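/- Let $k\ge 3$ and let $Y_k=\{o\}\cup\bigcup_{i=1}^k R_i$, where $R_i=\{r_{i,m}: m=1,2,\dots\}$ are disjoint rays. The Houghton group $\mathcal H_k$ is the group of all permutations $g$ of $Y_k$ which are eventual translations on each ray, that is, for which there are integers $m_1,\dots,m_k$ with $g(r_{i,n})=r_{i,n+m_i}$ for all $i$ and all large $n$. For $1\le i<j\le k$ let $h_{i,j}\in\mathcal H_k$ be the translation by $1$ along the copy of $\mathbb Z$ obtained by setting $0=o$, $-n=r_{i,n}$, $n=r_{j,n}$ ($n\ge 1$), fixing all other points. For a symmetric probability measure $\phi$ on a group $G$, put $\mathcal E_\phi(f,f)=\frac12\sum_{x,y\in G}|f(yx)-f(x)|^2\phi(y)$, and let $$\Lambda_{2,G,\phi}(v)=\inf\{\mathcal E_\phi(f,f): \mathrm{support}(f)\subset\Omega,\ \|f\|_2=1,\ \Omega\subset G,\ |\Omega|\le v\}$$ be its spectral profile (equal to $+\infty$ for $v<1$ and finite for $v\ge 1$). For $\alpha\in(0,\infty)\cup\{\mathfrak s,\mathfrak t\}$ define a symmetric probability measure $\xi_\alpha$ on $\mathbb Z$ and a function $\rho_\alpha$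 on $(0,1]$ by $$\xi_\alpha(m)=\begin{cases}c_\alpha(1+|m|)^{-\alpha-1}&\alpha\in(0,\infty)\\ \frac13\mathbf 1_{\{-1,0,1\}}(m)&\alpha=\mathfrak s\\ \delta_0(m)&\alpha=\mathfrak t,\end{cases}\qquad \rho_\alpha(s)=\begin{cases}s^{-1/\alpha}&\alpha\in(0,2)\\ s^{-1/2}[1+\log(1/s)]^{1/2}&\alpha=2\\ s^{-1/2}&\alpha\in(2,\infty)\cup\{\mathfrak s\}\\ 0&\alpha=\mathfrak t,\end{cases}$$ where $c_\alpha$ is the normalizing constant. Given $\alpha_{i,j}\in(0,\infty)\cup\{\mathfrak s,\mathfrak t\}$, $1\le i<j\le k$, of which at least two (for two different pairs $(i,j)$) are different from $\mathfrak t$, let $$q(g)=\binom k2^{-1}\sum_{1\le i<j\le k}\sum_{n\in\mathbb Z}\xi_{\alpha_{i,j}}(n)\mathbf 1_{\{h_{i,j}^n\}}(g),\quad g\in\mathcal H_k,\qquad \rho(s)=\max_{1\le i<j\le k}\rho_{\alpha_{i,j}}(s),$$ and $\rho^{-1}(t)=\inf\{s>0:\rho(s)\le t\}$. Then $$\Lambda_{2,\mathcal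 H_k,q}(v)\simeq\rho^{-1}\left(\frac{\log(1+v)}{\log(1+\log(1+v))}\right).$$ Moreover, for every finitely supported symmetric probability measure $\phi$ on $\mathcal H_k$ whose support generates $\mathcal H_k$, $$\Lambda_{2,\mathcal H_k,\phi}(v)\simeq\left(\frac{\log(1+v)}{\log(1+\log(1+v))}\right)^{-2}.$$ Here $\Lambda(v)\simeq F(v)$ means that there are constants $c_1,c_2,c_3,c_4\in(0,\infty)$ such that $c_1F(c_2v)\le\Lambda(v)$ for all $v>0$ and $\Lambda(v)\le c_3F(c_4v)$ for all $v\ge 1$; the constants may depend on $k$ and on the measure $q$ (respectively $\phi$). -/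

import Mathlib

open scoped ENNReal

noncomputable section

/-! ### The star `Y_k` and the Houghton group -/

/-- The star `Y_k` made of `k` rays glued at their common origin: `none` is the centre `o`, and
`some (i, n)` is the point `r_{i,n+1}` at distance `n + 1` from `o` on the ray `R_i`. -/
abbrev HStar (k : ℕ) : Type := Option (Fin k × ℕ)

/-- `g` acts on each ray `R_i`, far away from the centre, as the translation by the integer `m i`
(positive numbers being translations away from the centre). -/
def EventuallyTranslatesBy {k : ℕ} (g : HStar k → HStar k) (m : Fin k → ℤ) : Prop :=
  ∃ N : ℕ, ∀ (i : Fin k) (n : ℕ), N ≤ n →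
    ∃ n' : ℕ, (n' : ℤ) = (n : ℤ) + m i ∧ g (some (i, n)) = some (i, n')

theorem EventuallyTranslatesBy.comp {k : ℕ} {g g' : HStar k → HStar k} {m m' : Fin k → ℤ}
    (h : EventuallyTranslatesBy g m) (h' : EventuallyTranslatesBy g' m') :
    EventuallyTranslatesBy (g ∘ g') (m' + m) := by
  obtain ⟨N, hN⟩ := h
  obtain ⟨N', hN'⟩ := h'
  refine ⟨N' + N + ∑ i, (m' i).natAbs, fun i n hn => ?_⟩
  have hle : (m' i).natAbs ≤ ∑ i, (m' i).natAbs :=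
    Finset.single_le_sum (f := fun i => (m' i).natAbs) (fun _ _ => Nat.zero_le _)
      (Finset.mem_univ i)
  obtain ⟨n₁, e₁, h₁⟩ := hN' i n (by omega)
  obtain ⟨n₂, e₂, h₂⟩ := hN i n₁ (by omega)
  refine ⟨n₂, ?_, ?_⟩
  · simp only [Pi.add_apply]; omega
  · simp [h₁, h₂]

theorem EventuallyTranslatesBy.inv {k : ℕ} {g : Equiv.Perm (HStar k)} {m : Fin k → ℤ}
    (h : EventuallyTranslatesBy g m) : EventuallyTranslatesBy (⇑g⁻¹) (-m) := by
  obtain ⟨N, hN⟩ := h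
  refine ⟨N + ∑ i, (m i).natAbs, fun i n hn => ?_⟩
  have hle : (m i).natAbs ≤ ∑ i, (m i).natAbs :=
    Finset.single_le_sum (f := fun i => (m i).natAbs) (fun _ _ => Nat.zero_le _)
      (Finset.mem_univ i)
  obtain ⟨n', e', h'⟩ := hN i ((n : ℤ) - m i).toNat (by omega)
  refine ⟨((n : ℤ) - m i).toNat, ?_, ?_⟩
  · simp only [Pi.neg_apply]; omega
  · have : n' = n := by omega
    rw [Equiv.Perm.inv_eq_iff_eq, h', this]

/-- The Houghton group `H_k`: all permutations of `Y_k` which are eventual translations on each of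
the `k` rays. -/
def houghtonGroup (k : ℕ) : Subgroup (Equiv.Perm (HStar k)) where
  carrier := {g | ∃ m : Fin k → ℤ, EventuallyTranslatesBy g m}
  mul_mem' := by
    rintro g g' ⟨m, hm⟩ ⟨m', hm'⟩
    exact ⟨m' + m, hm.comp hm'⟩
  one_mem' := ⟨0, 0, fun i n _ => ⟨n, by simp, rfl⟩⟩
  inv_mem' := by
    rintro g ⟨m, hm⟩
    exact ⟨-m, hm.inv⟩

/-- One step along the line obtained from the rays `R_i` and `R_j` (`i ≠ j`) by setting `0 = o`,
`-n = r_{i,n}` and `n = r_{j,n}` for `n ≥ 1`: towards the centre on `R_i`, away from it on `R_j`,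
all the other points of `Y_k` being fixed. -/
def lineStep {k : ℕ} (i j : Fin k) : HStar k → HStar k
  | none => some (j, 0)
  | some (a, n) =>
    if a = j then some (j, n + 1)
    else if a = i then (match n with
      | 0 => none
      | n + 1 => some (i, n))
    else some (a, n)

theorem lineStep_lineStep {k : ℕ} {i j : Fin k} (hij : i ≠ j) (y : HStar k) :
    lineStep j i (lineStep i j y) = y := by
  rcases y with _ | ⟨a, n⟩
  · simp [lineStep, hij.symm]
  · by_cases hj : a = j
    · subst hj; simp [lineStep, hij.symm]
    · by_cases hi : a = i
      · subst hi
        cases n <;> simp [lineStep, hij]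
      · simp [lineStep, hi, hj]

/-- `lineStep i j` as a permutation of `Y_k`, for `i ≠ j`. -/
def linePerm {k : ℕ} (i j : Fin k) (hij : i ≠ j) : Equiv.Perm (HStar k) where
  toFun := lineStep i j
  invFun := lineStep j i
  left_inv := lineStep_lineStep hij
  right_inv := lineStep_lineStep hij.symm

theorem linePerm_mem {k : ℕ} (i j : Fin k) (hij : i ≠ j) :
    linePerm i j hij ∈ houghtonGroup k := by
  refine ⟨fun a => if a = j then 1 else if a = i then -1 else 0, 1, fun a n hn => ?_⟩
  obtain ⟨n, rfl⟩ : ∃ l, n = l + 1 := ⟨n - 1, by omega⟩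
  by_cases hj : a = j
  · subst hj
    exact ⟨n + 2, by simp; ring, by simp [linePerm, lineStep]⟩
  · by_cases hi : a = i
    · subst hi
      exact ⟨n, by simp [hj], by simp [linePerm, lineStep, hj]⟩
    · exact ⟨n + 1, by simp [hi, hj], by simp [linePerm, lineStep, hi, hj]⟩

/-- The pairs `(i, j)` of rays with `i < j`. There are `k.choose 2` of them. -/
abbrev RayPair (k : ℕ) : Type := {e : Fin k × Fin k // e.1 < e.2}

/-- The element `h_{i,j}` of the Houghton group, `i < j`. -/
def houghtonGen {k : ℕ} (e : RayPair k) : houghtonGroup k :=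
  ⟨linePerm e.1.1 e.1.2 e.2.ne, linePerm_mem _ _ _⟩

/-- For a family `p` of probability measures on `ℤ` indexed by the pairs `i < j`, the measure
`q_p(g) = (k choose 2)⁻¹ ∑_{i<j} ∑_{n ∈ ℤ} p_{i,j}(n) 1_{h_{i,j}^n}(g)` on the Houghton group. -/
def houghtonMeasure {k : ℕ} (p : RayPair k → ℤ → ℝ) (g : houghtonGroup k) : ℝ :=
  open Classical in
  ((k.choose 2 : ℕ) : ℝ)⁻¹ * ∑ e : RayPair k, ∑' n : ℤ, if g = houghtonGen e ^ n then p e n else 0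

/-! ### Dirichlet forms and spectral profiles -/

section Profile

variable {G : Type*} [Group G]

/-- `φ` is (the density of) a symmetric probability measure on the discrete group `G`. -/
structure IsSymmProb (φ : G → ℝ) : Prop where
  nonneg : ∀ g, 0 ≤ φ g
  hasSum : HasSum φ 1
  symm : ∀ g, φ g⁻¹ = φ g

/-- The Dirichlet form `E_φ(f,f) = (1/2) ∑_{x,y} |f(yx) - f(x)|² φ(y)`, with values in `[0,∞]`. -/
def dirichletForm (φ : G → ℝ) (f : G → ℝ) : ℝ≥0∞ :=
  (1 / 2) * ∑' x : G, ∑' y : G, ENNReal.ofReal (|f (y * x) - f x| ^ 2 * φ y)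

/-- `λ_φ(Ω) = inf {E_φ(f,f) : support f ⊆ Ω, ‖f‖₂ = 1}` for a finite subset `Ω` of `G`. -/
def dirichletEigenvalue (φ : G → ℝ) (Ω : Finset G) : ℝ≥0∞ :=
  ⨅ (f : G → ℝ) (_ : Function.support f ⊆ (Ω : Set G)) (_ : ∑ x ∈ Ω, f x ^ 2 = 1),
    dirichletForm φ f

/-- The spectral profile (`L²`-isoperimetric profile)
`Λ_{2,G,φ}(v) = inf {λ_φ(Ω) : |Ω| ≤ v}`. It is `∞` exactly where no non-empty `Ω` is allowed,
that is, for `v < 1`. -/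
def spectralProfile (φ : G → ℝ) (v : ℝ) : ℝ≥0∞ :=
  ⨅ (Ω : Finset G) (_ : (Ω.card : ℝ) ≤ v), dirichletEigenvalue φ Ω

end Profile

/-- `Λ ≃ F` for a profile `Λ` and a non-negative function `F` on `(0,∞)`: there are positive
constants with `c₁ F(c₂ v) ≤ Λ(v) ≤ c₃ F(c₄ v)`. The upper bound is asked for on `[1,∞)`, the set
where a spectral profile is finite. -/
def ProfileEquiv (Λ : ℝ → ℝ≥0∞) (F : ℝ → ℝ) : Prop :=
  ∃ c₁ c₂ c₃ c₄ : ℝ, 0 < c₁ ∧ 0 < c₂ ∧ 0 < c₃ ∧ 0 < c₄ ∧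
    (∀ v : ℝ, 0 < v → ENNReal.ofReal (c₁ * F (c₂ * v)) ≤ Λ v) ∧
    (∀ v : ℝ, 1 ≤ v → Λ v ≤ ENNReal.ofReal (c₃ * F (c₄ * v)))

/-- The inverse `t ↦ inf {s > 0 : f s ≤ t}` of a non-increasing function `f`. -/
def decrInverse (f : ℝ → ℝ) (t : ℝ) : ℝ := sInf {s : ℝ | 0 < s ∧ f s ≤ t}

/-- The function `v ↦ log(1+v) / log(1+log(1+v))`, which is greater than `1` for `v > 0`. -/
def logRatio (v : ℝ) : ℝ := Real.log (1 + v) / Real.log (1 + Real.log (1 + v))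

/-! ### The measures `ξ_α` and the functions `ρ_α` -/

/-- The set `(0,∞) ∪ {𝔰, 𝔱}` of indices: a positive real number (power law), `simple`, `trivial`. -/
inductive StepIndex : Type
  | power (α : ℝ) (hα : 0 < α) : StepIndex
  | simple : StepIndex
  | trivial : StepIndex

/-- The symmetric probability measures `ξ_α` on `ℤ`; in the first case the series is the
inverse `1 / c_α` of the normalizing constant. -/
def stepMeasure : StepIndex → ℤ → ℝ
  | .power α _, m => (∑' l : ℤ, (1 + |(l : ℝ)|) ^ (-α - 1))⁻¹ * (1 + |(m : ℝ)|) ^ (-α - 1)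
  | .simple, m => if m = -1 ∨ m = 0 ∨ m = 1 then 1 / 3 else 0
  | .trivial, m => if m = 0 then 1 else 0

/-- The functions `ρ_α`, to be used on `(0,1]`. -/
def stepRho : StepIndex → ℝ → ℝ
  | .power α _, s =>
    if α < 2 then s ^ (-1 / α)
    else if α = 2 then s ^ (-1 / 2 : ℝ) * (1 + Real.log (1 / s)) ^ (1 / 2 : ℝ)
    else s ^ (-1 / 2 : ℝ)
  | .simple, s => s ^ (-1 / 2 : ℝ)
  | .trivial, _ => 0

/-- `ρ(s) = max_{i<j} ρ_{α_{i,j}}(s)`. -/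
def maxRho {k : ℕ} (α : RayPair k → StepIndex) (s : ℝ) : ℝ := ⨆ e : RayPair k, stepRho (α e) s

end

/-!
The upper and the lower bounds concern one scale `n`, related to the volume `v` by
`log v ≍ n log n`, that is, `n ≍ logRatio v`. Both are stated through `energy f y`, the squared
`ℓ²`-distance between `f` and its translate by `y`, of which the Dirichlet forms are averages.

**Lower bound.** Take two different lines, translations `h` and `g` along them, and a commutator
`σ` of `h` and `g`. It is a transposition or a `3`-cycle, and both `σ` and `σ⁻¹` send a certain point
`z` outside the first line to that line. The conjugates `κ_a` of `σ` by the powers `h^(La)`, with `L`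
large, move `z` to points which no other `κ_b` moves (`exists_conj_commutator`), so a product
of distinct `κ_a`'s determines its factors. Hence a finite set which keeps half of its points
under the `κ_a`, `a ≤ 4d`, on average, contains the end points of at least `d!` different paths
(`factorial_le_card_of_forall_card_le`, after discarding the points with few neighbours in
`exists_subset_forall_card_le`). By a co-area inequality and Cheeger's argument, functions
supported by fewer than `d!` points have `κ_a`-energies comparable with their squared norm
(`sum_energy_ge_of_card_lt_factorial`). No loss occurs in Cheeger's inequality, because the
isoperimetric constant here does not depend on `d`. The energies along `κ_a` are bounded by those
along `h^(La)` and along the generators, and one-dimensional averaging bounds the energies along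
`h^a`, `a ≤ n`, by the Dirichlet form of `ξ_α` along `h`, with the factor `1 / stepRate α n`
(`exists_stepRate_mul_energy_le`; for `α = 2` all the scales up to `n` contribute equally, whence
the logarithm). As `stepRate α` is the inverse function of `ρ_α` up to constants, this is the lower
bound for each nontrivial line, and the largest of these bounds is the one that is claimed.

**Upper bound.** The test function `tent` lives on the set of the `g` which are translations, of
length less than `n`, beyond the distance `R ≍ n` from the centre; this set has at most
`exp (C n log n)` elements. The function is a tent function of the vector of the translations
of `g`, so its energies are those of a tent function on a lattice: along `h^l` they are at
most a constant times `min 1 ((l / n)²)` times the squared norm. Comparing the squared norm with the size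
of the set needs that a positive proportion of the set has translation vectors of length at most
`n / 2` (`card_translationSet_le_mul_card_half`). Summation against `ξ_α`
(`exists_tsum_stepMeasure_mul_min_le`) gives the rate `stepRate α n` again. For a finitely supported
measure each energy is `O(n⁻²)` times the squared norm.
-/

open scoped ENNReal

noncomputable section

/-! ### The energy of a finitely supported function along one group element -/

section Energy

variable {G : Type*} [Group G]

/-- The squared `ℓ²`-distance `∑_x |f(yx) - f(x)|²` between `f` and its translate by `y`. -/
def energy (f : G → ℝ) (y : G) : ℝ := ∑' x : G, (f (y * x) - f x) ^ 2

theorem summable_energy {f : G → ℝ} (hf : (Function.support f).Finite) (y : G) :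
    Summable fun x : G => (f (y * x) - f x) ^ 2 := by
  refine summable_of_hasFiniteSupport ?_
  refine ((hf.preimage ((mul_right_injective y).injOn)).union hf).subset fun x hx => ?_
  by_contra h
  simp only [Set.mem_union, Set.mem_preimage, Function.mem_support, not_or, not_not] at h
  simp [h.1, h.2] at hx

theorem energy_nonneg (f : G → ℝ) (y : G) : 0 ≤ energy f y := tsum_nonneg fun _ => sq_nonneg _

theorem energy_one (f : G → ℝ) : energy f 1 = 0 := by simp [energy]

theorem energy_inv (f : G → ℝ) (y : G) : energy f y⁻¹ = energy f y := by
  refine ((Equiv.mulLeft y).tsum_eq fun x => (f (y⁻¹ * x) - f x) ^ 2).symm.trans ?_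
  refine tsum_congr fun x => ?_
  simp only [Equiv.coe_mulLeft, inv_mul_cancel_left]
  ring

theorem energy_mul_le {f : G → ℝ} (hf : (Function.support f).Finite) (y z : G) {t : ℝ}
    (ht : 0 < t) : energy f (y * z) ≤ (1 + t) * energy f y + (1 + t⁻¹) * energy f z := by
  have h1 : energy f y = ∑' x : G, (f (y * (z * x)) - f (z * x)) ^ 2 :=
    ((Equiv.mulLeft z).tsum_eq fun x => (f (y * x) - f x) ^ 2).symm
  have s1 : Summable fun x : G => (f (y * (z * x)) - f (z * x)) ^ 2 :=
    (Equiv.mulLeft z).summable_iff (f := fun x => (f (y * x) - f x) ^ 2) |>.mpr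
      (summable_energy hf y)
  have s2 := summable_energy hf z
  rw [h1]
  unfold energy
  rw [← tsum_mul_left, ← tsum_mul_left, ← (s1.mul_left _).tsum_add (s2.mul_left _)]
  refine (summable_energy hf (y * z)).tsum_le_tsum (fun x => ?_)
    ((s1.mul_left _).add (s2.mul_left _))
  rw [mul_assoc]
  set u := f (y * (z * x)) - f (z * x)
  set v := f (z * x) - f x
  have e : f (y * (z * x)) - f x = u + v := by simp [u, v]
  rw [e]
  have h : t * t⁻¹ = 1 := mul_inv_cancel₀ ht.ne'
  have h0 : 0 ≤ t⁻¹ * (t * u - v) ^ 2 := by positivity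
  have : t⁻¹ * (t * u - v) ^ 2 = t * u ^ 2 + t⁻¹ * v ^ 2 - 2 * u * v := by
    field_simp
    ring
  nlinarith

theorem energy_mul_le_two {f : G → ℝ} (hf : (Function.support f).Finite) (y z : G) :
    energy f (y * z) ≤ 2 * energy f y + 2 * energy f z := by
  have := energy_mul_le hf y z one_pos
  norm_num at this
  linarith

theorem energy_pow_le {f : G → ℝ} (hf : (Function.support f).Finite) (y : G) (q : ℕ) :
    energy f (y ^ q) ≤ (q : ℝ) ^ 2 * energy f y := by
  induction q with
  | zero => simp [energy_one]
  | succ q ih =>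
    rcases Nat.eq_zero_or_pos q with rfl | hq
    · simp
    have hq' : (0 : ℝ) < q := by exact_mod_cast hq
    -- the weights `1 + 1/q` and `1 + q` turn `q²` into `(q + 1)²`
    have h := energy_mul_le hf (y ^ q) y (inv_pos.mpr hq')
    rw [← pow_succ, inv_inv] at h
    have h2 : (1 + (q : ℝ)⁻¹) * energy f (y ^ q) ≤ (1 + (q : ℝ)⁻¹) * ((q : ℝ) ^ 2 * energy f y) := by
      gcongr
    have h3 : (1 + (q : ℝ)⁻¹) * ((q : ℝ) ^ 2 * energy f y) = ((q : ℝ) ^ 2 + q) * energy f y := by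
      field_simp
    push_cast
    nlinarith

theorem tsum_sq_eq_sum {X : Type*} {f : X → ℝ} {Ω : Finset X} (hf : Function.support f ⊆ Ω) :
    ∑' x, f x ^ 2 = ∑ x ∈ Ω, f x ^ 2 := by
  refine tsum_eq_sum fun x hx => ?_
  have : f x = 0 := by
    by_contra h
    exact hx (hf h)
  simp [this]

theorem energy_le_four {f : G → ℝ} {Ω : Finset G} (hf : Function.support f ⊆ Ω) (y : G) :
    energy f y ≤ 4 * ∑ x ∈ Ω, f x ^ 2 := by
  have hfin : (Function.support f).Finite := Ω.finite_toSet.subset hf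
  have s2 : Summable fun x => f x ^ 2 := by
    refine summable_of_hasFiniteSupport (hfin.subset fun x hx => ?_)
    intro h
    simp [h] at hx
  have s1 : Summable fun x => f (y * x) ^ 2 := (Equiv.mulLeft y).summable_iff.mpr s2
  have e1 : ∑' x, f (y * x) ^ 2 = ∑' x, f x ^ 2 :=
    (Equiv.mulLeft y).tsum_eq fun x => f x ^ 2
  calc energy f y ≤ ∑' x, (2 * f (y * x) ^ 2 + 2 * f x ^ 2) :=
        (summable_energy hfin y).tsum_le_tsum
          (fun x => by nlinarith [sq_nonneg (f (y * x) + f x)])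
          ((s1.mul_left _).add (s2.mul_left _))
    _ = 4 * ∑ x ∈ Ω, f x ^ 2 := by
        rw [(s1.mul_left _).tsum_add (s2.mul_left _), tsum_mul_left, tsum_mul_left, e1,
          tsum_sq_eq_sum hf]
        ring

theorem dirichletForm_eq {φ : G → ℝ} (hφ : ∀ g, 0 ≤ φ g) {f : G → ℝ}
    (hf : (Function.support f).Finite) :
    dirichletForm φ f = (1 / 2) * ∑' y : G, ENNReal.ofReal (φ y) * ENNReal.ofReal (energy f y) := by
  unfold dirichletForm
  rw [ENNReal.tsum_comm]
  congr 1
  refine tsum_congr fun y => ?_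
  unfold energy
  rw [ENNReal.ofReal_tsum_of_nonneg (fun _ => sq_nonneg _) (summable_energy hf y)]
  rw [← ENNReal.tsum_mul_left]
  refine tsum_congr fun x => ?_
  rw [← ENNReal.ofReal_mul (hφ y), sq_abs, mul_comm]

theorem dirichletForm_const_mul (φ : G → ℝ) (f : G → ℝ) (c : ℝ) :
    dirichletForm φ (fun x => c * f x) = ENNReal.ofReal (c ^ 2) * dirichletForm φ f := by
  unfold dirichletForm
  rw [mul_left_comm]
  congr 1
  rw [← ENNReal.tsum_mul_left]
  refine tsum_congr fun x => ?_
  rw [← ENNReal.tsum_mul_left]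
  refine tsum_congr fun y => ?_
  rw [← ENNReal.ofReal_mul (sq_nonneg c), ← mul_sub, abs_mul, mul_pow, sq_abs c, mul_assoc]

/-- A test function on a set with at most `v` elements bounds the spectral profile at `v`. -/
theorem spectralProfile_le_of_dirichletForm_le {φ : G → ℝ} {f : G → ℝ} {Ω : Finset G} {v B : ℝ}
    (hf : Function.support f ⊆ Ω) (hΩ : (Ω.card : ℝ) ≤ v) (hpos : 0 < ∑ x ∈ Ω, f x ^ 2)
    (h : dirichletForm φ f ≤ ENNReal.ofReal (B * ∑ x ∈ Ω, f x ^ 2)) :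
    spectralProfile φ v ≤ ENNReal.ofReal B := by
  set s := ∑ x ∈ Ω, f x ^ 2 with hs
  set c := (Real.sqrt s)⁻¹ with hc
  have hc2 : c ^ 2 = s⁻¹ := by rw [hc, inv_pow, Real.sq_sqrt hpos.le]
  refine (iInf₂_le Ω hΩ).trans ?_
  refine (iInf_le _ (fun x => c * f x)).trans ?_
  refine (iInf₂_le ?_ ?_).trans ?_
  · intro x hx
    apply hf
    intro h0
    simp [h0] at hx
  · simp_rw [mul_pow, ← Finset.mul_sum, hc2, ← hs]
    exact inv_mul_cancel₀ hpos.ne'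
  · rw [dirichletForm_const_mul, hc2]
    calc ENNReal.ofReal s⁻¹ * dirichletForm φ f
        ≤ ENNReal.ofReal s⁻¹ * ENNReal.ofReal (B * s) := by gcongr
      _ = ENNReal.ofReal B := by
        rw [← ENNReal.ofReal_mul (inv_nonneg.mpr hpos.le)]
        congr 1
        field_simp

theorem spectralProfile_of_lt_one (φ : G → ℝ) {v : ℝ} (hv : v < 1) : spectralProfile φ v = ⊤ := by
  unfold spectralProfile
  simp only [iInf_eq_top]
  intro Ω hΩ
  have : Ω = ∅ := by
    rw [← Finset.card_eq_zero]
    have : (Ω.card : ℝ) < 1 := hΩ.trans_lt hv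
    have : Ω.card < 1 := by exact_mod_cast this
    omega
  subst this
  simp [dirichletEigenvalue]

end Energy

/-! ### From isoperimetry to energy -/

section Isoperimetry

variable {X ι : Type*} [Fintype ι]

open Classical in
/-- A discrete co-area inequality: an isoperimetric inequality for all the subsets of `Ω`
extends to the non-negative functions supported in `Ω`. The induction peels off the level set
of the least positive value. -/
theorem coarea (κ : ι → X → X) (K : ℝ) (Ω : Finset X)
    (hK : ∀ A ⊆ Ω, A.Nonempty → K * A.card ≤ ∑ a, ((A.filter fun x => κ a x ∉ A).card : ℝ))
    (F : X → ℝ) (hF : ∀ x, 0 ≤ F x) (hsupp : Function.support F ⊆ Ω) :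
    K * ∑ x ∈ Ω, F x ≤ ∑ a, ∑ x ∈ Ω, max (F x - F (κ a x)) 0 := by
  induction hn : (Ω.filter fun x => F x ≠ 0).card using Nat.strong_induction_on
    generalizing F with
  | _ n ih =>
  set A := Ω.filter fun x => F x ≠ 0 with hA
  have memA : ∀ x, x ∈ A ↔ F x ≠ 0 := fun x => by
    rw [hA, Finset.mem_filter]
    exact ⟨fun h => h.2, fun h => ⟨hsupp h, h⟩⟩
  rcases A.eq_empty_or_nonempty with hemp | hne
  · have h0 : ∀ x, F x = 0 := fun x => by
      by_contra h
      rw [← ne_eq, ← memA, hemp] at h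
      simp at h
    simp [h0]
  obtain ⟨x₀, hx₀, hmin⟩ := A.exists_min_image F hne
  set t := F x₀ with ht
  have htpos : 0 < t := lt_of_le_of_ne (hF x₀) (Ne.symm ((memA x₀).mp hx₀))
  set F' : X → ℝ := fun x => F x - if x ∈ A then t else 0 with hF'
  have hF'0 : ∀ x, x ∉ A → F' x = 0 := fun x hx => by
    have : F x = 0 := by
      by_contra h
      exact hx ((memA x).mpr h)
    simp [hF', hx, this]
  have hF'nn : ∀ x, 0 ≤ F' x := fun x => by
    by_cases hx : x ∈ A
    · simp only [hF', hx, if_true]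
      linarith [hmin x hx]
    · rw [hF'0 x hx]
  have hs' : Function.support F' ⊆ Ω := fun x hx => by
    by_contra h
    exact hx (hF'0 x fun hxA => h (Finset.mem_filter.mp hxA).1)
  have hlt : (Ω.filter fun x => F' x ≠ 0).card < n := by
    rw [← hn]
    refine Finset.card_lt_card ⟨fun x hx => ?_, fun h => ?_⟩
    · by_contra hxA
      exact (Finset.mem_filter.mp hx).2 (hF'0 x hxA)
    · have := (Finset.mem_filter.mp (h hx₀)).2
      simp [hF', hx₀, ht] at this
  have key := ih _ hlt F' hF'nn hs' rfl
  have hKA := hK A (Finset.filter_subset _ _) hne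
  have e1 : ∑ x ∈ Ω, F x = ∑ x ∈ Ω, F' x + t * A.card := by
    have : ∀ x, F x = F' x + if x ∈ A then t else 0 := fun x => by simp [hF']
    rw [Finset.sum_congr rfl fun x _ => this x, Finset.sum_add_distrib, ← Finset.sum_filter]
    have : (Ω.filter fun x => x ∈ A) = A := by
      ext x
      simp only [Finset.mem_filter]
      exact ⟨fun h => h.2, fun h => ⟨(Finset.mem_filter.mp h).1, h⟩⟩
    rw [this, Finset.sum_const, nsmul_eq_mul, mul_comm]
  have e2 : ∀ a, ∑ x ∈ Ω, max (F x - F (κ a x)) 0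
      = ∑ x ∈ Ω, max (F' x - F' (κ a x)) 0 + t * (A.filter fun x => κ a x ∉ A).card := by
    intro a
    have : ∀ x, max (F x - F (κ a x)) 0
        = max (F' x - F' (κ a x)) 0 + if x ∈ A ∧ κ a x ∉ A then t else 0 := by
      intro x
      by_cases hx : x ∈ A <;> by_cases hy : κ a x ∈ A
      · simp [hF', hx, hy]
      · have h0 : F (κ a x) = 0 := by
          by_contra h
          exact hy ((memA _).mpr h)
        have := hmin x hx
        simp only [hF', hx, hy, h0, if_true, if_false, not_false_eq_true, and_self, sub_zero]
        rw [max_eq_left (by linarith), max_eq_left (by linarith)]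
        ring
      · have h0 : F x = 0 := by
          by_contra h
          exact hx ((memA _).mpr h)
        have h1 := hF'nn (κ a x)
        have h2 := hF (κ a x)
        rw [hF'0 x hx, h0, max_eq_right (by linarith), max_eq_right (by linarith)]
        simp [hx]
      · have h0 : F x = 0 := by
          by_contra h
          exact hx ((memA _).mpr h)
        have h1 : F (κ a x) = 0 := by
          by_contra h
          exact hy ((memA _).mpr h)
        simp [hF', hx, hy, h0, h1]
    rw [Finset.sum_congr rfl fun x _ => this x, Finset.sum_add_distrib, ← Finset.sum_filter]
    have : (Ω.filter fun x => x ∈ A ∧ κ a x ∉ A) = A.filter fun x => κ a x ∉ A := by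
      ext x
      simp only [Finset.mem_filter]
      exact ⟨fun h => h.2, fun h => ⟨(Finset.mem_filter.mp h.1).1, h⟩⟩
    rw [this, Finset.sum_const, nsmul_eq_mul, mul_comm]
  rw [e1, Finset.sum_congr rfl fun a _ => e2 a, Finset.sum_add_distrib, ← Finset.mul_sum]
  nlinarith [mul_le_mul_of_nonneg_left hKA htpos.le]

open Classical in
/-- Cheeger's inequality for a family of translations: if every non-empty subset `A` of `Ω` loses
at least the proportion `η` of its elements on average, then so do the functions on `Ω`, in the
sense of energies, with `η` replaced by `η² / 4`. -/
theorem sum_energy_ge_of_isoperimetry {G : Type*} [Group G] (κ : ι → G) {η : ℝ} (hη : 0 < η)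
    (Ω : Finset G)
    (hK : ∀ A ⊆ Ω, A.Nonempty →
      η * Fintype.card ι * A.card ≤ ∑ a, ((A.filter fun x => κ a * x ∉ A).card : ℝ))
    (f : G → ℝ) (hf : Function.support f ⊆ Ω) :
    η ^ 2 / 4 * Fintype.card ι * ∑ x ∈ Ω, f x ^ 2 ≤ ∑ a, energy f (κ a) := by
  have h := coarea (fun a x => κ a * x) (η * Fintype.card ι) Ω hK (fun x => f x ^ 2)
    (fun x => sq_nonneg _) (fun x hx => hf fun h0 => by simp [h0] at hx)
  have hfin : (Function.support f).Finite := Ω.finite_toSet.subset hf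
  have hpt : ∀ u w : ℝ, max (u ^ 2 - w ^ 2) 0 ≤ η / 2 * u ^ 2 + 2 / η * (w - u) ^ 2 := by
    intro u w
    refine max_le ?_ (by positivity)
    have h0 : 0 ≤ 2 / η * (η / 2 * u + (w - u)) ^ 2 := by positivity
    have : 2 / η * (η / 2 * u + (w - u)) ^ 2
        = η / 2 * u ^ 2 + 2 / η * (w - u) ^ 2 + 2 * u * (w - u) := by
      field_simp
      ring
    nlinarith [sq_nonneg (w - u)]
  have hle : ∀ a, ∑ x ∈ Ω, max (f x ^ 2 - f (κ a * x) ^ 2) 0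
      ≤ η / 2 * ∑ x ∈ Ω, f x ^ 2 + 2 / η * energy f (κ a) := by
    intro a
    calc _ ≤ ∑ x ∈ Ω, (η / 2 * f x ^ 2 + 2 / η * (f (κ a * x) - f x) ^ 2) :=
          Finset.sum_le_sum fun x _ => hpt _ _
      _ ≤ _ := by
          rw [Finset.sum_add_distrib, ← Finset.mul_sum, ← Finset.mul_sum]
          gcongr
          exact (summable_energy hfin (κ a)).sum_le_tsum _ fun _ _ => sq_nonneg _
  have h2 := h.trans (Finset.sum_le_sum fun a _ => hle a)
  rw [Finset.sum_add_distrib, ← Finset.mul_sum (f := fun a => energy f (κ a)), Finset.sum_const, Finset.card_univ,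
    nsmul_eq_mul] at h2
  set S := ∑ x ∈ Ω, f x ^ 2
  set E := ∑ a, energy f (κ a)
  set N : ℝ := (Fintype.card ι : ℝ)
  have h3 : η / 2 * N * S ≤ 2 / η * E := by linarith
  have h4 := mul_le_mul_of_nonneg_left h3 (half_pos hη).le
  have h5 : η / 2 * (2 / η * E) = E := by field_simp
  rw [h5] at h4
  calc _ = η / 2 * (η / 2 * N * S) := by ring
    _ ≤ E := h4

end Isoperimetry

/-! ### Sets with small boundary for a family of translations are large -/

section Growth

variable {G ι : Type*} [Group G] [Fintype ι]

open Classical in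
/-- A finite set that keeps more than half of its points on average under the translations by the
`κ a` has a non-empty subset in which every point has a neighbour for at least a quarter of the
indices `a`. It is found as a maximizer of the number of internal edges minus half the number of
all outgoing edges: the removal of one point does not increase this quantity. -/
theorem exists_subset_forall_card_le (κ : ι → G) (A : Finset G)
    (hA : 2 * ∑ a, (A.filter fun x => κ a * x ∉ A).card < Fintype.card ι * A.card) :
    ∃ B ⊆ A, B.Nonempty ∧ ∀ x ∈ B, Fintype.card ι
      ≤ 4 * (Finset.univ.filter fun a => κ a * x ∈ B ∨ (κ a)⁻¹ * x ∈ B).card := by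
  set e : Finset G → ℕ := fun B => ∑ a, (B.filter fun x => κ a * x ∈ B).card with he
  have eA : e A + ∑ a, (A.filter fun x => κ a * x ∉ A).card = Fintype.card ι * A.card := by
    rw [he, ← Finset.sum_add_distrib]
    simp_rw [Finset.card_filter_add_card_filter_not]
    simp
  obtain ⟨B, hBA, hmax⟩ := A.powerset.exists_max_image
    (fun B => 2 * (e B : ℤ) - Fintype.card ι * B.card) ⟨A, by simp⟩
  rw [Finset.mem_powerset] at hBA
  have hpos : 0 < 2 * (e A : ℤ) - Fintype.card ι * A.card := by
    zify at eA hA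
    linarith
  have hBpos := hpos.trans_le (hmax A (by simp))
  refine ⟨B, hBA, ?_, fun x hx => ?_⟩
  · by_contra h
    rw [Finset.not_nonempty_iff_eq_empty] at h
    simp [h, he] at hBpos
  have h1 := hmax (B.erase x) (by
    rw [Finset.mem_powerset]
    exact (Finset.erase_subset _ _).trans hBA)
  set D := Finset.univ.filter fun a => κ a * x ∈ B ∨ (κ a)⁻¹ * x ∈ B with hD
  have h2 : e B ≤ e (B.erase x) + 2 * D.card := by
    have hD2 : 2 * D.card = ∑ a, if a ∈ D then 2 else 0 := by
      rw [← Finset.sum_filter]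
      simp [mul_comm]
    rw [he, hD2, ← Finset.sum_add_distrib]
    refine Finset.sum_le_sum fun a _ => ?_
    have hsub : (B.filter fun y => κ a * y ∈ B) ⊆
        ((B.erase x).filter fun y => κ a * y ∈ B.erase x) ∪
          (if a ∈ D then {x, (κ a)⁻¹ * x} else ∅) := by
      intro y hy
      rw [Finset.mem_filter] at hy
      rw [Finset.mem_union, Finset.mem_filter]
      by_cases h3 : y = x
      · subst h3
        right
        rw [if_pos (by simp [hD, hy.2])]
        simp
      by_cases h4 : κ a * y = x
      · right
        have : (κ a)⁻¹ * x = y := by rw [← h4, inv_mul_cancel_left]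
        rw [if_pos (by simp [hD, this, hy.1])]
        simp [this]
      · left
        simp [h3, h4, hy.1, hy.2]
    refine (Finset.card_le_card hsub).trans ((Finset.card_union_le _ _).trans ?_)
    gcongr
    split_ifs
    · exact Finset.card_le_two
    · simp
  have h3 : (B.erase x).card + 1 = B.card := Finset.card_erase_add_one hx
  zify at h2 h3
  rw [← h3] at h1
  have : (Fintype.card ι : ℤ) ≤ 4 * D.card := by nlinarith
  exact_mod_cast this

variable {Y : Type*} [MulAction G Y]

open Classical in
/-- Let the `κ a` move a point `z` to places that no other `κ b` moves. Then the product of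
distinct `κ a`'s determines its factors, since the first factor can be read off from the image of
`z`. So a set in which every point has `d` neighbours has at least `d!` elements: from a given point
there are that many end points of paths which use each `κ a` at most once. -/
theorem factorial_le_card_of_forall_card_le (κ : ι → G) (z : Y) (hz : ∀ a, κ a • z ≠ z)
    (hfix : ∀ a b, a ≠ b → κ b • κ a • z = κ a • z ∧ κ b • (κ a)⁻¹ • z = (κ a)⁻¹ • z)
    (B : Finset G) (hB : B.Nonempty) (d : ℕ)
    (hd : ∀ g ∈ B, d ≤ (Finset.univ.filter fun a => κ a * g ∈ B ∨ (κ a)⁻¹ * g ∈ B).card) :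
    d.factorial ≤ B.card := by
  have key : ∀ (m : ℕ) (S : Finset ι), m + S.card ≤ d → ∀ g ∈ B, ∃ W : Finset G,
      (∀ w ∈ W, w * g ∈ B) ∧
      (∀ w ∈ W, ∀ s ∈ S, ∀ k, k = κ s ∨ k = (κ s)⁻¹ → w • k • z = k • z) ∧
      m.factorial ≤ W.card := by
    intro m
    induction m with
    | zero => exact fun S _ g hg => ⟨{1}, by simp [hg], by simp, by simp⟩
    | succ m ih =>
      intro S hS g hg
      set T := (Finset.univ.filter fun a => κ a * g ∈ B ∨ (κ a)⁻¹ * g ∈ B) \ S with hT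
      have hTc : m + 1 ≤ T.card := by
        have := Finset.le_card_sdiff S
          (Finset.univ.filter fun a => κ a * g ∈ B ∨ (κ a)⁻¹ * g ∈ B)
        rw [← hT] at this
        have := hd g hg
        omega
      have hk : ∀ a : ι, ∃ k, (k = κ a ∨ k = (κ a)⁻¹) ∧ (a ∈ T → k * g ∈ B) := by
        intro a
        by_cases ha : a ∈ T
        · rw [hT, Finset.mem_sdiff, Finset.mem_filter] at ha
          rcases ha.1.2 with h | h
          · exact ⟨_, Or.inl rfl, fun _ => h⟩
          · exact ⟨_, Or.inr rfl, fun _ => h⟩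
        · exact ⟨_, Or.inl rfl, fun h => absurd h ha⟩
      choose k hk hkB using hk
      have hW : ∀ a : ι, ∃ W : Finset G, a ∈ T → (∀ w ∈ W, w * (k a * g) ∈ B) ∧
          (∀ w ∈ W, ∀ s ∈ insert a S, ∀ k, k = κ s ∨ k = (κ s)⁻¹ → w • k • z = k • z) ∧
          m.factorial ≤ W.card := by
        intro a
        by_cases ha : a ∈ T
        · have haS : a ∉ S := (Finset.mem_sdiff.mp ha).2
          obtain ⟨W, hW⟩ := ih (insert a S) (by rw [Finset.card_insert_of_notMem haS]; omega)
            (k a * g) (hkB a ha)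
          exact ⟨W, fun _ => hW⟩
        · exact ⟨∅, fun h => absurd h ha⟩
      choose W hW using hW
      refine ⟨T.biUnion fun a => (W a).image (· * k a), ?_, ?_, ?_⟩
      · intro w hw
        simp only [Finset.mem_biUnion, Finset.mem_image] at hw
        obtain ⟨a, ha, u, hu, rfl⟩ := hw
        rw [mul_assoc]
        exact (hW a ha).1 u hu
      · intro w hw s hs k' hk'
        simp only [Finset.mem_biUnion, Finset.mem_image] at hw
        obtain ⟨a, ha, u, hu, rfl⟩ := hw
        have hsa : s ≠ a := fun h => (Finset.mem_sdiff.mp ha).2 (h ▸ hs)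
        have hf : κ a • k' • z = k' • z := by
          rcases hk' with rfl | rfl
          · exact (hfix s a hsa).1
          · exact (hfix s a hsa).2
        have hf' : k a • k' • z = k' • z := by
          rcases hk a with h | h
          · rw [h, hf]
          · rw [h, inv_smul_eq_iff, hf]
        rw [mul_smul, hf']
        exact (hW a ha).2.1 u hu s (Finset.mem_insert_of_mem hs) k' hk'
      · rw [Finset.card_biUnion]
        · calc (m + 1).factorial = (m + 1) * m.factorial := Nat.factorial_succ m
            _ ≤ T.card * m.factorial := by gcongr
            _ = ∑ _a ∈ T, m.factorial := by simp
            _ ≤ _ := Finset.sum_le_sum fun a ha => by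
                rw [Finset.card_image_of_injective _ (mul_left_injective (k a))]
                exact (hW a ha).2.2
        · intro a ha b hb hab
          rw [Function.onFun, Finset.disjoint_left]
          intro w hwa hwb
          simp only [Finset.mem_image] at hwa hwb
          obtain ⟨u, hu, rfl⟩ := hwa
          obtain ⟨u', hu', he⟩ := hwb
          -- both factorizations send `z` to the point to which their first factor sends it
          have h1 : (u * k a) • z = k a • z := by
            rw [mul_smul]
            exact (hW a ha).2.1 u hu a (Finset.mem_insert_self _ _) _ (hk a)
          have h2 : (u' * k b) • z = k b • z := by
            rw [mul_smul]
            exact (hW b hb).2.1 u' hu' b (Finset.mem_insert_self _ _) _ (hk b)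
          rw [he, h1] at h2
          have h3 : κ b • k a • z = k a • z := by
            rcases hk a with h | h <;> rw [h]
            · exact (hfix a b hab).1
            · exact (hfix a b hab).2
          apply hz b
          rw [h2] at h3
          rcases hk b with h | h <;> rw [h] at h3
          · exact smul_left_cancel _ h3
          · rw [smul_inv_smul] at h3
            rw [eq_inv_smul_iff] at h3
            exact h3
  obtain ⟨g, hg⟩ := hB
  obtain ⟨W, hW, -, hc⟩ := key d ∅ (by simp) g hg
  refine hc.trans ?_
  rw [← Finset.card_image_of_injective W (mul_left_injective g)]
  refine Finset.card_le_card fun x hx => ?_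
  obtain ⟨w, hw, rfl⟩ := Finset.mem_image.mp hx
  exact hW w hw

/-- The energies along the `κ a` of a function supported by fewer than `d!` points. -/
theorem sum_energy_ge_of_card_lt_factorial (κ : ι → G) (z : Y) (hz : ∀ a, κ a • z ≠ z)
    (hfix : ∀ a b, a ≠ b → κ b • κ a • z = κ a • z ∧ κ b • (κ a)⁻¹ • z = (κ a)⁻¹ • z)
    (d : ℕ) (hd : Fintype.card ι = 4 * d) (Ω : Finset G) (hΩ : Ω.card < d.factorial)
    (f : G → ℝ) (hf : Function.support f ⊆ Ω) :
    d * ∑ x ∈ Ω, f x ^ 2 ≤ 4 * ∑ a, energy f (κ a) := by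
  classical
  have h := sum_energy_ge_of_isoperimetry κ (η := 1 / 2) (by norm_num) Ω ?_ f hf
  · rw [hd] at h
    push_cast at h
    linarith
  intro A hA hne
  by_contra hlt
  push Not at hlt
  have h2 : 2 * ∑ a, (A.filter fun x => κ a * x ∉ A).card < Fintype.card ι * A.card := by
    have : 2 * ∑ a, ((A.filter fun x => κ a * x ∉ A).card : ℝ) < Fintype.card ι * A.card := by
      linarith
    exact_mod_cast this
  obtain ⟨B, hBA, hB, hdeg⟩ := exists_subset_forall_card_le κ A h2
  have := factorial_le_card_of_forall_card_le κ z hz hfix B hB d fun g hg => by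
    have := hdeg g hg
    omega
  have := Finset.card_le_card (hBA.trans hA)
  omega

end Growth

/-! ### Commutators of translations along two lines -/

section Lines

variable {k : ℕ}

/-- The translation by `1` from the ray `R_i` to the ray `R_j`, as an element of the Houghton
group, for `i ≠ j` in either order. -/
def lineTrans (i j : Fin k) (hij : i ≠ j) : houghtonGroup k :=
  ⟨linePerm i j hij, linePerm_mem i j hij⟩

theorem lineTrans_smul (i j : Fin k) (hij : i ≠ j) (y : HStar k) :
    lineTrans i j hij • y = lineStep i j y := rfl

theorem lineTrans_inv (i j : Fin k) (hij : i ≠ j) :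
    (lineTrans i j hij)⁻¹ = lineTrans j i hij.symm := by
  apply Subtype.ext
  apply Equiv.ext
  intro y
  rfl

/-- The parametrization by `ℤ` of the line made of the rays `R_i` and `R_j`: the origin is sent to
the centre, the positive integers to `R_j` and the negative ones to `R_i`. -/
def linePoint (i j : Fin k) : ℤ → HStar k
  | .ofNat 0 => none
  | .ofNat (n + 1) => some (j, n)
  | .negSucc n => some (i, n)

theorem lineTrans_smul_linePoint {i j : Fin k} (hij : i ≠ j) (t : ℤ) :
    lineTrans i j hij • linePoint i j t = linePoint i j (t + 1) := by
  rw [lineTrans_smul]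
  rcases t with (_ | n) | (_ | n)
  · rfl
  · change lineStep i j (some (j, n)) = some (j, n + 1)
    simp [lineStep]
  · change lineStep i j (some (i, 0)) = none
    simp [lineStep, hij]
  · change lineStep i j (some (i, n + 1)) = some (i, n)
    simp [lineStep, hij]

theorem lineTrans_zpow_smul_linePoint {i j : Fin k} (hij : i ≠ j) (s t : ℤ) :
    lineTrans i j hij ^ s • linePoint i j t = linePoint i j (t + s) := by
  induction s with
  | zero => simp
  | succ n ih =>
    rw [add_comm (n : ℤ) 1, zpow_add, mul_smul, ih, zpow_one, lineTrans_smul_linePoint]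
    congr 1
    ring
  | pred n ih =>
    rw [sub_eq_neg_add, zpow_add, mul_smul, ih, zpow_neg_one, inv_smul_eq_iff,
      lineTrans_smul_linePoint]
    congr 1
    ring

theorem linePoint_eq_some_of_le (i j : Fin k) {N : ℕ} {t : ℤ} (ht : (N : ℤ) + 1 ≤ |t|) :
    ∃ (l : Fin k) (n : ℕ), N ≤ n ∧ linePoint i j t = some (l, n) := by
  rcases t with (_ | n) | n
  · simp at ht
    omega
  · refine ⟨j, n, ?_, rfl⟩
    change (N : ℤ) + 1 ≤ |((n + 1 : ℕ) : ℤ)| at ht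
    rw [Nat.abs_cast] at ht
    omega
  · refine ⟨i, n, ?_, rfl⟩
    rw [abs_of_neg (Int.negSucc_lt_zero n)] at ht
    omega

theorem commutator_fixes_far (g h : houghtonGroup k) :
    ∃ N : ℕ, ∀ (i : Fin k) (n : ℕ), N ≤ n →
      (h * g * h⁻¹ * g⁻¹) • (some (i, n) : HStar k) = some (i, n) := by
  obtain ⟨m, hm⟩ := g.2
  obtain ⟨m', hm'⟩ := h.2
  obtain ⟨N, hN⟩ := ((hm'.comp hm).comp hm'.inv).comp hm.inv
  refine ⟨N, fun i n hn => ?_⟩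
  obtain ⟨n', e, h'⟩ := hN i n hn
  have : n' = n := by
    simp only [Pi.add_apply, Pi.neg_apply] at e
    omega
  subst this
  exact h'

/-- Conjugates of a commutator by the powers of `h` whose exponents are multiples of a large `L`.
Here `h` is a translation along a line, and `g` is the translation along another line, from a ray
`R_a'` to a ray `R_c` not in the first line. The commutator of `h` and `g` is a transposition if
the lines share a ray and a `3`-cycle if they do not; in both cases the commutator and its inverse
send the first point `z` of `R_c` to the first line, so that the conjugates and their inverses send
`z` to places far apart from each other. -/
theorem exists_conj_commutator {a b a' c : Fin k} (hab : a ≠ b) (hac : a' ≠ c) (hca : c ≠ a)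
    (hcb : c ≠ b) (hab' : a' ≠ b) :
    ∃ (L : ℕ) (κ : ℤ → houghtonGroup k), (∀ t, κ t = lineTrans a b hab ^ (L * t) *
        (lineTrans a b hab * lineTrans a' c hac * (lineTrans a b hab)⁻¹ * (lineTrans a' c hac)⁻¹) *
        lineTrans a b hab ^ (-(L * t))) ∧
      ∃ z : HStar k, (∀ t, κ t • z ≠ z) ∧
        ∀ t s, t ≠ s → κ s • κ t • z = κ t • z ∧ κ s • (κ t)⁻¹ • z = (κ t)⁻¹ • z := by
  set h := lineTrans a b hab with hh
  set g := lineTrans a' c hac with hg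
  set σ := h * g * h⁻¹ * g⁻¹ with hσ
  set z : HStar k := some (c, 0) with hz
  have hzh : ∀ s : ℤ, h ^ s • z = z := by
    have h0 : h ∈ MulAction.stabilizer (houghtonGroup k) z := by
      rw [MulAction.mem_stabilizer_iff, hh, lineTrans_smul, hz]
      simp [lineStep, hca, hcb]
    intro s
    exact MulAction.mem_stabilizer_iff.mp (zpow_mem h0 s)
  have hgz : g⁻¹ • z = none := by
    rw [hg, lineTrans_inv, lineTrans_smul, hz]
    simp [lineStep, hac.symm]
  -- the images of `z` under the commutator and its inverse lie on the first line
  obtain ⟨u, hu⟩ : ∃ u : ℤ, σ • z = linePoint a b u := by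
    have e1 : h⁻¹ • (none : HStar k) = some (a, 0) := by
      rw [hh, lineTrans_inv, lineTrans_smul]
      rfl
    rw [hσ, mul_smul, mul_smul, mul_smul, hgz, e1]
    by_cases haa : a = a'
    · refine ⟨1, ?_⟩
      have e2 : g • (some (a, 0) : HStar k) = none := by
        rw [hg, lineTrans_smul, haa]
        simp [lineStep, hac]
      rw [e2, hh, lineTrans_smul]
      rfl
    · refine ⟨0, ?_⟩
      have e2 : g • (some (a, 0) : HStar k) = some (a, 0) := by
        rw [hg, lineTrans_smul]
        simp [lineStep, hca.symm, haa]
      rw [e2, hh, lineTrans_smul]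
      simp [lineStep, hab, linePoint]
  obtain ⟨w, hw⟩ : ∃ w : ℤ, σ⁻¹ • z = linePoint a b w := by
    have e0 : σ⁻¹ = g * h * g⁻¹ * h⁻¹ := by
      rw [hσ]
      group
    have e1 : h⁻¹ • z = z := by
      have := hzh (-1)
      rwa [zpow_neg_one] at this
    have e2 : h • (none : HStar k) = some (b, 0) := by
      rw [hh, lineTrans_smul]
      rfl
    have e3 : g • (some (b, 0) : HStar k) = some (b, 0) := by
      rw [hg, lineTrans_smul]
      simp [lineStep, hcb.symm, hab'.symm]
    refine ⟨1, ?_⟩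
    rw [e0, mul_smul, mul_smul, mul_smul, e1, hgz, e2, e3]
    rfl
  have hzl : ∀ t : ℤ, linePoint a b t ≠ z := by
    rintro ((_ | n) | n) h0
    · simp [linePoint, hz] at h0
    · simp [linePoint, hz, hcb.symm] at h0
    · simp [linePoint, hz, hca.symm] at h0
  obtain ⟨N, hN⟩ := commutator_fixes_far g h
  set L : ℕ := N + 1 + u.natAbs + w.natAbs with hL
  have hfar : ∀ r : ℤ, r.natAbs ≤ u.natAbs + w.natAbs → ∀ t : ℤ, t ≠ 0 →
      σ • linePoint a b (r + L * t) = linePoint a b (r + L * t) := by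
    intro r hr t ht
    have h1 : (L : ℤ) ≤ |(L : ℤ) * t| := by
      rw [abs_mul, abs_of_nonneg (Int.natCast_nonneg L)]
      have : 1 ≤ |t| := Int.one_le_abs ht
      nlinarith [Int.natCast_nonneg L]
    have h2 : |(L : ℤ) * t| ≤ |r + L * t| + |r| := by
      have := abs_sub (r + L * t) r
      rwa [add_sub_cancel_left] at this
    have h3 : |r| = r.natAbs := Int.abs_eq_natAbs r
    obtain ⟨l, n, hn, e⟩ := linePoint_eq_some_of_le a b (N := N) (t := r + L * t) (by omega)
    rw [e]
    exact hN l n hn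
  set κ : ℤ → houghtonGroup k := fun t => h ^ (L * t) * σ * h ^ (-(L * t)) with hκ
  have hκi : ∀ t, (κ t)⁻¹ = h ^ (L * t) * σ⁻¹ * h ^ (-(L * t)) := fun t => by
    simp only [hκ, mul_inv_rev, zpow_neg, inv_inv, mul_assoc]
  have hκz : ∀ t, κ t • z = linePoint a b (u + L * t) := fun t => by
    simp only [hκ]
    rw [mul_smul, mul_smul, hzh, hu, lineTrans_zpow_smul_linePoint]
  have hκz' : ∀ t, (κ t)⁻¹ • z = linePoint a b (w + L * t) := fun t => by
    rw [hκi, mul_smul, mul_smul, hzh, hw, lineTrans_zpow_smul_linePoint]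
  have hκf : ∀ r : ℤ, r.natAbs ≤ u.natAbs + w.natAbs → ∀ t s : ℤ, t ≠ s →
      κ s • linePoint a b (r + L * t) = linePoint a b (r + L * t) := by
    intro r hr t s hts
    have e : r + L * t + -(L * s) = r + L * (t - s) := by ring
    have e' : r + (L : ℤ) * (t - s) + L * s = r + L * t := by ring
    simp only [hκ]
    rw [mul_smul, mul_smul, lineTrans_zpow_smul_linePoint, e, hfar r hr _ (sub_ne_zero.mpr hts),
      lineTrans_zpow_smul_linePoint, e']
  refine ⟨L, κ, fun t => rfl, z, fun t => ?_, fun t s hts => ?_⟩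
  · rw [hκz]
    exact hzl _
  · rw [hκz, hκz']
    exact ⟨hκf u (by omega) t s hts, hκf w (by omega) t s hts⟩

theorem energy_lineTrans_zpow_swap (f : houghtonGroup k → ℝ) {i j : Fin k} (hij : i ≠ j) (s : ℤ) :
    energy f (lineTrans j i hij.symm ^ s) = energy f (lineTrans i j hij ^ s) := by
  rw [← lineTrans_inv i j hij, inv_zpow, energy_inv]

/-- Two different lines can be oriented so that the second one ends on a ray `R_c` outside the first
one, and starts from a ray `R_a'` other than the end `R_b` of the first one. The orientation does
not matter for energies, as `y` and `y⁻¹` have the same energy. -/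
theorem exists_orientation {e e' : RayPair k} (hne : e ≠ e') :
    ∃ (a b a' c : Fin k) (hab : a ≠ b) (hac : a' ≠ c), c ≠ a ∧ c ≠ b ∧ a' ≠ b ∧
      (∀ (f : houghtonGroup k → ℝ) (s : ℤ),
        energy f (lineTrans a b hab ^ s) = energy f (houghtonGen e ^ s)) ∧
      ∀ (f : houghtonGroup k → ℝ) (s : ℤ),
        energy f (lineTrans a' c hac ^ s) = energy f (houghtonGen e' ^ s) := by
  obtain ⟨⟨i, j⟩, hij⟩ := e
  obtain ⟨⟨i', j'⟩, hij'⟩ := e'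
  simp only at hij hij'
  have hne' : ¬(i = i' ∧ j = j') := fun h => hne (by simp [h.1, h.2])
  -- a ray `R_c` of the second line that is not in the first line
  obtain ⟨a', c, hac, hci, hcj, h'⟩ : ∃ (a' c : Fin k) (hac : a' ≠ c), c ≠ i ∧ c ≠ j ∧
      ∀ (f : houghtonGroup k → ℝ) (s : ℤ),
        energy f (lineTrans a' c hac ^ s) = energy f (houghtonGen ⟨(i', j'), hij'⟩ ^ s) := by
    by_cases h : j' = i ∨ j' = j
    · refine ⟨j', i', hij'.ne', ?_, ?_, fun f s => energy_lineTrans_zpow_swap f hij'.ne s⟩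
      · rintro rfl
        rcases h with h | h
        · exact hij'.ne h.symm
        · exact hne' ⟨rfl, h.symm⟩
      · rintro rfl
        rcases h with h | h
        · rw [h] at hij'
          exact absurd hij hij'.not_gt
        · exact hij'.ne h.symm
    · push Not at h
      exact ⟨i', j', hij'.ne, h.1, h.2, fun f s => rfl⟩
  by_cases h : a' = j
  · exact ⟨j, i, a', c, hij.ne', hac, hcj, hci, fun h0 => hij.ne (h0.symm.trans h),
      fun f s => energy_lineTrans_zpow_swap f hij.ne s, h'⟩
  · exact ⟨i, j, a', c, hij.ne, hac, hci, hcj, h, fun f s => rfl, h'⟩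

/-- The translations along two different lines control the `ℓ²`-norm of the functions which are
supported by fewer than `d!` points, the translations along the first line being used up to the
distance `4d`. -/
theorem exists_sum_sq_le_energy {e e' : RayPair k} (hne : e ≠ e') :
    ∃ C : ℝ, 0 < C ∧ ∀ (d : ℕ), 0 < d → ∀ (Ω : Finset (houghtonGroup k)), Ω.card < d.factorial →
      ∀ f : houghtonGroup k → ℝ, Function.support f ⊆ Ω → ∀ M : ℝ,
        (∀ a : ℕ, 1 ≤ a → a ≤ 4 * d → energy f (houghtonGen e ^ a) ≤ M) →
        energy f (houghtonGen e') ≤ M → ∑ x ∈ Ω, f x ^ 2 ≤ C * M := by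
  obtain ⟨a, b, a', c, hab, hac, hca, hcb, hab', he, he'⟩ := exists_orientation hne
  obtain ⟨L, κ, hκ, z, hz, hfix⟩ := exists_conj_commutator hab hac hca hcb hab'
  refine ⟨16 * (6 * L ^ 2 + 64), by positivity, fun d hd Ω hΩ f hf M hM hM' => ?_⟩
  set h := lineTrans a b hab
  set g := lineTrans a' c hac
  have hfin : (Function.support f).Finite := Ω.finite_toSet.subset hf
  have main := sum_energy_ge_of_card_lt_factorial (fun t : Fin (4 * d) => κ ((t : ℤ) + 1)) z
    (fun t => hz _) (fun t s hts => hfix _ _ (by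
      intro h0
      apply hts
      ext
      omega)) d (by simp) Ω hΩ f hf
  have hMh : energy f h ≤ M := by
    have := hM 1 le_rfl (by omega)
    have h1 := he f 1
    rw [zpow_one, zpow_one] at h1
    rw [pow_one] at this
    rwa [h1]
  have hMg : energy f g ≤ M := by
    have h1 := he' f 1
    rw [zpow_one, zpow_one] at h1
    rwa [h1]
  have hσ : energy f (h * g * h⁻¹ * g⁻¹) ≤ 16 * M := by
    rw [mul_assoc]
    have h1 := energy_mul_le_two hfin (h * g) (h⁻¹ * g⁻¹)
    have h2 := energy_mul_le_two hfin h g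
    have h3 := energy_mul_le_two hfin h⁻¹ g⁻¹
    rw [energy_inv, energy_inv] at h3
    linarith
  have hκe : ∀ t : Fin (4 * d), energy f (κ ((t : ℤ) + 1)) ≤ (6 * L ^ 2 + 64) * M := by
    intro t
    have hp : energy f (h ^ ((L : ℤ) * ((t : ℤ) + 1))) ≤ L ^ 2 * M := by
      have e1 : houghtonGen e ^ ((L : ℤ) * ((t : ℤ) + 1)) = (houghtonGen e ^ ((t : ℕ) + 1)) ^ L := by
        rw [← pow_mul, ← zpow_natCast]
        congr 1
        push_cast
        ring
      rw [he, e1]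
      refine (energy_pow_le hfin _ _).trans ?_
      gcongr
      exact hM _ (by omega) (by omega)
    rw [hκ]
    have h1 := energy_mul_le_two hfin (h ^ ((L : ℤ) * ((t : ℤ) + 1)) * (h * g * h⁻¹ * g⁻¹))
      (h ^ (-((L : ℤ) * ((t : ℤ) + 1))))
    have h2 := energy_mul_le_two hfin (h ^ ((L : ℤ) * ((t : ℤ) + 1))) (h * g * h⁻¹ * g⁻¹)
    rw [zpow_neg, energy_inv] at h1
    rw [zpow_neg]
    linarith
  have hsum := Finset.sum_le_sum fun t (_ : t ∈ Finset.univ) => hκe t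
  rw [Finset.sum_const, Finset.card_univ, Fintype.card_fin, nsmul_eq_mul] at hsum
  push_cast at hsum
  have hd' : (0 : ℝ) < d := by exact_mod_cast hd
  refine le_of_mul_le_mul_left ?_ hd'
  calc _ ≤ _ := main
    _ ≤ _ := mul_le_mul_of_nonneg_left hsum (by norm_num)
    _ = _ := by ring

end Lines

/-! ### The rates of decay -/

section Rates

/-- The rate `r_α(t)` at which the profile of the measure `ξ_α` decays at the scale `t ≥ 1`: up to
constants, the inverse function of `ρ_α`. -/
def stepRate : StepIndex → ℝ → ℝ
  | .power α _, t =>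
    if α < 2 then t ^ (-α) else if α = 2 then (1 + Real.log t) * (t ^ 2)⁻¹ else (t ^ 2)⁻¹
  | .simple, t => (t ^ 2)⁻¹
  | .trivial, _ => 0

theorem one_add_log_le (t : ℝ) (ht : 1 ≤ t) : 1 + Real.log t ≤ t := by
  linarith [Real.log_le_sub_one_of_pos (zero_lt_one.trans_le ht)]

theorem inv_sq_le_stepRate {a : StepIndex} (ha : a ≠ .trivial) {t : ℝ} (ht : 1 ≤ t) :
    (t ^ 2)⁻¹ ≤ stepRate a t := by
  have h0 : 0 < t := zero_lt_one.trans_le ht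
  rcases a with ⟨α, hα⟩ | _ | _
  · simp only [stepRate]
    split_ifs with h1 h2
    · rw [← Real.rpow_natCast, ← Real.rpow_neg h0.le]
      exact Real.rpow_le_rpow_of_exponent_le ht (by push_cast; linarith)
    · have := Real.log_nonneg ht
      exact le_mul_of_one_le_left (by positivity) (by linarith)
    · exact le_rfl
  · exact le_rfl
  · exact absurd rfl ha

theorem stepRate_pos {a : StepIndex} (ha : a ≠ .trivial) {t : ℝ} (ht : 1 ≤ t) :
    0 < stepRate a t := by
  have h0 : 0 < t := zero_lt_one.trans_le ht
  exact (by positivity : (0 : ℝ) < (t ^ 2)⁻¹).trans_le (inv_sq_le_stepRate ha ht)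

theorem stepRate_nonneg (a : StepIndex) {t : ℝ} (ht : 1 ≤ t) : 0 ≤ stepRate a t := by
  by_cases ha : a = .trivial
  · subst ha
    exact le_rfl
  · exact (stepRate_pos ha ht).le

theorem stepRate_anti (a : StepIndex) {s t : ℝ} (hs : 1 ≤ s) (hst : s ≤ t) :
    stepRate a t ≤ stepRate a s := by
  have h0 : 0 < s := zero_lt_one.trans_le hs
  have h0' : 0 < t := h0.trans_le hst
  have hsq : (t ^ 2)⁻¹ ≤ (s ^ 2)⁻¹ := by gcongr
  rcases a with ⟨α, hα⟩ | _ | _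
  · simp only [stepRate]
    split_ifs with h1 h2
    · exact Real.rpow_le_rpow_of_nonpos h0 hst (by linarith)
    · have hl : Real.log (t / s) ≤ t / s - 1 := Real.log_le_sub_one_of_pos (by positivity)
      rw [Real.log_div h0'.ne' h0.ne'] at hl
      have hls := Real.log_nonneg hs
      have h3 : 1 ≤ t / s := (one_le_div h0).mpr hst
      have h4 : 1 + Real.log t ≤ t / s * (1 + Real.log s) := by nlinarith
      calc (1 + Real.log t) * (t ^ 2)⁻¹ ≤ t / s * (1 + Real.log s) * (t ^ 2)⁻¹ := by gcongr
        _ = (1 + Real.log s) * (s * t)⁻¹ := by field_simp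
        _ ≤ (1 + Real.log s) * (s ^ 2)⁻¹ := by
          have : s ^ 2 ≤ s * t := by nlinarith
          gcongr
    · exact hsq
  · exact hsq
  · exact le_rfl

theorem stepRate_one (a : StepIndex) : stepRate a 1 ≤ 1 := by
  rcases a with ⟨α, hα⟩ | _ | _
  · simp only [stepRate]
    split_ifs <;> simp
  · simp [stepRate]
  · simp [stepRate]

theorem stepRate_le_one (a : StepIndex) {t : ℝ} (ht : 1 ≤ t) : stepRate a t ≤ 1 :=
  (stepRate_anti a le_rfl ht).trans (stepRate_one a)

theorem exists_stepRate_le_mul (a : StepIndex) {K : ℝ} (hK : 1 ≤ K) :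
    ∃ C : ℝ, 0 < C ∧ ∀ s t : ℝ, 1 ≤ s → s ≤ t → t ≤ K * s → stepRate a s ≤ C * stepRate a t := by
  have hK0 : 0 < K := zero_lt_one.trans_le hK
  have hsq : ∀ s t : ℝ, 1 ≤ s → s ≤ t → t ≤ K * s → (s ^ 2)⁻¹ ≤ K ^ 2 * (t ^ 2)⁻¹ := by
    intro s t hs hst ht
    have h0 : 0 < s := zero_lt_one.trans_le hs
    have h0' : 0 < t := h0.trans_le hst
    have h2 : t ^ 2 ≤ (K * s) ^ 2 := by gcongr
    rw [← div_eq_mul_inv, inv_eq_one_div, div_le_div_iff₀ (by positivity) (by positivity)]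
    nlinarith
  rcases a with ⟨α, hα⟩ | _ | _
  · refine ⟨K ^ α + K ^ 2, by positivity, fun s t hs hst ht => ?_⟩
    have h0 : 0 < s := zero_lt_one.trans_le hs
    have h0' : 0 < t := h0.trans_le hst
    have hKα : 0 < K ^ α := by positivity
    simp only [stepRate]
    split_ifs with h1 h2
    · have h3 : (K * s) ^ (-α) ≤ t ^ (-α) := Real.rpow_le_rpow_of_nonpos h0' ht (by linarith)
      rw [Real.mul_rpow hK0.le h0.le] at h3
      have h4 : K ^ α * K ^ (-α) = 1 := by rw [← Real.rpow_add hK0]; simp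
      have h5 : 0 < t ^ (-α) := by positivity
      calc s ^ (-α) = K ^ α * (K ^ (-α) * s ^ (-α)) := by rw [← mul_assoc, h4, one_mul]
        _ ≤ K ^ α * t ^ (-α) := by gcongr
        _ ≤ _ := by nlinarith [sq_nonneg K]
    · have h3 : Real.log s ≤ Real.log t := Real.log_le_log h0 hst
      have h4 := Real.log_nonneg hs
      have h5 : 0 < (t ^ 2)⁻¹ := by positivity
      calc (1 + Real.log s) * (s ^ 2)⁻¹ ≤ (1 + Real.log t) * (K ^ 2 * (t ^ 2)⁻¹) := by
            gcongr
            · linarith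
            · exact hsq s t hs hst ht
        _ = K ^ 2 * ((1 + Real.log t) * (t ^ 2)⁻¹) := by ring
        _ ≤ _ := by
            have : 0 ≤ (1 + Real.log t) * (t ^ 2)⁻¹ := by
              have : 0 ≤ 1 + Real.log t := by linarith
              positivity
            nlinarith
    · have h5 : 0 < (t ^ 2)⁻¹ := by positivity
      nlinarith [hsq s t hs hst ht]
  · exact ⟨K ^ 2, by positivity, hsq⟩
  · exact ⟨1, one_pos, fun s t _ _ _ => by simp [stepRate]⟩

theorem sq_rpow_mul_rpow_half {s l : ℝ} (hs : 0 < s) (hl : 0 ≤ l) :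
    (s ^ (-1 / 2 : ℝ) * l ^ (1 / 2 : ℝ)) ^ 2 = 1 / s * l := by
  have h1 : (s ^ (-1 / 2 : ℝ)) ^ 2 = s⁻¹ := by
    rw [← Real.rpow_natCast, ← Real.rpow_mul hs.le, ← Real.rpow_neg_one]
    norm_num
  rw [mul_pow, h1, ← Real.sqrt_eq_rpow, Real.sq_sqrt hl, one_div]

theorem inv_le_sq_of_rpow_le {s t : ℝ} (hs : 0 < s) (h : s ^ (-1 / 2 : ℝ) ≤ t) : s⁻¹ ≤ t ^ 2 := by
  have h1 : 0 < s ^ (-1 / 2 : ℝ) := by positivity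
  have h2 : (s ^ (-1 / 2 : ℝ)) ^ 2 = s⁻¹ := by
    rw [← Real.rpow_natCast, ← Real.rpow_mul hs.le, ← Real.rpow_neg_one]
    norm_num
  rw [← h2]
  gcongr

theorem rpow_le_of_inv_le_sq {s t : ℝ} (hs : 0 < s) (ht : 0 ≤ t) (h : s⁻¹ ≤ t ^ 2) :
    s ^ (-1 / 2 : ℝ) ≤ t := by
  have h2 : (s ^ (-1 / 2 : ℝ)) ^ 2 = s⁻¹ := by
    rw [← Real.rpow_natCast, ← Real.rpow_mul hs.le, ← Real.rpow_neg_one]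
    norm_num
  rw [← h2] at h
  exact le_of_sq_le_sq h ht

theorem stepRate_le_of_stepRho_le (a : StepIndex) {s t : ℝ} (hs : 0 < s) (ht : 1 ≤ t)
    (h : stepRho a s ≤ t) : stepRate a t ≤ s := by
  have ht0 : 0 < t := zero_lt_one.trans_le ht
  have hsq : s ^ (-1 / 2 : ℝ) ≤ t → (t ^ 2)⁻¹ ≤ s := fun h => by
    have := inv_le_sq_of_rpow_le hs h
    exact inv_le_of_inv_le₀ hs this
  rcases a with ⟨α, hα⟩ | _ | _
  · rw [stepRho] at h
    by_cases h1 : α < 2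
    · rw [if_pos h1] at h
      rw [stepRate, if_pos h1]
      have h2 : (s ^ (-1 / α)) ^ α ≤ t ^ α := by gcongr
      rw [← Real.rpow_mul hs.le, div_mul_cancel₀ _ hα.ne', Real.rpow_neg_one] at h2
      rw [Real.rpow_neg ht0.le]
      exact inv_le_of_inv_le₀ hs h2
    rw [if_neg h1] at h
    by_cases h2 : α = 2
    · rw [if_pos h2] at h
      by_cases hs1 : 1 < s
      · exact (stepRate_le_one _ ht).trans hs1.le
      rw [stepRate, if_neg h1, if_pos h2]
      push Not at hs1
      set u := 1 / s with hu
      have hu1 : 1 ≤ u := (one_le_div hs).mpr hs1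
      have hlu := Real.log_nonneg hu1
      have h3 : u * (1 + Real.log u) ≤ t ^ 2 := by
        have e := sq_rpow_mul_rpow_half hs (by linarith : 0 ≤ 1 + Real.log u)
        rw [← hu] at e
        rw [← e]
        gcongr
      have h4 : u * (1 + Real.log t) ≤ t ^ 2 := by
        rcases le_total u t with hut | hut
        · calc u * (1 + Real.log t) ≤ t * t := by
                have := one_add_log_le t ht
                have := Real.log_nonneg ht
                gcongr
            _ = t ^ 2 := by ring
        · have := Real.log_le_log ht0 hut
          refine le_trans ?_ h3
          gcongr
      have h5 : s = u⁻¹ := by rw [hu]; simp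
      rw [h5, ← div_eq_mul_inv, ← one_div, div_le_div_iff₀ (by positivity) (by positivity)]
      linarith
    · rw [if_neg h2] at h
      rw [stepRate, if_neg h1, if_neg h2]
      exact hsq h
  · exact hsq h
  · exact hs.le

theorem stepRho_le_of_two_mul_stepRate_le (a : StepIndex) {s t : ℝ} (hs : 0 < s) (ht : 1 ≤ t)
    (h : 2 * stepRate a t ≤ s) : stepRho a s ≤ t := by
  have ht0 : 0 < t := zero_lt_one.trans_le ht
  have h' : stepRate a t ≤ s := by linarith [stepRate_nonneg a ht]
  have hsq : (t ^ 2)⁻¹ ≤ s → s ^ (-1 / 2 : ℝ) ≤ t := fun h =>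
    rpow_le_of_inv_le_sq hs ht0.le (inv_le_of_inv_le₀ (by positivity) h)
  rcases a with ⟨α, hα⟩ | _ | _
  · rw [stepRho]
    by_cases h1 : α < 2
    · rw [if_pos h1]
      rw [stepRate, if_pos h1, Real.rpow_neg ht0.le] at h'
      have h2 : s⁻¹ ≤ t ^ α := inv_le_of_inv_le₀ (by positivity) h'
      have h3 : (s⁻¹) ^ (1 / α) ≤ (t ^ α) ^ (1 / α) := by gcongr
      rw [← Real.rpow_mul ht0.le, mul_one_div_cancel hα.ne', Real.rpow_one,
        Real.inv_rpow hs.le, ← Real.rpow_neg hs.le] at h3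
      rwa [neg_div]
    rw [if_neg h1]
    by_cases h2 : α = 2
    · rw [if_pos h2]
      rw [stepRate, if_neg h1, if_pos h2] at h
      by_cases hs1 : 1 < s
      · have hl : Real.log (1 / s) < 0 := Real.log_neg (by positivity) ((div_lt_one hs).mpr hs1)
        have e1 : s ^ (-1 / 2 : ℝ) ≤ 1 := Real.rpow_le_one_of_one_le_of_nonpos hs1.le (by norm_num)
        have e2 : (1 + Real.log (1 / s)) ^ (1 / 2 : ℝ) ≤ 1 := by
          rw [← Real.sqrt_eq_rpow, Real.sqrt_le_one]
          linarith
        have e3 : 0 ≤ (1 + Real.log (1 / s)) ^ (1 / 2 : ℝ) := by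
          rw [← Real.sqrt_eq_rpow]
          exact Real.sqrt_nonneg _
        calc _ ≤ (1 : ℝ) * 1 := by gcongr
          _ ≤ t := by linarith
      push Not at hs1
      set u := 1 / s with hu
      have hu1 : 1 ≤ u := (one_le_div hs).mpr hs1
      have hlu := Real.log_nonneg hu1
      have hlt := Real.log_nonneg ht
      have hus : u * s = 1 := by rw [hu]; field_simp
      have h3 : 2 * (1 + Real.log t) * u ≤ t ^ 2 := by
        have e : 2 * ((1 + Real.log t) * (t ^ 2)⁻¹) * t ^ 2 * u ≤ s * t ^ 2 * u := by gcongr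
        have e2 : 2 * ((1 + Real.log t) * (t ^ 2)⁻¹) * t ^ 2 * u = 2 * (1 + Real.log t) * u := by
          field_simp
        rw [e2] at e
        calc _ ≤ _ := e
          _ = u * s * t ^ 2 := by ring
          _ = t ^ 2 := by rw [hus, one_mul]
      have h4 : u ≤ t ^ 2 := by nlinarith
      have h5 : Real.log u ≤ 2 * Real.log t := by
        have := Real.log_le_log (by linarith) h4
        rwa [Real.log_pow] at this
      have h6 : u * (1 + Real.log u) ≤ t ^ 2 := by nlinarith
      have e := sq_rpow_mul_rpow_half hs (by linarith : 0 ≤ 1 + Real.log u)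
      rw [← hu] at e
      rw [← e] at h6
      exact le_of_sq_le_sq h6 ht0.le
    · rw [if_neg h2]
      rw [stepRate, if_neg h1, if_neg h2] at h'
      exact hsq h'
  · exact hsq h'
  · exact ht0.le

variable {k : ℕ}

theorem stepRate_le_decrInverse (α : RayPair k → StepIndex) {e₀ : RayPair k}
    {t : ℝ} (ht : 1 ≤ t) (e : RayPair k) :
    stepRate (α e) t ≤ decrInverse (maxRho α) t := by
  have : Nonempty (RayPair k) := ⟨e₀⟩
  refine le_csInf ⟨2, two_pos, ciSup_le fun e' => ?_⟩ fun s hs => ?_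
  · refine stepRho_le_of_two_mul_stepRate_le _ two_pos ht ?_
    linarith [stepRate_le_one (α e') ht]
  · refine stepRate_le_of_stepRho_le _ hs.1 ht (le_trans ?_ hs.2)
    exact le_ciSup (f := fun e => stepRho (α e) s) (Set.finite_range _).bddAbove e

theorem decrInverse_le_sum_stepRate (α : RayPair k → StepIndex) {e₀ : RayPair k}
    (he₀ : α e₀ ≠ .trivial) {t : ℝ} (ht : 1 ≤ t) :
    decrInverse (maxRho α) t ≤ 2 * ∑ e, stepRate (α e) t := by
  have : Nonempty (RayPair k) := ⟨e₀⟩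
  have hle : ∀ e, stepRate (α e) t ≤ ∑ e, stepRate (α e) t := fun e =>
    Finset.single_le_sum (f := fun e => stepRate (α e) t)
      (fun e _ => stepRate_nonneg (α e) ht) (Finset.mem_univ e)
  have hpos : 0 < 2 * ∑ e, stepRate (α e) t := by
    linarith [stepRate_pos he₀ ht, hle e₀]
  refine csInf_le ⟨0, fun s hs => hs.1.le⟩ ⟨hpos, ciSup_le fun e => ?_⟩
  exact stepRho_le_of_two_mul_stepRate_le _ hpos ht (by linarith [hle e])

end Rates

/-! ### The measures `ξ_α` and the energies along a cyclic subgroup -/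

section StepMeasure

theorem summable_one_add_abs_rpow {α : ℝ} (hα : 0 < α) :
    Summable fun l : ℤ => (1 + |(l : ℝ)|) ^ (-α - 1) := by
  have h : Summable fun n : ℕ => (1 + (n : ℝ)) ^ (-α - 1) := by
    have := (summable_nat_add_iff 1).mpr (Real.summable_nat_rpow.mpr (by linarith : -α - 1 < -1))
    refine this.congr fun n => ?_
    push_cast
    rw [add_comm]
  refine Summable.of_nat_of_neg ?_ ?_
  · simpa using h
  · simpa using h

theorem stepMeasure_nonneg (a : StepIndex) (m : ℤ) : 0 ≤ stepMeasure a m := by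
  rcases a with ⟨α, hα⟩ | _ | _
  · rw [stepMeasure]
    have : 0 ≤ ∑' l : ℤ, (1 + |(l : ℝ)|) ^ (-α - 1) := tsum_nonneg fun l => by positivity
    positivity
  · rw [stepMeasure]
    split_ifs <;> norm_num
  · rw [stepMeasure]
    split_ifs <;> norm_num

theorem summable_stepMeasure (a : StepIndex) : Summable (stepMeasure a) := by
  rcases a with ⟨α, hα⟩ | _ | _
  · exact (summable_one_add_abs_rpow hα).mul_left _
  · refine summable_of_ne_finset_zero (s := {-1, 0, 1}) fun m hm => ?_
    simp only [Finset.mem_insert, Finset.mem_singleton] at hm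
    simp [stepMeasure, hm]
  · refine summable_of_ne_finset_zero (s := {0}) fun m hm => ?_
    simp only [Finset.mem_singleton] at hm
    simp [stepMeasure, hm]

theorem exists_le_stepMeasure_power {α : ℝ} (hα : 0 < α) : ∃ c : ℝ, 0 < c ∧ ∀ n : ℕ, 1 ≤ n →
    c * (n : ℝ) ^ (-α - 1) ≤ stepMeasure (.power α hα) n := by
  set Z := ∑' l : ℤ, (1 + |(l : ℝ)|) ^ (-α - 1) with hZ
  have hZpos : 0 < Z := (summable_one_add_abs_rpow hα).tsum_pos (fun l => by positivity) 0
    (by simp)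
  refine ⟨Z⁻¹ * 2 ^ (-α - 1), by positivity, fun n hn => ?_⟩
  have hn' : (1 : ℝ) ≤ n := by exact_mod_cast hn
  rw [stepMeasure, ← hZ, mul_assoc, ← Real.mul_rpow two_pos.le (by linarith)]
  have e : |((n : ℤ) : ℝ)| = n := by simp
  rw [e]
  refine mul_le_mul_of_nonneg_left ?_ (by positivity)
  exact Real.rpow_le_rpow_of_nonpos (by linarith) (by linarith) (by linarith)

theorem stepMeasure_one_pos {a : StepIndex} (ha : a ≠ .trivial) : 0 < stepMeasure a 1 := by
  rcases a with ⟨α, hα⟩ | _ | _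
  · obtain ⟨c, hc, h⟩ := exists_le_stepMeasure_power hα
    have := h 1 le_rfl
    simp only [Nat.cast_one, Real.one_rpow, mul_one] at this
    exact hc.trans_le this
  · norm_num [stepMeasure]
  · exact absurd rfl ha

variable {G : Type*} [Group G]

/-- The energy along a power of `y` is controlled by its average along the longer powers. -/
theorem energy_pow_le_average {f : G → ℝ} (hf : (Function.support f).Finite) (y : G) {a b : ℕ}
    (hab : a ≤ b) :
    b * energy f (y ^ a) ≤ 4 * ∑ c ∈ Finset.Icc 1 (2 * b), energy f (y ^ c) := by
  have h1 : ∀ c ∈ Finset.Icc 1 b,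
      energy f (y ^ a) ≤ 2 * energy f (y ^ (a + c)) + 2 * energy f (y ^ c) := by
    intro c _
    have := energy_mul_le_two hf (y ^ (a + c)) (y ^ c)⁻¹
    rwa [energy_inv, pow_add, mul_inv_cancel_right, ← pow_add] at this
  have h2 := Finset.sum_le_sum h1
  rw [Finset.sum_const, Nat.card_Icc, nsmul_eq_mul, Nat.add_sub_cancel, Finset.sum_add_distrib,
    ← Finset.mul_sum, ← Finset.mul_sum] at h2
  have h3 : ∑ c ∈ Finset.Icc 1 b, energy f (y ^ c)
      ≤ ∑ c ∈ Finset.Icc 1 (2 * b), energy f (y ^ c) :=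
    Finset.sum_le_sum_of_subset_of_nonneg (Finset.Icc_subset_Icc_right (by omega))
      fun _ _ _ => energy_nonneg _ _
  have h4 : ∑ c ∈ Finset.Icc 1 b, energy f (y ^ (a + c))
      ≤ ∑ c ∈ Finset.Icc 1 (2 * b), energy f (y ^ c) := by
    rw [← Finset.sum_image (f := fun c => energy f (y ^ c)) (g := fun c => a + c)
      (fun _ _ _ _ h => by simpa using h)]
    refine Finset.sum_le_sum_of_subset_of_nonneg (fun c hc => ?_) fun _ _ _ => energy_nonneg _ _
    simp only [Finset.mem_image, Finset.mem_Icc] at hc ⊢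
    obtain ⟨c, hc, rfl⟩ := hc
    omega
  linarith

/-- Comparison of the energy along the `a`-th power with its average at a smaller scale `b`. -/
theorem energy_pow_le_scale {f : G → ℝ} (hf : (Function.support f).Finite) (y : G) {a b n : ℕ}
    (hb : 0 < b) (hbn : b ≤ n) (han : a ≤ n) :
    (b : ℝ) ^ 3 * energy f (y ^ a)
      ≤ 16 * (n : ℝ) ^ 2 * ∑ c ∈ Finset.Icc 1 (2 * b), energy f (y ^ c) := by
  set S := ∑ c ∈ Finset.Icc 1 (2 * b), energy f (y ^ c) with hS
  have hb' : (0 : ℝ) < b := by exact_mod_cast hb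
  have hbn' : (b : ℝ) ≤ n := by exact_mod_cast hbn
  have h1 : energy f (y ^ a)
      ≤ 2 * ((a / b : ℕ) ^ 2 * energy f (y ^ b)) + 2 * energy f (y ^ (a % b)) := by
    have e : y ^ a = (y ^ b) ^ (a / b) * y ^ (a % b) := by
      rw [← pow_mul, ← pow_add, Nat.div_add_mod]
    rw [e]
    refine (energy_mul_le_two hf _ _).trans ?_
    gcongr
    exact energy_pow_le hf _ _
  have h2 := energy_pow_le_average hf y (le_refl b)
  have h3 := energy_pow_le_average hf y (Nat.mod_lt a hb).le
  rw [← hS] at h2 h3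
  have hS0 : 0 ≤ S := Finset.sum_nonneg fun _ _ => energy_nonneg _ _
  have h4 : (b : ℝ) * (a / b : ℕ) ≤ n := by
    have := (Nat.mul_div_le a b).trans han
    exact_mod_cast this
  have h5 : ((b : ℝ) * (a / b : ℕ)) ^ 2 ≤ (n : ℝ) ^ 2 := by gcongr
  have h6 : (b : ℝ) ^ 2 ≤ (n : ℝ) ^ 2 := by gcongr
  calc (b : ℝ) ^ 3 * energy f (y ^ a)
      ≤ (b : ℝ) ^ 3 * (2 * ((a / b : ℕ) ^ 2 * energy f (y ^ b)) + 2 * energy f (y ^ (a % b))) := by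
        gcongr
    _ = 2 * ((b : ℝ) * (a / b : ℕ)) ^ 2 * (b * energy f (y ^ b))
        + 2 * (b : ℝ) ^ 2 * (b * energy f (y ^ (a % b))) := by ring
    _ ≤ 2 * (n : ℝ) ^ 2 * (4 * S) + 2 * (n : ℝ) ^ 2 * (4 * S) := by
        have := energy_nonneg f (y ^ b)
        have := energy_nonneg f (y ^ (a % b))
        gcongr
    _ = _ := by ring

/-- The case `α = 2`: the scales `b ≤ n`, with weights `1 / b`, all contribute equally, which
accounts for the logarithm. -/
theorem one_add_log_mul_energy_pow_le {f : G → ℝ} (hf : (Function.support f).Finite) (y : G)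
    {a n : ℕ} (hn : 0 < n) (han : a ≤ n) :
    (1 + Real.log n) * energy f (y ^ a)
      ≤ 512 * (n : ℝ) ^ 2 * ∑ c ∈ Finset.Icc 1 (2 * n), ((c : ℝ) ^ 3)⁻¹ * energy f (y ^ c) := by
  have hH : 1 + Real.log n ≤ 2 * ∑ b ∈ Finset.Icc 1 n, (b : ℝ)⁻¹ := by
    have h1 := log_add_one_le_harmonic n
    rw [harmonic_eq_sum_Icc] at h1
    push_cast at h1
    have h2 : Real.log n ≤ Real.log (n + 1) :=
      Real.log_le_log (by exact_mod_cast hn) (by linarith)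
    have h3 : (1 : ℝ) ≤ ∑ b ∈ Finset.Icc 1 n, (b : ℝ)⁻¹ := by
      have := Finset.single_le_sum (f := fun b : ℕ => (b : ℝ)⁻¹) (s := Finset.Icc 1 n)
        (fun b _ => by positivity) (Finset.mem_Icc.mpr ⟨le_rfl, hn⟩)
      simpa using this
    linarith
  have hb : ∀ b ∈ Finset.Icc 1 n, (b : ℝ)⁻¹ * energy f (y ^ a)
      ≤ 16 * (n : ℝ) ^ 2 * ∑ c ∈ Finset.Icc 1 (2 * n),
        (if c ≤ 2 * b then ((b : ℝ) ^ 4)⁻¹ else 0) * energy f (y ^ c) := by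
    intro b hb
    rw [Finset.mem_Icc] at hb
    have hb' : (0 : ℝ) < b := by exact_mod_cast hb.1
    have h := energy_pow_le_scale hf y hb.1 hb.2 han
    have e : ∑ c ∈ Finset.Icc 1 (2 * n),
        (if c ≤ 2 * b then ((b : ℝ) ^ 4)⁻¹ else 0) * energy f (y ^ c)
        = ((b : ℝ) ^ 4)⁻¹ * ∑ c ∈ Finset.Icc 1 (2 * b), energy f (y ^ c) := by
      simp_rw [ite_mul, zero_mul]
      rw [← Finset.sum_filter, Finset.mul_sum]
      refine Finset.sum_congr ?_ fun _ _ => rfl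
      ext c
      simp only [Finset.mem_filter, Finset.mem_Icc]
      omega
    rw [e]
    calc (b : ℝ)⁻¹ * energy f (y ^ a) = ((b : ℝ) ^ 4)⁻¹ * ((b : ℝ) ^ 3 * energy f (y ^ a)) := by
          field_simp
      _ ≤ ((b : ℝ) ^ 4)⁻¹ * (16 * (n : ℝ) ^ 2 *
          ∑ c ∈ Finset.Icc 1 (2 * b), energy f (y ^ c)) := by gcongr
      _ = _ := by ring
  have hsum := Finset.sum_le_sum hb
  rw [← Finset.sum_mul, ← Finset.mul_sum, Finset.sum_comm] at hsum
  have hc : ∀ c ∈ Finset.Icc 1 (2 * n),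
      ∑ b ∈ Finset.Icc 1 n, (if c ≤ 2 * b then ((b : ℝ) ^ 4)⁻¹ else 0) * energy f (y ^ c)
      ≤ 16 * (((c : ℝ) ^ 3)⁻¹ * energy f (y ^ c)) := by
    intro c hc
    rw [Finset.mem_Icc] at hc
    have hc0 : (0 : ℝ) < c := by exact_mod_cast hc.1
    rw [← Finset.sum_mul, ← mul_assoc]
    refine mul_le_mul_of_nonneg_right ?_ (energy_nonneg _ _)
    set m := (c + 1) / 2 with hm
    have hm1 : 1 ≤ m := by omega
    have hcm : (c : ℝ) ≤ 2 * m := by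
      have : c ≤ 2 * m := by omega
      exact_mod_cast this
    rw [← Finset.sum_filter]
    have hle : ∀ b ∈ (Finset.Icc 1 n).filter (fun b => c ≤ 2 * b),
        ((b : ℝ) ^ 4)⁻¹ ≤ 4 * ((c : ℝ) ^ 2)⁻¹ * ((b : ℝ) ^ 2)⁻¹ := by
      intro b hb
      rw [Finset.mem_filter, Finset.mem_Icc] at hb
      have hb' : (0 : ℝ) < b := by exact_mod_cast hb.1.1
      have hcb : (c : ℝ) ≤ 2 * b := by exact_mod_cast hb.2
      have h2 : ((2 * b : ℝ) ^ 2)⁻¹ ≤ ((c : ℝ) ^ 2)⁻¹ := by gcongr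
      calc ((b : ℝ) ^ 4)⁻¹ = 4 * ((2 * b : ℝ) ^ 2)⁻¹ * ((b : ℝ) ^ 2)⁻¹ := by field_simp; norm_num
        _ ≤ _ := by gcongr
    calc _ ≤ _ := Finset.sum_le_sum hle
      _ ≤ ∑ b ∈ Finset.Ioo (m - 1) (n + 1), 4 * ((c : ℝ) ^ 2)⁻¹ * ((b : ℝ) ^ 2)⁻¹ := by
          refine Finset.sum_le_sum_of_subset_of_nonneg (fun b hb => ?_) fun _ _ _ => by positivity
          simp only [Finset.mem_filter, Finset.mem_Icc] at hb
          rw [Finset.mem_Ioo]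
          omega
      _ ≤ 4 * ((c : ℝ) ^ 2)⁻¹ * (4 / c) := by
          rw [← Finset.mul_sum]
          refine mul_le_mul_of_nonneg_left ?_ (by positivity)
          refine (sum_Ioo_inv_sq_le (α := ℝ) (m - 1) (n + 1)).trans ?_
          have : ((m - 1 : ℕ) : ℝ) + 1 = m := by
            rw [Nat.cast_sub hm1]
            simp
          rw [this, div_le_div_iff₀ (by exact_mod_cast hm1) hc0]
          linarith
      _ = 16 * ((c : ℝ) ^ 3)⁻¹ := by field_simp; norm_num
  have h1 := Finset.sum_le_sum hc
  rw [← Finset.mul_sum] at h1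
  have hE := energy_nonneg f (y ^ a)
  calc (1 + Real.log n) * energy f (y ^ a)
      ≤ (2 * ∑ b ∈ Finset.Icc 1 n, (b : ℝ)⁻¹) * energy f (y ^ a) := by gcongr
    _ = 2 * ((∑ b ∈ Finset.Icc 1 n, (b : ℝ)⁻¹) * energy f (y ^ a)) := by ring
    _ ≤ 2 * (16 * (n : ℝ) ^ 2 *
        (16 * ∑ c ∈ Finset.Icc 1 (2 * n), ((c : ℝ) ^ 3)⁻¹ * energy f (y ^ c))) := by
      refine mul_le_mul_of_nonneg_left (hsum.trans ?_) two_pos.le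
      exact mul_le_mul_of_nonneg_left h1 (by positivity)
    _ = _ := by ring

/-- The Dirichlet form of `ξ_α` along the powers of `y` controls the energies along all the powers up
to `n`, with the rate `r_α(n)`. -/
theorem exists_stepRate_mul_energy_le {a : StepIndex} (ha : a ≠ .trivial) :
    ∃ C : ℝ, 0 < C ∧ ∀ (f : G → ℝ), (Function.support f).Finite → ∀ (y : G) (n l : ℕ), 1 ≤ n →
      l ≤ n → stepRate a n * energy f (y ^ l)
        ≤ C * ∑ c ∈ Finset.Icc 1 (2 * n), stepMeasure a c * energy f (y ^ c) := by
  have hsq : ∃ C : ℝ, 0 < C ∧ ∀ (f : G → ℝ), (Function.support f).Finite →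
      ∀ (y : G) (n l : ℕ), 1 ≤ n → l ≤ n → ((n : ℝ) ^ 2)⁻¹ * energy f (y ^ l)
        ≤ C * ∑ c ∈ Finset.Icc 1 (2 * n), stepMeasure a c * energy f (y ^ c) := by
    have hp := stepMeasure_one_pos ha
    refine ⟨(stepMeasure a 1)⁻¹, by positivity, fun f hf y n l hn hl => ?_⟩
    have hn' : (0 : ℝ) < n := by exact_mod_cast hn
    have hl' : (l : ℝ) ≤ n := by exact_mod_cast hl
    have h1 : stepMeasure a 1 * energy f y
        ≤ ∑ c ∈ Finset.Icc 1 (2 * n), stepMeasure a c * energy f (y ^ c) := by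
      have := Finset.single_le_sum (f := fun c : ℕ => stepMeasure a c * energy f (y ^ c))
        (s := Finset.Icc 1 (2 * n))
        (fun c _ => mul_nonneg (stepMeasure_nonneg _ _) (energy_nonneg _ _))
        (Finset.mem_Icc.mpr ⟨le_rfl, by omega⟩)
      simpa using this
    calc _ ≤ ((n : ℝ) ^ 2)⁻¹ * ((l : ℝ) ^ 2 * energy f y) := by
          gcongr
          exact energy_pow_le hf y l
      _ ≤ ((n : ℝ) ^ 2)⁻¹ * ((n : ℝ) ^ 2 * energy f y) := by
          have := energy_nonneg f y
          gcongr
      _ = (stepMeasure a 1)⁻¹ * (stepMeasure a 1 * energy f y) := by field_simp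
      _ ≤ _ := by gcongr
  rcases a with ⟨α, hα⟩ | _ | _
  · obtain ⟨c₀, hc₀, hξ⟩ := exists_le_stepMeasure_power hα
    simp only [stepRate]
    split_ifs with h1 h2
    · refine ⟨4 * 2 ^ (α + 1) * c₀⁻¹, by positivity, fun f hf y n l hn hl => ?_⟩
      have hn' : (0 : ℝ) < n := by exact_mod_cast hn
      have h3 := energy_pow_le_average hf y hl
      have h4 : ∀ c ∈ Finset.Icc 1 (2 * n), c₀ * (2 * n : ℝ) ^ (-α - 1) * energy f (y ^ c)
          ≤ stepMeasure (.power α hα) c * energy f (y ^ c) := by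
        intro c hc
        rw [Finset.mem_Icc] at hc
        have hc0 : (0 : ℝ) < c := by exact_mod_cast hc.1
        have hcn : (c : ℝ) ≤ 2 * n := by exact_mod_cast hc.2
        refine mul_le_mul_of_nonneg_right (le_trans ?_ (hξ c hc.1)) (energy_nonneg _ _)
        refine mul_le_mul_of_nonneg_left ?_ hc₀.le
        exact Real.rpow_le_rpow_of_nonpos hc0 hcn (by linarith)
      have h5 := Finset.sum_le_sum h4
      rw [← Finset.mul_sum] at h5
      set S := ∑ c ∈ Finset.Icc 1 (2 * n), energy f (y ^ c)
      have e1 : (n : ℝ) ^ (-α) = n ^ (-α - 1) * n := by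
        rw [← Real.rpow_add_one hn'.ne']
        congr 1
        ring
      have e2 : (2 : ℝ) ^ (α + 1) * (2 * n : ℝ) ^ (-α - 1) = (n : ℝ) ^ (-α - 1) := by
        rw [Real.mul_rpow two_pos.le hn'.le, ← mul_assoc, ← Real.rpow_add two_pos]
        have : α + 1 + (-α - 1) = 0 := by ring
        rw [this, Real.rpow_zero, one_mul]
      calc (n : ℝ) ^ (-α) * energy f (y ^ l) = n ^ (-α - 1) * (n * energy f (y ^ l)) := by
            rw [e1, mul_assoc]
        _ ≤ n ^ (-α - 1) * (4 * S) := by gcongr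
        _ = 4 * 2 ^ (α + 1) * c₀⁻¹ * (c₀ * (2 * n : ℝ) ^ (-α - 1) * S) := by
            rw [← e2]
            field_simp
        _ ≤ _ := by gcongr
    · refine ⟨512 * c₀⁻¹, by positivity, fun f hf y n l hn hl => ?_⟩
      have hn' : (0 : ℝ) < n := by exact_mod_cast hn
      have h3 := one_add_log_mul_energy_pow_le hf y hn hl
      have h4 : ∀ c ∈ Finset.Icc 1 (2 * n), c₀ * (((c : ℝ) ^ 3)⁻¹ * energy f (y ^ c))
          ≤ stepMeasure (.power α hα) c * energy f (y ^ c) := by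
        intro c hc
        rw [Finset.mem_Icc] at hc
        have hc0 : (0 : ℝ) < c := by exact_mod_cast hc.1
        rw [← mul_assoc]
        refine mul_le_mul_of_nonneg_right (le_of_eq_of_le ?_ (hξ c hc.1)) (energy_nonneg _ _)
        rw [h2, ← Real.rpow_natCast, ← Real.rpow_neg hc0.le]
        norm_num
      have h5 := Finset.sum_le_sum h4
      rw [← Finset.mul_sum] at h5
      calc (1 + Real.log n) * ((n : ℝ) ^ 2)⁻¹ * energy f (y ^ l)
          = ((n : ℝ) ^ 2)⁻¹ * ((1 + Real.log n) * energy f (y ^ l)) := by ring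
        _ ≤ ((n : ℝ) ^ 2)⁻¹ * (512 * (n : ℝ) ^ 2 *
            ∑ c ∈ Finset.Icc 1 (2 * n), ((c : ℝ) ^ 3)⁻¹ * energy f (y ^ c)) := by gcongr
        _ = 512 * c₀⁻¹ * (c₀ *
            ∑ c ∈ Finset.Icc 1 (2 * n), ((c : ℝ) ^ 3)⁻¹ * energy f (y ^ c)) := by field_simp
        _ ≤ _ := by gcongr
    · exact hsq
  · exact hsq
  · exact absurd rfl ha

end StepMeasure

/-! ### The Dirichlet forms -/

section Forms

variable {k : ℕ}

theorem dirichletForm_houghtonMeasure {p : RayPair k → ℤ → ℝ} (hp : ∀ e n, 0 ≤ p e n)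
    (hs : ∀ e, Summable (p e)) {f : houghtonGroup k → ℝ} (hf : (Function.support f).Finite) :
    dirichletForm (houghtonMeasure p) f = (1 / 2) * (ENNReal.ofReal ((k.choose 2 : ℕ) : ℝ)⁻¹ *
      ∑ e : RayPair k, ∑' n : ℤ, ENNReal.ofReal (p e n * energy f (houghtonGen e ^ n))) := by
  classical
  have hite : ∀ e (g : houghtonGroup k) n, 0 ≤ if g = houghtonGen e ^ n then p e n else 0 :=
    fun e g n => by
      split_ifs
      · exact hp e n
      · exact le_rfl
  have hq : ∀ g, houghtonMeasure p g
      = ((k.choose 2 : ℕ) : ℝ)⁻¹ * ∑ e, ∑' n, if g = houghtonGen e ^ n then p e n else 0 :=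
    fun g => by
      unfold houghtonMeasure
      congr!
  have hsum : ∀ g, 0 ≤ ∑ e, ∑' n, if g = houghtonGen e ^ n then p e n else 0 := fun g =>
    Finset.sum_nonneg fun e _ => tsum_nonneg (hite e g)
  rw [dirichletForm_eq (fun g => by rw [hq]; exact mul_nonneg (by positivity) (hsum g)) hf]
  congr 1
  have hterm : ∀ g, ENNReal.ofReal (houghtonMeasure p g) * ENNReal.ofReal (energy f g)
      = ENNReal.ofReal ((k.choose 2 : ℕ) : ℝ)⁻¹ * ∑ e, ∑' n,
        if g = houghtonGen e ^ n then
          ENNReal.ofReal (p e n * energy f (houghtonGen e ^ n)) else 0 := by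
    intro g
    rw [hq, ENNReal.ofReal_mul (by positivity), mul_assoc]
    congr 1
    rw [ENNReal.ofReal_sum_of_nonneg fun e _ => tsum_nonneg (hite e g), Finset.sum_mul]
    refine Finset.sum_congr rfl fun e _ => ?_
    rw [ENNReal.ofReal_tsum_of_nonneg (hite e g)
      ((hs e).of_nonneg_of_le (hite e g) fun n => by
        split_ifs
        · exact le_rfl
        · exact hp e n), ← ENNReal.tsum_mul_right]
    refine tsum_congr fun n => ?_
    split_ifs with h
    · rw [h, ENNReal.ofReal_mul (hp e n)]
    · simp
  rw [tsum_congr hterm, ENNReal.tsum_mul_left]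
  congr 1
  rw [Summable.tsum_finsetSum fun _ _ => ENNReal.summable]
  refine Finset.sum_congr rfl fun e _ => ?_
  rw [ENNReal.tsum_comm]
  refine tsum_congr fun n => ?_
  rw [tsum_ite_eq]

end Forms

/-! ### Lower bounds for the spectral profiles -/

section LowerBounds

theorem one_le_logRatio {v : ℝ} (hv : 0 < v) : 1 ≤ logRatio v := by
  unfold logRatio
  have hx : 0 < Real.log (1 + v) := Real.log_pos (by linarith)
  have hl : 0 < Real.log (1 + Real.log (1 + v)) := Real.log_pos (by linarith)
  rw [one_le_div hl]
  have := Real.log_le_sub_one_of_pos (by linarith : 0 < 1 + Real.log (1 + v))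
  linarith

theorem half_log_le_one_add_log_logRatio {v : ℝ} (hv : 1 ≤ v) :
    Real.log (1 + Real.log (1 + v)) / 2 ≤ 1 + Real.log (logRatio v) := by
  unfold logRatio
  set x := Real.log (1 + v) with hx
  have hx1 : 0.69 < x := by
    have h1 := Real.log_le_log two_pos (by linarith : (2 : ℝ) ≤ 1 + v)
    have h2 := Real.log_two_gt_d9
    norm_num at h2 ⊢
    linarith
  have hx0 : 0 < x := by linarith
  set l := Real.log (1 + x) with hl
  have hl0 : 0 < l := Real.log_pos (by linarith)
  rw [Real.log_div hx0.ne' hl0.ne']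
  have h1 : Real.log l ≤ l / 2 := by
    have h2 := Real.log_le_sub_one_of_pos (half_pos hl0)
    rw [Real.log_div hl0.ne' two_ne_zero] at h2
    have h3 := Real.log_two_lt_d9
    norm_num at h3
    linarith
  have h2 : l - 1 ≤ Real.log x := by
    have h3 : 1 + x ≤ x * Real.exp 1 := by
      have := Real.exp_one_gt_d9
      norm_num at this hx1
      nlinarith
    have h4 := Real.log_le_log (by linarith) h3
    rw [Real.log_mul hx0.ne' (Real.exp_pos 1).ne', Real.log_exp] at h4
    linarith
  linarith

theorem exp_le_factorial (d : ℕ) (hd : 0 < d) :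
    Real.exp (d * (Real.log d - 1)) ≤ d.factorial := by
  have hd' : (0 : ℝ) < d := by exact_mod_cast hd
  have h := Real.pow_div_factorial_le_exp (d : ℝ) hd'.le d
  have hf : (0 : ℝ) < d.factorial := by exact_mod_cast d.factorial_pos
  rw [div_le_iff₀ hf] at h
  rw [mul_sub, mul_one, Real.exp_sub, mul_comm, Real.exp_mul, Real.exp_log hd',
    Real.rpow_natCast, div_le_iff₀ (Real.exp_pos _)]
  linarith

/-- The choice of the scale in the lower bound: sets of volume `v` have fewer than `d!` elements for
a `d` of the order of `logRatio v`. -/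
theorem lt_factorial_ceil_logRatio {v : ℝ} (hv : 1 ≤ v) :
    v < (⌈8 * logRatio v⌉₊.factorial : ℝ) := by
  set t := logRatio v with ht
  have ht1 : 1 ≤ t := one_le_logRatio (by linarith)
  have hl := half_log_le_one_add_log_logRatio hv
  rw [← ht] at hl
  have hx0 : 0 < Real.log (1 + v) := Real.log_pos (by linarith)
  have hl0 : 0 < Real.log (1 + Real.log (1 + v)) := Real.log_pos (by linarith)
  have htl : t * Real.log (1 + Real.log (1 + v)) = Real.log (1 + v) := by
    rw [ht, logRatio, div_mul_cancel₀ _ hl0.ne']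
  set d := ⌈8 * t⌉₊ with hd
  have hdt : 8 * t ≤ d := Nat.le_ceil _
  have hd0 : 0 < d := Nat.ceil_pos.mpr (by linarith)
  have hlog : 2 + Real.log t ≤ Real.log d := by
    have h1 := Real.log_le_log (by linarith) hdt
    have h8 : Real.log 8 = 3 * Real.log 2 := by
      rw [show (8 : ℝ) = 2 ^ 3 by norm_num, Real.log_pow]
      norm_num
    rw [Real.log_mul (by norm_num) (by linarith), h8] at h1
    have h3 := Real.log_two_gt_d9
    norm_num at h3
    linarith
  have hkey : Real.log (1 + v) ≤ d * (Real.log d - 1) := by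
    calc Real.log (1 + v) = t * Real.log (1 + Real.log (1 + v)) := htl.symm
      _ ≤ 8 * t * (1 + Real.log t) := by nlinarith
      _ ≤ d * (Real.log d - 1) := by
          have : 0 ≤ 1 + Real.log t := by linarith
          gcongr
          linarith
  calc v < 1 + v := by linarith
    _ = Real.exp (Real.log (1 + v)) := (Real.exp_log (by linarith)).symm
    _ ≤ Real.exp (d * (Real.log d - 1)) := Real.exp_le_exp.mpr hkey
    _ ≤ _ := exp_le_factorial d hd0

variable {k : ℕ}

/-- A lower bound for the spectral profile of a measure whose Dirichlet form controls the
translations along one line at all scales, with the rate `r_α`, and one translation along another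
line. -/
theorem exists_stepRate_le_spectralProfile {φ : houghtonGroup k → ℝ} {e e' : RayPair k}
    (hne : e ≠ e') {a : StepIndex} (ha : a ≠ .trivial) {C : ℝ} (hC : 0 < C)
    (H : ∀ f : houghtonGroup k → ℝ, (Function.support f).Finite → dirichletForm φ f ≠ ⊤ →
      (∀ n l : ℕ, 1 ≤ n → l ≤ n →
        stepRate a n * energy f (houghtonGen e ^ l) ≤ C * (dirichletForm φ f).toReal) ∧
      energy f (houghtonGen e') ≤ C * (dirichletForm φ f).toReal) :
    ∃ c : ℝ, 0 < c ∧ ∀ v : ℝ, 1 ≤ v →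
      ENNReal.ofReal (c * stepRate a (logRatio v)) ≤ spectralProfile φ v := by
  obtain ⟨C₁, hC₁, h₁⟩ := exists_sum_sq_le_energy hne
  obtain ⟨C₂, hC₂, h₂⟩ := exists_stepRate_le_mul a (K := 36) (by norm_num)
  refine ⟨(C₁ * C * C₂)⁻¹, by positivity, fun v hv => ?_⟩
  have ht1 : 1 ≤ logRatio v := one_le_logRatio (by linarith)
  set t := logRatio v with ht
  set d := ⌈8 * t⌉₊ with hd
  have hdt : 8 * t ≤ d := Nat.le_ceil _
  have hdt' : (d : ℝ) < 8 * t + 1 := Nat.ceil_lt_add_one (by linarith)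
  have hd0 : 0 < d := Nat.ceil_pos.mpr (by linarith)
  have hn1 : (1 : ℝ) ≤ ((4 * d : ℕ) : ℝ) := by
    push_cast
    linarith
  have hrate : stepRate a t ≤ C₂ * stepRate a ((4 * d : ℕ) : ℝ) :=
    h₂ _ _ ht1 (by push_cast; linarith) (by push_cast; linarith)
  have hpos := stepRate_pos ha hn1
  have hle1 := stepRate_le_one a hn1
  set r := stepRate a ((4 * d : ℕ) : ℝ) with hr
  unfold spectralProfile dirichletEigenvalue
  refine le_iInf₂ fun Ω hΩ => le_iInf fun f => le_iInf₂ fun hf hnorm => ?_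
  by_cases htop : dirichletForm φ f = ⊤
  · rw [htop]
    exact le_top
  obtain ⟨H1, H2⟩ := H f (Ω.finite_toSet.subset hf) htop
  refine ENNReal.ofReal_le_of_le_toReal ?_
  set D := (dirichletForm φ f).toReal with hD
  have hD0 : 0 ≤ D := ENNReal.toReal_nonneg
  have hcard : Ω.card < d.factorial := by
    have := hΩ.trans_lt (lt_factorial_ceil_logRatio hv)
    exact_mod_cast this
  have h := h₁ d hd0 Ω hcard f hf (C * D / r)
    (fun l _ hl => by
      rw [le_div_iff₀ hpos, mul_comm]
      exact H1 _ l (by omega) hl)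
    (H2.trans (by
      rw [le_div_iff₀ hpos]
      exact mul_le_of_le_one_right (by positivity) hle1))
  rw [hnorm, ← mul_div_assoc, le_div_iff₀ hpos, one_mul] at h
  rw [inv_mul_le_iff₀ (by positivity)]
  calc stepRate a t ≤ C₂ * r := hrate
    _ ≤ C₂ * (C₁ * (C * D)) := by gcongr
    _ = _ := by ring

theorem sum_energy_le_dirichletForm {p : RayPair k → ℤ → ℝ} (hk : 2 ≤ k) (hp : ∀ e n, 0 ≤ p e n)
    (hs : ∀ e, Summable (p e)) {f : houghtonGroup k → ℝ} (hf : (Function.support f).Finite)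
    (htop : dirichletForm (houghtonMeasure p) f ≠ ⊤) (e : RayPair k) (s : Finset ℕ) :
    ∑ n ∈ s, p e n * energy f (houghtonGen e ^ n)
      ≤ 2 * (k.choose 2 : ℕ) * (dirichletForm (houghtonMeasure p) f).toReal := by
  have hch : (0 : ℝ) < (k.choose 2 : ℕ) := by exact_mod_cast Nat.choose_pos hk
  have h1 : ENNReal.ofReal ((1 / 2) * (((k.choose 2 : ℕ) : ℝ)⁻¹ *
      ∑ n ∈ s, p e n * energy f (houghtonGen e ^ n))) ≤ dirichletForm (houghtonMeasure p) f := by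
    rw [dirichletForm_houghtonMeasure hp hs hf, ENNReal.ofReal_mul (by norm_num),
      ENNReal.ofReal_mul (by positivity)]
    have e2 : ENNReal.ofReal (1 / 2) = 1 / 2 := by
      rw [ENNReal.ofReal_div_of_pos two_pos]
      simp
    rw [e2]
    gcongr
    refine le_trans ?_ (Finset.single_le_sum (f := fun e => ∑' n : ℤ,
      ENNReal.ofReal (p e n * energy f (houghtonGen e ^ n))) (fun _ _ => zero_le)
      (Finset.mem_univ e))
    rw [ENNReal.ofReal_sum_of_nonneg fun n _ => mul_nonneg (hp e _) (energy_nonneg _ _)]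
    have h2 := ENNReal.sum_le_tsum (f := fun n : ℤ =>
      ENNReal.ofReal (p e n * energy f (houghtonGen e ^ n))) (s.map Nat.castEmbedding)
    rw [Finset.sum_map] at h2
    simpa using h2
  have h2 := (ENNReal.ofReal_le_iff_le_toReal htop).mp h1
  set S := ∑ n ∈ s, p e n * energy f (houghtonGen e ^ n)
  have h3 : S = 2 * (k.choose 2 : ℕ) * ((1 / 2) * (((k.choose 2 : ℕ) : ℝ)⁻¹ * S)) := by
    field_simp
  rw [h3]
  gcongr

theorem exists_decrInverse_le_spectralProfile (hk : 2 ≤ k) (α : RayPair k → StepIndex)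
    (hα : ∃ e e' : RayPair k, e ≠ e' ∧ α e ≠ StepIndex.trivial ∧ α e' ≠ StepIndex.trivial) :
    ∃ c : ℝ, 0 < c ∧ ∀ v : ℝ, 1 ≤ v → ENNReal.ofReal (c * decrInverse (maxRho α) (logRatio v))
      ≤ spectralProfile (houghtonMeasure fun e => stepMeasure (α e)) v := by
  have hp : ∀ e n, 0 ≤ (fun e => stepMeasure (α e)) e n := fun e n => stepMeasure_nonneg _ _
  have hs : ∀ e, Summable ((fun e => stepMeasure (α e)) e) := fun e => summable_stepMeasure _
  have hch : (0 : ℝ) < (k.choose 2 : ℕ) := by exact_mod_cast Nat.choose_pos hk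
  have hother : ∀ e, ∃ e', e ≠ e' ∧ α e' ≠ .trivial := by
    obtain ⟨e₁, e₂, hne, h1, h2⟩ := hα
    intro e
    by_cases h : e = e₁
    · exact ⟨e₂, h ▸ hne, h2⟩
    · exact ⟨e₁, h, h1⟩
  have hline : ∀ e, ∃ c : ℝ, 0 < c ∧ ∀ v : ℝ, 1 ≤ v →
      ENNReal.ofReal (c * stepRate (α e) (logRatio v))
        ≤ spectralProfile (houghtonMeasure fun e => stepMeasure (α e)) v := by
    intro e
    by_cases he : α e = .trivial
    · exact ⟨1, one_pos, fun v _ => by simp [he, stepRate]⟩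
    obtain ⟨e', hne, he'⟩ := hother e
    obtain ⟨C₁, hC₁, h₁⟩ := exists_stepRate_mul_energy_le (G := houghtonGroup k) he
    have hp' := stepMeasure_one_pos he'
    refine exists_stepRate_le_spectralProfile hne he
      (C := C₁ * (2 * (k.choose 2 : ℕ)) + (stepMeasure (α e') 1)⁻¹ * (2 * (k.choose 2 : ℕ)))
      (by positivity) fun f hf htop => ⟨fun n l hn hl => ?_, ?_⟩
    · refine (h₁ f hf _ n l hn hl).trans ?_
      have h2 := sum_energy_le_dirichletForm hk hp hs hf htop e (Finset.Icc 1 (2 * n))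
      rw [add_mul]
      refine le_add_of_le_of_nonneg ?_ (by positivity)
      rw [mul_assoc]
      gcongr
    · have h2 := sum_energy_le_dirichletForm hk hp hs hf htop e' {1}
      rw [Finset.sum_singleton, pow_one, Nat.cast_one, mul_comm,
        ← le_div_iff₀ hp', div_eq_inv_mul, ← mul_assoc] at h2
      rw [add_mul]
      exact le_add_of_nonneg_of_le (by positivity) h2
  choose c hc hcle using hline
  obtain ⟨e₀, -, -, he₀, -⟩ := hα
  have hsum : 0 < ∑ e, (c e)⁻¹ :=
    Finset.sum_pos (fun e _ => inv_pos.mpr (hc e)) ⟨e₀, Finset.mem_univ _⟩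
  refine ⟨(2 * ∑ e, (c e)⁻¹)⁻¹, by positivity, fun v hv => ?_⟩
  have ht := one_le_logRatio (by linarith : 0 < v)
  by_cases htop : spectralProfile (houghtonMeasure fun e => stepMeasure (α e)) v = ⊤
  · rw [htop]
    exact le_top
  refine ENNReal.ofReal_le_of_le_toReal ?_
  rw [inv_mul_le_iff₀ (by positivity)]
  refine (decrInverse_le_sum_stepRate α he₀ ht).trans ?_
  rw [mul_assoc, Finset.sum_mul]
  refine mul_le_mul_of_nonneg_left (Finset.sum_le_sum fun e _ => ?_) two_pos.le
  rw [← div_eq_inv_mul, le_div_iff₀ (hc e), mul_comm]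
  exact (ENNReal.ofReal_le_iff_le_toReal htop).mp (hcle e v hv)

theorem exists_energy_le_dirichletForm {G : Type*} [Group G] {φ : G → ℝ} (hφ : ∀ g, 0 ≤ φ g)
    (hgen : Subgroup.closure (Function.support φ) = ⊤) (g : G) :
    ∃ C : ℝ, 0 < C ∧ ∀ f : G → ℝ, (Function.support f).Finite → dirichletForm φ f ≠ ⊤ →
      energy f g ≤ C * (dirichletForm φ f).toReal := by
  have hg : g ∈ Subgroup.closure (Function.support φ) := hgen ▸ Subgroup.mem_top g
  induction hg using Subgroup.closure_induction with
  | mem s hs =>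
    have hs0 : 0 < φ s := lt_of_le_of_ne (hφ s) (Ne.symm hs)
    refine ⟨2 * (φ s)⁻¹, by positivity, fun f hf htop => ?_⟩
    have h1 : ENNReal.ofReal ((1 / 2) * (φ s * energy f s)) ≤ dirichletForm φ f := by
      rw [dirichletForm_eq hφ hf, ENNReal.ofReal_mul (by norm_num), ENNReal.ofReal_mul (hφ s)]
      have e2 : ENNReal.ofReal (1 / 2) = 1 / 2 := by
        rw [ENNReal.ofReal_div_of_pos two_pos]
        simp
      rw [e2]
      gcongr
      exact ENNReal.le_tsum s
    have h2 := (ENNReal.ofReal_le_iff_le_toReal htop).mp h1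
    calc energy f s = 2 * (φ s)⁻¹ * ((1 / 2) * (φ s * energy f s)) := by field_simp
      _ ≤ _ := by gcongr
  | one => exact ⟨1, one_pos, fun f _ _ => by rw [energy_one]; positivity⟩
  | mul x y _ _ hx hy =>
    obtain ⟨C, hC, h⟩ := hx
    obtain ⟨C', hC', h'⟩ := hy
    refine ⟨2 * C + 2 * C', by positivity, fun f hf htop => ?_⟩
    have := energy_mul_le_two hf x y
    have := h f hf htop
    have := h' f hf htop
    linarith
  | inv x _ hx =>
    obtain ⟨C, hC, h⟩ := hx
    exact ⟨C, hC, fun f hf htop => by rw [energy_inv]; exact h f hf htop⟩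

theorem exists_inv_sq_le_spectralProfile {e e' : RayPair k} (hne : e ≠ e')
    {φ : houghtonGroup k → ℝ} (hφ : ∀ g, 0 ≤ φ g)
    (hgen : Subgroup.closure (Function.support φ) = ⊤) :
    ∃ c : ℝ, 0 < c ∧ ∀ v : ℝ, 1 ≤ v →
      ENNReal.ofReal (c * (logRatio v ^ 2)⁻¹) ≤ spectralProfile φ v := by
  obtain ⟨C, hC, h⟩ := exists_energy_le_dirichletForm hφ hgen (houghtonGen e)
  obtain ⟨C', hC', h'⟩ := exists_energy_le_dirichletForm hφ hgen (houghtonGen e')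
  refine exists_stepRate_le_spectralProfile hne (a := .simple) (by simp) (C := C + C')
    (by positivity) fun f hf htop => ⟨fun n l hn hl => ?_, ?_⟩
  · have hn' : (0 : ℝ) < n := by exact_mod_cast hn
    have hl' : (l : ℝ) ≤ n := by exact_mod_cast hl
    have hE := energy_nonneg f (houghtonGen e)
    calc stepRate .simple n * energy f (houghtonGen e ^ l)
        ≤ ((n : ℝ) ^ 2)⁻¹ * ((l : ℝ) ^ 2 * energy f (houghtonGen e)) := by
          rw [stepRate]
          gcongr
          exact energy_pow_le hf _ _
      _ ≤ ((n : ℝ) ^ 2)⁻¹ * ((n : ℝ) ^ 2 * energy f (houghtonGen e)) := by gcongr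
      _ = energy f (houghtonGen e) := by field_simp
      _ ≤ C * (dirichletForm φ f).toReal := h f hf htop
      _ ≤ _ := by
          gcongr
          linarith
  · refine (h' f hf htop).trans ?_
    gcongr
    linarith

end LowerBounds

/-! ### Translation vectors -/

section Shift

variable {k : ℕ}

/-- `x` acts as the translation by `M i` on the points of the ray `R_i` at distance more than `R`
from the centre. -/
def TranslatesBeyond (R : ℕ) (x : houghtonGroup k) (M : Fin k → ℤ) : Prop :=
  ∀ (i : Fin k) (p : ℕ), R ≤ p →
    ∃ q : ℕ, (q : ℤ) = (p : ℤ) + M i ∧ x • (some (i, p) : HStar k) = some (i, q)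

theorem TranslatesBeyond.mono {R R' : ℕ} {x : houghtonGroup k} {M : Fin k → ℤ}
    (h : TranslatesBeyond R x M) (hR : R ≤ R') : TranslatesBeyond R' x M :=
  fun i p hp => h i p (hR.trans hp)

theorem TranslatesBeyond.unique {R R' : ℕ} {x : houghtonGroup k} {M M' : Fin k → ℤ}
    (h : TranslatesBeyond R x M) (h' : TranslatesBeyond R' x M') : M = M' := by
  ext i
  obtain ⟨q, hq, e⟩ := h i (R + R') (by omega)
  obtain ⟨q', hq', e'⟩ := h' i (R + R') (by omega)
  rw [e] at e'
  simp only [Option.some.injEq, Prod.mk.injEq, true_and] at e'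
  omega

theorem TranslatesBeyond.mul {R R' : ℕ} {x y : houghtonGroup k} {M M' : Fin k → ℤ}
    (h : TranslatesBeyond R x M) (h' : TranslatesBeyond R' y M')
    (hR : ∀ i, (R : ℤ) ≤ R' + M' i) : TranslatesBeyond R' (x * y) (M + M') := by
  intro i p hp
  obtain ⟨q', hq', e'⟩ := h' i p hp
  have := hR i
  obtain ⟨q, hq, e⟩ := h i q' (by omega)
  refine ⟨q, ?_, ?_⟩
  · rw [hq, hq', Pi.add_apply]
    ring
  · rw [mul_smul, e', e]

theorem TranslatesBeyond.inv {R R' : ℕ} {x : houghtonGroup k} {M : Fin k → ℤ}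
    (h : TranslatesBeyond R x M) (hR : ∀ i, (R : ℤ) + M i ≤ R') :
    TranslatesBeyond R' x⁻¹ (-M) := by
  intro i p hp
  have := hR i
  obtain ⟨q, hq, e⟩ := h i ((p : ℤ) - M i).toNat (by omega)
  refine ⟨((p : ℤ) - M i).toNat, ?_, ?_⟩
  · rw [Pi.neg_apply]
    omega
  · rw [inv_smul_eq_iff, e]
    congr 2
    omega

theorem exists_translatesBeyond (x : houghtonGroup k) :
    ∃ (M : Fin k → ℤ) (R : ℕ), TranslatesBeyond R x M := by
  obtain ⟨M, R, h⟩ := x.2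
  exact ⟨M, R, h⟩

/-- The vector of the eventual translations of an element of the Houghton group. -/
def shift (x : houghtonGroup k) : Fin k → ℤ := (exists_translatesBeyond x).choose

theorem exists_translatesBeyond_shift (x : houghtonGroup k) :
    ∃ R : ℕ, TranslatesBeyond R x (shift x) := (exists_translatesBeyond x).choose_spec

theorem TranslatesBeyond.shift_eq {R : ℕ} {x : houghtonGroup k} {M : Fin k → ℤ}
    (h : TranslatesBeyond R x M) : shift x = M := by
  obtain ⟨R', h'⟩ := exists_translatesBeyond_shift x
  exact h'.unique h

theorem TranslatesBeyond.eq_shift {R : ℕ} {x : houghtonGroup k} {M : Fin k → ℤ}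
    (h : TranslatesBeyond R x M) : TranslatesBeyond R x (shift x) := by
  rwa [h.shift_eq]

theorem natAbs_shift_le_sum (x : houghtonGroup k) (i : Fin k) :
    (shift x i).natAbs ≤ ∑ i, (shift x i).natAbs :=
  Finset.single_le_sum (f := fun i => (shift x i).natAbs) (fun _ _ => Nat.zero_le _)
    (Finset.mem_univ i)

theorem shift_mul (x y : houghtonGroup k) : shift (x * y) = shift x + shift y := by
  obtain ⟨R, h⟩ := exists_translatesBeyond_shift x
  obtain ⟨R', h'⟩ := exists_translatesBeyond_shift y
  refine (h.mul (h'.mono (R' := R' + R + ∑ i, (shift y i).natAbs) (by omega)) fun i => ?_).shift_eq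
  have := natAbs_shift_le_sum y i
  omega

theorem shift_inv (x : houghtonGroup k) : shift x⁻¹ = -shift x := by
  obtain ⟨R, h⟩ := exists_translatesBeyond_shift x
  refine (h.inv (R' := R + ∑ i, (shift x i).natAbs) fun i => ?_).shift_eq
  have := natAbs_shift_le_sum x i
  omega

/-- The points of the star at distance at most `r i` from the centre on the ray `R_i`. -/
def starBall (r : Fin k → ℕ) : Finset (HStar k) :=
  Finset.insertNone ((Finset.univ.sigma fun i => Finset.range (r i)).map
    (Equiv.sigmaEquivProd (Fin k) ℕ).toEmbedding)

theorem none_mem_starBall (r : Fin k → ℕ) : none ∈ starBall r := Finset.none_mem_insertNone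

theorem some_mem_starBall {r : Fin k → ℕ} {i : Fin k} {p : ℕ} :
    some (i, p) ∈ starBall r ↔ p < r i := by
  unfold starBall
  rw [Finset.some_mem_insertNone]
  simp

theorem card_starBall (r : Fin k → ℕ) : (starBall r).card = (∑ i, r i) + 1 := by
  simp [starBall, Finset.card_insertNone]

theorem TranslatesBeyond.smul_mem_starBall_iff {R : ℕ} {x : houghtonGroup k} {M : Fin k → ℤ}
    (h : TranslatesBeyond R x M) (y : HStar k) :
    x • y ∈ starBall (fun i => ((R : ℤ) + M i).toNat) ↔ y ∈ starBall fun _ => R := by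
  rw [← not_iff_not]
  constructor
  · intro hy hy'
    rcases hx : x • y with _ | ⟨i, q⟩
    · rw [hx] at hy
      exact hy (none_mem_starBall _)
    · rw [hx, some_mem_starBall] at hy
      obtain ⟨p, hp⟩ : ∃ p : ℕ, (p : ℤ) = q - M i := by
        obtain ⟨q', hq', -⟩ := h i R le_rfl
        exact ⟨((q : ℤ) - M i).toNat, by omega⟩
      obtain ⟨q', hq', e⟩ := h i p (by
        obtain ⟨q', hq', -⟩ := h i R le_rfl
        omega)
      have : q' = q := by omega
      subst this
      rw [← hx] at e
      have := smul_left_cancel _ e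
      rw [← this, some_mem_starBall] at hy'
      obtain ⟨q', hq', -⟩ := h i R le_rfl
      omega
  · intro hy hy'
    rcases y with _ | ⟨i, p⟩
    · exact hy (none_mem_starBall _)
    · rw [some_mem_starBall] at hy
      obtain ⟨q, hq, e⟩ := h i p (by omega)
      rw [e, some_mem_starBall] at hy'
      omega

/-- The eventual translations of an element of the Houghton group add up to zero, since the
element is a bijection between finite sets of points near the centre. -/
theorem sum_shift (x : houghtonGroup k) : ∑ i, shift x i = 0 := by
  obtain ⟨R, h⟩ := exists_translatesBeyond_shift x
  have hcard : (starBall fun _ : Fin k => R).card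
      = (starBall fun i => ((R : ℤ) + shift x i).toNat).card := by
    refine Finset.card_bij (fun y _ => x • y) (fun y hy => (h.smul_mem_starBall_iff y).mpr hy)
      (fun y _ y' _ e => smul_left_cancel _ e) fun y hy => ⟨x⁻¹ • y, ?_, smul_inv_smul _ _⟩
    rw [← h.smul_mem_starBall_iff, smul_inv_smul]
    exact hy
  rw [card_starBall, card_starBall] at hcard
  have h2 : ∑ i : Fin k, ((((R : ℤ) + shift x i).toNat : ℕ) : ℤ) = ∑ i, ((R : ℤ) + shift x i) := by
    refine Finset.sum_congr rfl fun i _ => ?_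
    obtain ⟨q', hq', -⟩ := h i R le_rfl
    omega
  rw [Finset.sum_add_distrib] at h2
  zify at hcard
  rw [h2] at hcard
  linarith

theorem linePoint_natCast_add_one (i j : Fin k) (n : ℕ) :
    linePoint i j ((n : ℤ) + 1) = some (j, n) := rfl

theorem linePoint_neg_natCast_add_one (i j : Fin k) (n : ℕ) :
    linePoint i j (-((n : ℤ) + 1)) = some (i, n) := by
  rw [← Int.negSucc_eq]
  rfl

theorem translatesBeyond_lineTrans_zpow {i j : Fin k} (hij : i ≠ j) (s : ℤ) {R : ℕ}
    (hR : s.natAbs ≤ R) : TranslatesBeyond R (lineTrans i j hij ^ s)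
      fun a => if a = j then s else if a = i then -s else 0 := by
  intro a p hp
  by_cases haj : a = j
  · subst haj
    refine ⟨((p : ℤ) + s).toNat, by simp only [if_true]; omega, ?_⟩
    rw [← linePoint_natCast_add_one i a p, lineTrans_zpow_smul_linePoint,
      ← linePoint_natCast_add_one i a]
    congr 1
    omega
  by_cases hai : a = i
  · subst hai
    refine ⟨((p : ℤ) - s).toNat, by simp only [haj, if_false, if_true]; omega, ?_⟩
    rw [← linePoint_neg_natCast_add_one a j p, lineTrans_zpow_smul_linePoint,
      ← linePoint_neg_natCast_add_one a j]
    congr 1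
    omega
  · refine ⟨p, by simp [haj, hai], ?_⟩
    have h0 : lineTrans i j hij ∈ MulAction.stabilizer (houghtonGroup k) (some (a, p)) := by
      rw [MulAction.mem_stabilizer_iff, lineTrans_smul]
      simp [lineStep, haj, hai]
    exact MulAction.mem_stabilizer_iff.mp (zpow_mem h0 s)

/-- The largest absolute value of the eventual translations of `x`. -/
def shiftNorm (x : houghtonGroup k) : ℕ := Finset.univ.sup fun i => (shift x i).natAbs

theorem natAbs_shift_le (x : houghtonGroup k) (i : Fin k) : (shift x i).natAbs ≤ shiftNorm x :=
  Finset.le_sup (f := fun i => (shift x i).natAbs) (Finset.mem_univ i)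

theorem shiftNorm_le_iff {x : houghtonGroup k} {n : ℕ} :
    shiftNorm x ≤ n ↔ ∀ i, (shift x i).natAbs ≤ n := by
  simp [shiftNorm]

theorem shiftNorm_mul_le (x y : houghtonGroup k) :
    shiftNorm (x * y) ≤ shiftNorm x + shiftNorm y := by
  rw [shiftNorm_le_iff]
  intro i
  rw [shift_mul, Pi.add_apply]
  have := natAbs_shift_le x i
  have := natAbs_shift_le y i
  omega

theorem shiftNorm_inv (x : houghtonGroup k) : shiftNorm x⁻¹ = shiftNorm x := by
  simp [shiftNorm, shift_inv]

theorem shiftNorm_lineTrans_zpow_le {i j : Fin k} (hij : i ≠ j) (s : ℤ) :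
    shiftNorm (lineTrans i j hij ^ s) ≤ s.natAbs := by
  rw [shiftNorm_le_iff, (translatesBeyond_lineTrans_zpow hij s le_rfl).shift_eq]
  intro a
  simp only
  split_ifs <;> simp

/-- Elements with a prescribed vector of eventual translations, which is only prescribed on the
rays other than `R_z`. -/
theorem exists_shift_eq (z : Fin k) (u : Fin k → ℤ) (B : ℕ) (hu : ∀ j, (u j).natAbs ≤ B) :
    ∃ y : houghtonGroup k, TranslatesBeyond ((k + 1) * B) y (shift y) ∧
      ∀ j, j ≠ z → shift y j = u j := by
  have key : ∀ J : Finset (Fin k), z ∉ J → ∃ y : houghtonGroup k,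
      TranslatesBeyond ((J.card + 1) * B) y (shift y) ∧ (∀ i, (shift y i).natAbs ≤ J.card * B) ∧
      (∀ j ∈ J, shift y j = u j) ∧ ∀ j, j ∉ J → j ≠ z → shift y j = 0 := by
    intro J
    induction J using Finset.induction_on with
    | empty =>
      intro _
      have h1 : TranslatesBeyond 0 (1 : houghtonGroup k) 0 := fun i p _ =>
        ⟨p, by simp, one_smul _ _⟩
      refine ⟨1, h1.eq_shift.mono (by simp), ?_, by simp, ?_⟩ <;> simp [h1.shift_eq]
    | insert j J hj ih =>
      intro hz
      rw [Finset.mem_insert, not_or] at hz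
      obtain ⟨y, hy, hyb, hyJ, hy0⟩ := ih hz.2
      have hh := translatesBeyond_lineTrans_zpow hz.1 (u j) (hu j)
      have hs := shift_mul (lineTrans z j hz.1 ^ u j) y
      rw [hh.shift_eq] at hs
      refine ⟨lineTrans z j hz.1 ^ u j * y, ?_, ?_, ?_, ?_⟩
      · rw [Finset.card_insert_of_notMem hj]
        refine ((hh.mul hy fun i => ?_).eq_shift).mono (by gcongr; omega)
        have := hyb i
        have e : (J.card + 1) * B = J.card * B + B := by ring
        rw [e]
        omega
      · intro i
        rw [Finset.card_insert_of_notMem hj, hs, Pi.add_apply, add_mul, one_mul]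
        have := hyb i
        have := hu j
        split_ifs <;> omega
      · intro i hi
        rw [hs, Pi.add_apply]
        rcases Finset.mem_insert.mp hi with rfl | hi
        · rw [if_pos rfl, hy0 i hj (Ne.symm hz.1), add_zero]
        · have h1 : i ≠ j := fun h => hj (h ▸ hi)
          have h2 : i ≠ z := fun h => hz.2 (h ▸ hi)
          rw [if_neg h1, if_neg h2, hyJ i hi, zero_add]
      · intro i hi hiz
        rw [Finset.mem_insert, not_or] at hi
        rw [hs, Pi.add_apply, if_neg hi.1, if_neg hiz, hy0 i hi.2 hiz, zero_add]
  obtain ⟨y, hy, -, hyJ, -⟩ := key (Finset.univ.erase z) (by simp)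
  refine ⟨y, hy.mono ?_, fun j hj => hyJ j (by simp [hj])⟩
  have : (Finset.univ.erase z).card ≤ k := by
    refine (Finset.card_le_univ _).trans ?_
    simp
  gcongr

end Shift

/-! ### The test functions -/

section TestFunction

variable {k : ℕ}

/-- There are finitely many elements which translate by less than `n` beyond `R`. The estimate of their
number is of the form `exp (C n log n)` when `R` is a multiple of `n`. -/
theorem finite_translatesBeyond (R n : ℕ) :
    {x : houghtonGroup k | TranslatesBeyond R x (shift x) ∧ shiftNorm x < n}.Finite ∧
    {x : houghtonGroup k | TranslatesBeyond R x (shift x) ∧ shiftNorm x < n}.ncard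
      ≤ (2 * n + 1) ^ k * (k * (R + n) + 1) ^ (k * R + 1) := by
  set S := {x : houghtonGroup k | TranslatesBeyond R x (shift x) ∧ shiftNorm x < n} with hS
  -- an element is determined by its translations and its action near the centre
  let F : S → (Fin k → Finset.Icc (-(n : ℤ)) n) ×
      ((starBall fun _ : Fin k => R) → (starBall fun _ : Fin k => R + n)) := fun x =>
    (fun i => ⟨shift x.1 i, by
      rw [Finset.mem_Icc]
      have := natAbs_shift_le x.1 i
      have := x.2.2
      omega⟩,
    fun y => ⟨x.1 • y.1, by
      have h := (x.2.1.smul_mem_starBall_iff y.1).mpr y.2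
      rcases hy : x.1 • y.1 with _ | ⟨i, p⟩
      · exact none_mem_starBall _
      · rw [hy, some_mem_starBall] at h
        rw [some_mem_starBall]
        have := natAbs_shift_le x.1 i
        have := x.2.2
        omega⟩)
  have hF : Function.Injective F := by
    intro x x' h
    have h1 : ∀ i, shift x.1 i = shift x'.1 i := fun i =>
      congrArg Subtype.val (congrFun (congrArg Prod.fst h) i)
    have h2 : ∀ y : (starBall fun _ : Fin k => R), x.1 • y.1 = x'.1 • y.1 := fun y =>
      congrArg Subtype.val (congrFun (congrArg Prod.snd h) y)
    apply Subtype.ext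
    apply Subtype.ext
    apply Equiv.ext
    intro y
    change x.1 • y = x'.1 • y
    by_cases hy : y ∈ starBall fun _ : Fin k => R
    · exact h2 ⟨y, hy⟩
    · rcases y with _ | ⟨i, p⟩
      · exact absurd (none_mem_starBall _) hy
      · rw [some_mem_starBall, not_lt] at hy
        obtain ⟨q, hq, e⟩ := x.2.1 i p hy
        obtain ⟨q', hq', e'⟩ := x'.2.1 i p hy
        rw [e, e']
        have := h1 i
        have : q = q' := by omega
        rw [this]
  have : Finite S := Finite.of_injective F hF
  refine ⟨Set.toFinite _, ?_⟩
  have hc := Nat.card_le_card_of_injective F hF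
  rw [Nat.card_prod, Nat.card_fun, Nat.card_fun] at hc
  simp only [Nat.card_eq_fintype_card, Fintype.card_coe, Int.card_Icc, card_starBall,
    Finset.sum_const, Finset.card_univ, Fintype.card_fin, smul_eq_mul] at hc
  rw [← Nat.card_coe_set_eq]
  have e : ((n : ℤ) + 1 - -(n : ℤ)).toNat = 2 * n + 1 := by omega
  rw [e] at hc
  simpa using hc

/-- The elements of the Houghton group which are translations of length less than `n` beyond the
distance `R`. -/
def translationSet (k R n : ℕ) : Finset (houghtonGroup k) := (finite_translatesBeyond R n).1.toFinset

theorem mem_translationSet {R n : ℕ} {x : houghtonGroup k} :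
    x ∈ translationSet k R n ↔ TranslatesBeyond R x (shift x) ∧ shiftNorm x < n := by
  simp [translationSet]

theorem card_translationSet_le (k R n : ℕ) : (translationSet k R n).card
    ≤ (2 * n + 1) ^ k * (k * (R + n) + 1) ^ (k * R + 1) := by
  have := (finite_translatesBeyond (k := k) R n).2
  rwa [Set.ncard_eq_toFinset_card _ (finite_translatesBeyond R n).1] at this

open Classical in
/-- The test function on `translationSet k R n`, a tent function of the translation vector. -/
def tent (k R n : ℕ) (x : houghtonGroup k) : ℝ :=
  if x ∈ translationSet k R n then ((n - shiftNorm x : ℕ) : ℝ) else 0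

theorem tent_nonneg (R n : ℕ) (x : houghtonGroup k) : 0 ≤ tent k R n x := by
  unfold tent
  split_ifs
  · positivity
  · exact le_rfl

theorem support_tent_subset (R n : ℕ) :
    Function.support (tent k R n) ⊆ (translationSet k R n : Set (houghtonGroup k)) := by
  intro x hx
  by_contra h
  apply hx
  unfold tent
  rw [if_neg]
  exact fun h' => h (by exact_mod_cast h')

theorem tent_sub_le {R R' n : ℕ} (hR : R' + n ≤ R) {y : houghtonGroup k}
    (hy : TranslatesBeyond R' y (shift y)) (x : houghtonGroup k) :
    tent k R n x - tent k R n (y * x) ≤ shiftNorm y := by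
  by_cases hx : x ∈ translationSet k R n
  · have hx' := mem_translationSet.mp hx
    have hm : TranslatesBeyond R (y * x) (shift (y * x)) := by
      rw [shift_mul]
      refine hy.mul hx'.1 fun i => ?_
      have := natAbs_shift_le x i
      omega
    have hN := shiftNorm_mul_le y x
    have h1 : ((n - shiftNorm (y * x) : ℕ) : ℝ) ≤ tent k R n (y * x) := by
      by_cases hyx : y * x ∈ translationSet k R n
      · rw [tent, if_pos hyx]
      · have : n ≤ shiftNorm (y * x) := by
          by_contra h
          exact hyx (mem_translationSet.mpr ⟨hm, by omega⟩)
        rw [tent, if_neg hyx, Nat.sub_eq_zero_of_le this, Nat.cast_zero]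
    have h2 : tent k R n x = ((n - shiftNorm x : ℕ) : ℝ) := by rw [tent, if_pos hx]
    have h3 : ((n - shiftNorm x : ℕ) : ℝ) ≤ ((n - shiftNorm (y * x) : ℕ) : ℝ) + shiftNorm y := by
      have : n - shiftNorm x ≤ n - shiftNorm (y * x) + shiftNorm y := by omega
      exact_mod_cast this
    linarith
  · have h1 : tent k R n x = 0 := by rw [tent, if_neg hx]
    have := tent_nonneg R n (y * x)
    have : (0 : ℝ) ≤ shiftNorm y := by positivity
    linarith

theorem abs_tent_sub_le {R R' n : ℕ} (hR : R' + n ≤ R) {y : houghtonGroup k}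
    (hy : TranslatesBeyond R' y (shift y)) (hy' : TranslatesBeyond R' y⁻¹ (shift y⁻¹))
    (x : houghtonGroup k) : |tent k R n (y * x) - tent k R n x| ≤ shiftNorm y := by
  have h1 := tent_sub_le hR hy x
  have h2 := tent_sub_le hR hy' (y * x)
  rw [inv_mul_cancel_left, shiftNorm_inv] at h2
  rw [abs_le]
  constructor <;> linarith

theorem energy_le_of_abs_sub_le {G : Type*} [Group G] {f : G → ℝ} {Ω : Finset G}
    (hf : Function.support f ⊆ Ω) {y : G} {b : ℝ} (hb : ∀ x, |f (y * x) - f x| ≤ b) :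
    energy f y ≤ 2 * Ω.card * b ^ 2 := by
  classical
  set T := Ω ∪ Ω.image fun x => y⁻¹ * x with hT
  have h0 : ∀ x ∉ T, (f (y * x) - f x) ^ 2 = 0 := by
    intro x hx
    rw [hT, Finset.mem_union, not_or] at hx
    have h1 : f x = 0 := by
      by_contra h
      exact hx.1 (hf h)
    have h2 : f (y * x) = 0 := by
      by_contra h
      exact hx.2 (Finset.mem_image.mpr ⟨y * x, hf h, by simp⟩)
    simp [h1, h2]
  have hcard : (T.card : ℝ) ≤ 2 * Ω.card := by
    have h1 := Finset.card_union_le Ω (Ω.image fun x => y⁻¹ * x)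
    have h2 : (Ω.image fun x => y⁻¹ * x).card ≤ Ω.card := Finset.card_image_le
    have : T.card ≤ 2 * Ω.card := by
      rw [hT]
      omega
    exact_mod_cast this
  unfold energy
  rw [tsum_eq_sum h0]
  calc _ ≤ ∑ _x ∈ T, b ^ 2 := Finset.sum_le_sum fun x _ => by
        rw [← sq_abs]
        have := hb x
        gcongr
    _ = T.card * b ^ 2 := by rw [Finset.sum_const, nsmul_eq_mul]
    _ ≤ _ := by gcongr

/-- A positive proportion of `translationSet k R n` consists of translations of length at most
`n / 2`: up to finitely many left multiplications by elements translating by multiples of `r`,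
the translation vector of an element has all its coordinates but one in `[0, r)`; the remaining
one is then small too because the coordinates add up to zero. -/
theorem card_translationSet_le_mul_card_half (z : Fin k) {r n R : ℕ} (hr : 0 < r)
    (hn : n = 2 * k * r) (hR : R = (k + 2) * n) :
    (translationSet k R n).card ≤ (4 * k + 1) ^ k *
      ((translationSet k R n).filter fun x => 2 * shiftNorm x ≤ n).card := by
  classical
  have hk : 0 < k := z.pos
  have hr' : (0 : ℤ) < r := by exact_mod_cast hr
  have hy : ∀ q : Fin k → ℤ, ∃ y : houghtonGroup k, (∀ j, (q j).natAbs ≤ 2 * k) →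
      TranslatesBeyond ((k + 1) * n) y (shift y) ∧ ∀ j, j ≠ z → shift y j = -(q j * r) := by
    intro q
    by_cases hq : ∀ j, (q j).natAbs ≤ 2 * k
    · obtain ⟨y, hy⟩ := exists_shift_eq z (fun j => -(q j * r)) n fun j => by
        rw [Int.natAbs_neg, Int.natAbs_mul, Int.natAbs_natCast, hn]
        exact Nat.mul_le_mul_right _ (hq j)
      exact ⟨y, fun _ => hy⟩
    · exact ⟨1, fun h => absurd h hq⟩
  choose y hy using hy
  set Q : Finset (Fin k → ℤ) := Fintype.piFinset fun _ => Finset.Icc (-(2 * k : ℤ)) (2 * k) with hQ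
  set q : houghtonGroup k → Fin k → ℤ := fun x j => shift x j / r with hq
  have hqb : ∀ x ∈ translationSet k R n, ∀ j, -(2 * k : ℤ) ≤ q x j ∧ q x j ≤ 2 * k := by
    intro x hx j
    have h1 := natAbs_shift_le x j
    have h2 := (mem_translationSet.mp hx).2
    have h3 : -(2 * k * r : ℤ) ≤ shift x j := by
      have : (n : ℤ) = 2 * k * r := by rw [hn]; push_cast; ring
      omega
    have h4 : shift x j ≤ 2 * k * r := by
      have : (n : ℤ) = 2 * k * r := by rw [hn]; push_cast; ring
      omega
    constructor
    · rw [hq, Int.le_ediv_iff_mul_le hr']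
      linarith
    · have := Int.ediv_le_ediv hr' h4
      rwa [Int.mul_ediv_cancel _ hr'.ne'] at this
  have hcQ : Q.card = (4 * k + 1) ^ k := by
    rw [hQ, Fintype.card_piFinset]
    simp only [Int.card_Icc, Finset.prod_const, Finset.card_univ, Fintype.card_fin]
    congr 1
    omega
  rw [← hcQ, ← Finset.card_product]
  refine Finset.card_le_card_of_injOn (fun x => (q x, y (q x) * x)) ?_ ?_
  · intro x hx
    have hx' : x ∈ translationSet k R n := by exact_mod_cast hx
    have hb := hqb x hx'
    obtain ⟨h1, h2⟩ := hy (q x) fun j => by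
      have := hb j
      omega
    have hmem := mem_translationSet.mp hx'
    have hT : TranslatesBeyond R (y (q x) * x) (shift (y (q x) * x)) := by
      rw [shift_mul]
      refine h1.mul hmem.1 fun i => ?_
      have h3 := natAbs_shift_le x i
      have h4 : R = (k + 1) * n + n := by rw [hR]; ring
      omega
    have hother : ∀ j, j ≠ z → 0 ≤ shift (y (q x) * x) j ∧ shift (y (q x) * x) j ≤ r := by
      intro j hj
      rw [shift_mul, Pi.add_apply, h2 j hj]
      have e : -(q x j * r) + shift x j = shift x j % r := by
        have := Int.mul_ediv_add_emod (shift x j) r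
        rw [hq]
        linarith
      rw [e]
      exact ⟨Int.emod_nonneg _ hr'.ne', (Int.emod_lt_of_pos _ hr').le⟩
    have hN : shiftNorm (y (q x) * x) ≤ k * r := by
      rw [shiftNorm_le_iff]
      intro j
      by_cases hj : j = z
      · have hs := sum_shift (y (q x) * x)
        rw [← Finset.add_sum_erase _ _ (Finset.mem_univ z)] at hs
        have h5 : 0 ≤ ∑ i ∈ Finset.univ.erase z, shift (y (q x) * x) i :=
          Finset.sum_nonneg fun i hi => (hother i (Finset.ne_of_mem_erase hi)).1
        have h6 : ∑ i ∈ Finset.univ.erase z, shift (y (q x) * x) i ≤ k * r := by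
          refine (Finset.sum_le_card_nsmul _ _ (r : ℤ)
            fun i hi => (hother i (Finset.ne_of_mem_erase hi)).2).trans ?_
          rw [nsmul_eq_mul]
          have : (Finset.univ.erase z).card ≤ k := by
            refine (Finset.card_le_univ _).trans ?_
            simp
          gcongr
        rw [hj]
        zify
        rw [abs_le]
        constructor <;> linarith
      · have h5 := hother j hj
        have h6 : r ≤ k * r := Nat.le_mul_of_pos_left r hk
        omega
    have hkr : 0 < k * r := Nat.mul_pos hk hr
    have hn' : n = 2 * (k * r) := by rw [hn]; ring
    rw [Finset.coe_product, Set.mem_prod]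
    refine ⟨?_, ?_⟩
    · rw [Finset.mem_coe, hQ, Fintype.mem_piFinset]
      exact fun j => Finset.mem_Icc.mpr (hb j)
    · rw [Finset.mem_coe, Finset.mem_filter, mem_translationSet]
      exact ⟨⟨hT, by simp only; omega⟩, by simp only; omega⟩
  · intro x _ x' _ h
    simp only [Prod.mk.injEq] at h
    rw [h.1] at h
    exact mul_left_cancel h.2

theorem card_le_mul_sum_sq_tent (z : Fin k) {r n R : ℕ} (hr : 0 < r)
    (hn : n = 2 * k * r) (hR : R = (k + 2) * n) :
    (n : ℝ) ^ 2 * (translationSet k R n).card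
      ≤ 4 * (4 * k + 1) ^ k * ∑ x ∈ translationSet k R n, tent k R n x ^ 2 := by
  have h1 := card_translationSet_le_mul_card_half z hr hn hR
  set H := (translationSet k R n).filter fun x => 2 * shiftNorm x ≤ n with hH
  have h1' : ((translationSet k R n).card : ℝ) ≤ (4 * k + 1) ^ k * H.card := by exact_mod_cast h1
  have h2 : (H.card : ℝ) * ((n : ℝ) / 2) ^ 2 ≤ ∑ x ∈ translationSet k R n, tent k R n x ^ 2 := by
    calc _ = ∑ _x ∈ H, ((n : ℝ) / 2) ^ 2 := by rw [Finset.sum_const, nsmul_eq_mul]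
      _ ≤ ∑ x ∈ H, tent k R n x ^ 2 := Finset.sum_le_sum fun x hx => by
          rw [hH, Finset.mem_filter] at hx
          rw [tent, if_pos hx.1, Nat.cast_sub (by omega)]
          have : (2 : ℝ) * shiftNorm x ≤ n := by exact_mod_cast hx.2
          gcongr
          linarith
      _ ≤ _ := Finset.sum_le_sum_of_subset_of_nonneg (Finset.filter_subset _ _)
          fun _ _ _ => sq_nonneg _
  calc (n : ℝ) ^ 2 * (translationSet k R n).card
      ≤ (n : ℝ) ^ 2 * ((4 * k + 1) ^ k * H.card) := by gcongr
    _ = 4 * (4 * k + 1) ^ k * (H.card * ((n : ℝ) / 2) ^ 2) := by ring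
    _ ≤ _ := by gcongr

end TestFunction

/-! ### Truncated second moments of the measures `ξ_α` -/

section Moments

theorem rpow_neg_sub_one_le {α x : ℝ} (hα : 0 < α) (hx : 0 < x) :
    (1 + x) ^ (-α - 1) ≤ α⁻¹ * (x ^ (-α) - (1 + x) ^ (-α)) := by
  have h1x : 0 < 1 + x := by linarith
  -- `((1 + x) / x)^α = exp (α log ((1 + x) / x)) ≥ 1 + α / (1 + x)`
  have h1 : 1 + α * (1 + x)⁻¹ ≤ ((1 + x) / x) ^ α := by
    have hl : (1 + x)⁻¹ ≤ Real.log ((1 + x) / x) := by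
      have := Real.one_sub_inv_le_log_of_pos (div_pos h1x hx)
      have e : 1 - ((1 + x) / x)⁻¹ = (1 + x)⁻¹ := by
        field_simp
        ring
      linarith
    rw [Real.rpow_def_of_pos (div_pos h1x hx)]
    have h2 := Real.add_one_le_exp (Real.log ((1 + x) / x) * α)
    have h3 : α * (1 + x)⁻¹ ≤ α * Real.log ((1 + x) / x) := by gcongr
    linarith
  have h2 : x ^ (-α) = (1 + x) ^ (-α) * ((1 + x) / x) ^ α := by
    rw [Real.div_rpow h1x.le hx.le, Real.rpow_neg hx.le, Real.rpow_neg h1x.le]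
    field_simp
  have h3 : (1 + x) ^ (-α - 1) = (1 + x) ^ (-α) * (1 + x)⁻¹ := by
    rw [Real.rpow_sub_one h1x.ne', div_eq_mul_inv]
  have h4 : 0 < (1 + x) ^ (-α) := by positivity
  rw [h2, h3, ← mul_sub_one, inv_mul_eq_div, le_div_iff₀ hα]
  nlinarith

theorem sum_Ico_rpow_le {α : ℝ} (hα : 0 < α) {r : ℕ} (hr : 0 < r) (m : ℕ) :
    ∑ n ∈ Finset.Ico r m, (1 + (n : ℝ)) ^ (-α - 1) ≤ α⁻¹ * (r : ℝ) ^ (-α) := by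
  have key : ∀ m, r ≤ m → ∑ n ∈ Finset.Ico r m, (1 + (n : ℝ)) ^ (-α - 1)
      ≤ α⁻¹ * ((r : ℝ) ^ (-α) - (m : ℝ) ^ (-α)) := by
    intro m hm
    induction m, hm using Nat.le_induction with
    | base => simp
    | succ m hm ih =>
      rw [Finset.sum_Ico_succ_top hm]
      have hm0 : (0 : ℝ) < m := by exact_mod_cast hr.trans_le hm
      have := rpow_neg_sub_one_le hα hm0
      push_cast
      rw [add_comm (m : ℝ) 1]
      linarith
  rcases le_total r m with h | h
  · refine (key m h).trans ?_
    have : 0 ≤ (m : ℝ) ^ (-α) := by positivity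
    gcongr
    linarith
  · rw [Finset.Ico_eq_empty_of_le h, Finset.sum_empty]
    positivity

theorem one_add_rpow_sub_one_le {β x : ℝ} (hβ : 0 < β) (hx : 0 ≤ x) :
    (1 + x) ^ (β - 1) ≤ (min 1 β)⁻¹ * ((1 + x) ^ β - x ^ β) := by
  have h1x : 0 < 1 + x := by linarith
  set γ := min 1 β with hγ
  have hγ0 : 0 < γ := lt_min one_pos hβ
  have hs1 : (1 + x)⁻¹ ≤ 1 := inv_le_one_of_one_le₀ (by linarith)
  have h1 : (1 + -(1 + x)⁻¹) ^ β ≤ 1 - γ * (1 + x)⁻¹ := by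
    have h2 := rpow_one_add_le_one_add_mul_self (s := -(1 + x)⁻¹) (by linarith) hγ0.le
      (min_le_left _ _)
    have h3 : (1 + -(1 + x)⁻¹) ^ β ≤ (1 + -(1 + x)⁻¹) ^ γ := by
      refine Real.rpow_le_rpow_of_exponent_ge' (by linarith) ?_ hγ0.le (min_le_right _ _)
      have : 0 < (1 + x)⁻¹ := by positivity
      linarith
    linarith
  have h2 : x ^ β = (1 + x) ^ β * (1 + -(1 + x)⁻¹) ^ β := by
    rw [← Real.mul_rpow h1x.le (by linarith)]
    congr 1
    field_simp
    ring
  have h3 : (1 + x) ^ (β - 1) = (1 + x) ^ β * (1 + x)⁻¹ := by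
    rw [Real.rpow_sub_one h1x.ne', div_eq_mul_inv]
  have h4 : 0 < (1 + x) ^ β := by positivity
  rw [h2, h3, inv_mul_eq_div, le_div_iff₀ hγ0]
  nlinarith

theorem exists_sum_range_rpow_le {α : ℝ} (hα : 0 < α) : ∃ C : ℝ, 0 < C ∧ ∀ r : ℕ, 1 ≤ r →
    (∑ n ∈ Finset.range r, (1 + (n : ℝ)) ^ (1 - α)) * ((r : ℝ) ^ 2)⁻¹
      ≤ C * stepRate (.power α hα) r := by
  simp only [stepRate]
  split_ifs with h1 h2
  · have hβ : 0 < 2 - α := by linarith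
    have hγ : 0 < min 1 (2 - α) := lt_min one_pos hβ
    refine ⟨(min 1 (2 - α))⁻¹, by positivity, fun r hr => ?_⟩
    have hr0 : (0 : ℝ) < r := by exact_mod_cast hr
    have key : ∀ r : ℕ, ∑ n ∈ Finset.range r, (1 + (n : ℝ)) ^ (1 - α)
        ≤ (min 1 (2 - α))⁻¹ * (r : ℝ) ^ (2 - α) := by
      intro r
      induction r with
      | zero => simp [hβ.ne']
      | succ r ih =>
        rw [Finset.sum_range_succ]
        have h3 := one_add_rpow_sub_one_le hβ (Nat.cast_nonneg r : (0 : ℝ) ≤ r)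
        have e : 2 - α - 1 = 1 - α := by ring
        rw [e] at h3
        push_cast
        rw [add_comm (r : ℝ) 1]
        linarith
    have e : (r : ℝ) ^ (-α) = (r : ℝ) ^ (2 - α) * ((r : ℝ) ^ 2)⁻¹ := by
      rw [← Real.rpow_natCast, ← Real.rpow_neg hr0.le, ← Real.rpow_add hr0]
      congr 1
      push_cast
      ring
    rw [e, ← mul_assoc]
    gcongr
    exact key r
  · refine ⟨1, one_pos, fun r hr => ?_⟩
    rw [one_mul]
    gcongr
    have h3 := harmonic_le_one_add_log r
    unfold harmonic at h3
    push_cast at h3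
    refine le_trans (le_of_eq ?_) h3
    refine Finset.sum_congr rfl fun n _ => ?_
    have : (1 : ℝ) - α = -1 := by rw [h2]; norm_num
    rw [this, Real.rpow_neg_one, add_comm]
  · have h3 : 2 < α := lt_of_le_of_ne (not_lt.mp h1) (Ne.symm h2)
    have hs : Summable fun n : ℕ => (1 + (n : ℝ)) ^ (1 - α) := by
      have := (summable_nat_add_iff 1).mpr (Real.summable_nat_rpow.mpr (by linarith : 1 - α < -1))
      refine this.congr fun n => ?_
      push_cast
      rw [add_comm]
    refine ⟨∑' n : ℕ, (1 + (n : ℝ)) ^ (1 - α), hs.tsum_pos (fun n => by positivity) 0 (by simp),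
      fun r _ => ?_⟩
    gcongr
    exact hs.sum_le_tsum _ fun n _ => by positivity

theorem summable_stepMeasure_mul_min (a : StepIndex) (r : ℝ) :
    Summable fun l : ℤ => stepMeasure a l * min 1 ((|(l : ℝ)| / r) ^ 2) :=
  (summable_stepMeasure a).of_nonneg_of_le
    (fun l => mul_nonneg (stepMeasure_nonneg a l) (le_min zero_le_one (sq_nonneg _)))
    fun l => mul_le_of_le_one_right (stepMeasure_nonneg a l) (min_le_left _ _)

/-- The truncated second moment of `ξ_α` at the scale `r`, divided by `r²`, is of the order of the
rate `r_α(r)`. -/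
theorem exists_tsum_stepMeasure_mul_min_le (a : StepIndex) :
    ∃ C : ℝ, 0 < C ∧ ∀ r : ℕ, 1 ≤ r →
      ∑' l : ℤ, stepMeasure a l * min 1 ((|(l : ℝ)| / r) ^ 2) ≤ C * stepRate a r := by
  rcases a with ⟨α, hα⟩ | _ | _
  · obtain ⟨C, hC, h⟩ := exists_sum_range_rpow_le hα
    set Z := ∑' l : ℤ, (1 + |(l : ℝ)|) ^ (-α - 1) with hZ
    have hZpos : 0 < Z := (summable_one_add_abs_rpow hα).tsum_pos (fun l => by positivity) 0
      (by simp)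
    refine ⟨2 * (Z⁻¹ * (C + α⁻¹)), by positivity, fun r hr => ?_⟩
    have hr1 : (1 : ℝ) ≤ r := by exact_mod_cast hr
    have hr0 : (0 : ℝ) < r := by linarith
    set g : ℤ → ℝ := fun l => stepMeasure (.power α hα) l * min 1 ((|(l : ℝ)| / r) ^ 2) with hg
    have hg0 : ∀ l, 0 ≤ g l := fun l =>
      mul_nonneg (stepMeasure_nonneg _ l) (le_min zero_le_one (sq_nonneg _))
    have hgn : ∀ n : ℕ, g n
        = Z⁻¹ * ((1 + (n : ℝ)) ^ (-α - 1) * min 1 (((n : ℝ) / r) ^ 2)) := fun n => by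
      simp only [hg, stepMeasure, ← hZ]
      rw [mul_assoc]
      simp
    have hsum : Summable fun n : ℕ => g n :=
      (summable_stepMeasure_mul_min (.power α hα) r).comp_injective Nat.cast_injective
    have hpow : (r : ℝ) ^ (-α) ≤ stepRate (.power α hα) r := by
      simp only [stepRate]
      split_ifs with h1 h2
      · exact le_rfl
      · rw [h2, Real.rpow_neg hr0.le, Real.rpow_two]
        have := Real.log_nonneg hr1
        exact le_mul_of_one_le_left (by positivity) (by linarith)
      · rw [← Real.rpow_two, ← Real.rpow_neg hr0.le]
        exact Real.rpow_le_rpow_of_exponent_le hr1 (by linarith [not_lt.mp h1])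
    have hhalf : ∑' n : ℕ, g n ≤ Z⁻¹ * (C + α⁻¹) * stepRate (.power α hα) r := by
      refine Real.tsum_le_of_sum_range_le (fun n => hg0 n) fun m => ?_
      rw [Finset.sum_congr rfl fun n _ => hgn n, ← Finset.mul_sum, mul_assoc]
      refine mul_le_mul_of_nonneg_left ?_ (by positivity)
      have hsub : Finset.range m ⊆ Finset.range r ∪ Finset.Ico r m := by
        intro n hn
        simp only [Finset.mem_union, Finset.mem_range, Finset.mem_Ico] at hn ⊢
        omega
      have hnn : ∀ n : ℕ, 0 ≤ (1 + (n : ℝ)) ^ (-α - 1) * min 1 (((n : ℝ) / r) ^ 2) := fun n =>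
        mul_nonneg (by positivity) (le_min zero_le_one (sq_nonneg _))
      refine (Finset.sum_le_sum_of_subset_of_nonneg hsub fun n _ _ => hnn n).trans ?_
      rw [Finset.sum_union (Finset.disjoint_left.mpr fun n hn hn' => by
        simp only [Finset.mem_range, Finset.mem_Ico] at hn hn'
        omega), add_mul]
      refine add_le_add (le_trans ?_ (h r hr)) (le_trans ?_ ((sum_Ico_rpow_le hα hr m).trans ?_))
      · rw [Finset.sum_mul]
        refine Finset.sum_le_sum fun n _ => ?_
        have hn1 : (0 : ℝ) < 1 + n := by positivity
        have e : (1 + (n : ℝ)) ^ (1 - α) = (1 + (n : ℝ)) ^ (-α - 1) * (1 + (n : ℝ)) ^ 2 := by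
          rw [← Real.rpow_natCast, ← Real.rpow_add hn1]
          congr 1
          push_cast
          ring
        rw [e, mul_assoc]
        refine mul_le_mul_of_nonneg_left ((min_le_right _ _).trans ?_) (by positivity)
        rw [div_pow, div_eq_mul_inv]
        gcongr
        linarith
      · exact Finset.sum_le_sum fun n _ =>
          mul_le_of_le_one_right (by positivity) (min_le_left _ _)
      · gcongr
    have heven : ∀ n : ℕ, g (-(n : ℤ)) = g n := fun n => by simp [hg, stepMeasure]
    have hall := HasSum.of_nat_of_neg (f := g) hsum.hasSum
      (by simpa only [heven] using hsum.hasSum)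
    rw [hall.tsum_eq]
    have := hg0 0
    linarith
  · refine ⟨1, one_pos, fun r hr => ?_⟩
    have hr0 : (0 : ℝ) < r := by exact_mod_cast hr
    rw [tsum_eq_sum (s := {-1, 0, 1}) fun m hm => by
      simp only [Finset.mem_insert, Finset.mem_singleton] at hm
      simp [stepMeasure, hm]]
    have h1 : min 1 ((r : ℝ) ^ 2)⁻¹ ≤ ((r : ℝ) ^ 2)⁻¹ := min_le_right _ _
    have h2 : 0 < ((r : ℝ) ^ 2)⁻¹ := by positivity
    simp [stepMeasure, stepRate]
    linarith
  · refine ⟨1, one_pos, fun r hr => ?_⟩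
    rw [tsum_eq_single 0 fun m hm => by simp [stepMeasure, hm]]
    simp [stepRate]

end Moments

/-! ### Upper bounds for the spectral profiles -/

section UpperBounds

/-- The choice of the scale in the upper bound: `m ^ m` elements fit in the volume `v` for an `m` of
the order of `logRatio v`. -/
theorem pow_self_le_of_le_logRatio {v : ℝ} (hv : 1 ≤ v) {m : ℕ} (hm : 1 ≤ m)
    (h : 8 * (m : ℝ) ≤ logRatio v) : (m : ℝ) ^ m ≤ v := by
  have hm0 : (1 : ℝ) ≤ m := by exact_mod_cast hm
  unfold logRatio at h
  set x := Real.log (1 + v) with hx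
  have hx0 : 0 < x := Real.log_pos (by linarith)
  set l := Real.log (1 + x) with hl
  have hl0 : 0 < l := Real.log_pos (by linarith)
  have htl : x / l * l = x := div_mul_cancel₀ _ hl0.ne'
  set t := x / l with ht
  have htx : t ≤ 1 + x := by
    have h1 := Real.one_sub_inv_le_log_of_pos (by linarith : 0 < 1 + x)
    rw [ht, div_le_iff₀ hl0]
    have h2 : (1 + x) * (1 - (1 + x)⁻¹) ≤ (1 + x) * l := by gcongr
    have h3 : (1 + x) * (1 - (1 + x)⁻¹) = x := by
      field_simp
      ring
    linarith
  have hlogm : Real.log m ≤ l := Real.log_le_log (by linarith) (by linarith)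
  have hlm0 := Real.log_nonneg hm0
  have h1 : m * Real.log m ≤ x / 2 := by nlinarith
  have hv2 : 1 + v ≤ v ^ 2 := by
    have h2 := Real.add_one_le_exp x
    rw [hx, Real.exp_log (by linarith), ← hx] at h2
    nlinarith
  have h3 : x / 2 ≤ Real.log v := by
    have := Real.log_le_log (by linarith) hv2
    rw [Real.log_pow, ← hx] at this
    push_cast at this
    linarith
  have h4 : (m : ℝ) ^ m = Real.exp (m * Real.log m) := by
    rw [mul_comm, Real.exp_mul, Real.exp_log (by linarith), Real.rpow_natCast]
  rw [h4, ← Real.exp_log (by linarith : 0 < v)]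
  exact Real.exp_le_exp.mpr (by linarith)

variable {k : ℕ}

/-- The test function at the scale `r`. -/
def scaledTent (k r : ℕ) : houghtonGroup k → ℝ := tent k ((k + 2) * (2 * k * r)) (2 * k * r)

/-- The set supporting the test function at the scale `r`. -/
def scaledSet (k r : ℕ) : Finset (houghtonGroup k) :=
  translationSet k ((k + 2) * (2 * k * r)) (2 * k * r)

theorem support_scaledTent_subset (r : ℕ) :
    Function.support (scaledTent k r) ⊆ (scaledSet k r : Set (houghtonGroup k)) :=
  support_tent_subset _ _

theorem card_scaledSet_le {r : ℕ} (hr : 1 ≤ r) :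
    (scaledSet k r).card ≤ ((2 * k ^ 2 * (k + 3) + 4 * k + 1) * r) ^
      ((2 * k ^ 2 * (k + 3) + 4 * k + 1) * r) := by
  refine (card_translationSet_le k _ _).trans ?_
  set A := 2 * k ^ 2 * (k + 3) + 4 * k + 1 with hA
  have h1 : 2 * (2 * k * r) + 1 ≤ A * r := by
    rw [hA]
    nlinarith [Nat.zero_le (2 * k ^ 2 * (k + 3) * r)]
  have h2 : k * ((k + 2) * (2 * k * r) + 2 * k * r) + 1 ≤ A * r := by
    rw [hA]
    nlinarith [Nat.zero_le (k * r)]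
  have h3 : k + (k * ((k + 2) * (2 * k * r)) + 1) ≤ A * r := by
    have : k ≤ k * r := Nat.le_mul_of_pos_right k hr
    rw [hA]
    nlinarith [Nat.zero_le (k ^ 2 * r)]
  calc _ ≤ (A * r) ^ k * (A * r) ^ (k * ((k + 2) * (2 * k * r)) + 1) := by gcongr
    _ = (A * r) ^ (k + (k * ((k + 2) * (2 * k * r)) + 1)) := by rw [← pow_add]
    _ ≤ _ := Nat.pow_le_pow_right (by
        have : 0 < A := by omega
        exact Nat.mul_pos this hr) h3

theorem sum_sq_scaledTent_pos (z : Fin k) {r : ℕ} (hr : 1 ≤ r) :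
    0 < ∑ x ∈ scaledSet k r, scaledTent k r x ^ 2 := by
  have h := card_le_mul_sum_sq_tent z hr (n := 2 * k * r) rfl rfl
  have hn : 0 < 2 * k * r := Nat.mul_pos (Nat.mul_pos two_pos z.pos) hr
  have hn' : (0 : ℝ) < ((2 * k * r : ℕ) : ℝ) := by exact_mod_cast hn
  have h1 : TranslatesBeyond 0 (1 : houghtonGroup k) 0 := fun i p _ =>
    ⟨p, by simp, one_smul _ _⟩
  have hmem : 1 ∈ scaledSet k r := mem_translationSet.mpr ⟨h1.eq_shift.mono (Nat.zero_le _),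
    lt_of_le_of_lt (shiftNorm_le_iff.mpr fun i => by simp [h1.shift_eq]) hn⟩
  have hc : (0 : ℝ) < (scaledSet k r).card := by
    exact_mod_cast Finset.card_pos.mpr ⟨_, hmem⟩
  have h2 : 0 < 4 * (4 * (k : ℝ) + 1) ^ k * ∑ x ∈ scaledSet k r, scaledTent k r x ^ 2 :=
    lt_of_lt_of_le (by positivity) h
  exact pos_of_mul_pos_right h2 (by positivity)

/-- The energies of the test functions along elements which are translations not too far from the
centre. -/
theorem energy_scaledTent_le (z : Fin k) {r R : ℕ} (hr : 1 ≤ r) {y : houghtonGroup k}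
    (hy : TranslatesBeyond R y (shift y)) (hy' : TranslatesBeyond R y⁻¹ (shift y⁻¹))
    (hR : R ≤ 2 * k * r) :
    energy (scaledTent k r) y ≤ 8 * (4 * k + 1) ^ k * ((shiftNorm y : ℝ) / r) ^ 2 *
      ∑ x ∈ scaledSet k r, scaledTent k r x ^ 2 := by
  have hle : R + 2 * k * r ≤ (k + 2) * (2 * k * r) := by nlinarith [Nat.zero_le (k * (2 * k * r))]
  have h1 := energy_le_of_abs_sub_le (support_scaledTent_subset r) (y := y)
    fun x => abs_tent_sub_le hle hy hy' x
  have h2 := card_le_mul_sum_sq_tent z hr (n := 2 * k * r) rfl rfl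
  have hr0 : (0 : ℝ) < r := by exact_mod_cast hr
  have hrn : (r : ℝ) ≤ ((2 * k * r : ℕ) : ℝ) := by
    have : r ≤ 2 * k * r := Nat.le_mul_of_pos_left r (Nat.mul_pos two_pos z.pos)
    exact_mod_cast this
  set S := ∑ x ∈ scaledSet k r, scaledTent k r x ^ 2
  have h3 : (r : ℝ) ^ 2 * (scaledSet k r).card ≤ 4 * (4 * k + 1) ^ k * S := by
    refine le_trans ?_ h2
    gcongr
    exact le_rfl
  calc energy (scaledTent k r) y ≤ 2 * (scaledSet k r).card * (shiftNorm y : ℝ) ^ 2 := h1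
    _ = 2 * ((shiftNorm y : ℝ) / r) ^ 2 * ((r : ℝ) ^ 2 * (scaledSet k r).card) := by field_simp
    _ ≤ 2 * ((shiftNorm y : ℝ) / r) ^ 2 * (4 * (4 * k + 1) ^ k * S) := by gcongr
    _ = _ := by ring

theorem energy_scaledTent_houghtonGen_zpow_le (e : RayPair k) {r : ℕ} (hr : 1 ≤ r) (l : ℤ) :
    energy (scaledTent k r) (houghtonGen e ^ l) ≤ 8 * (4 * k + 1) ^ k *
      min 1 ((|(l : ℝ)| / r) ^ 2) * ∑ x ∈ scaledSet k r, scaledTent k r x ^ 2 := by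
  have hr0 : (0 : ℝ) < r := by exact_mod_cast hr
  have hS := sum_sq_scaledTent_pos e.1.1 hr
  set S := ∑ x ∈ scaledSet k r, scaledTent k r x ^ 2
  have hbig : energy (scaledTent k r) (houghtonGen e ^ l) ≤ 8 * (4 * k + 1) ^ k * S := by
    refine (energy_le_four (support_scaledTent_subset r) _).trans ?_
    have : (1 : ℝ) ≤ (4 * k + 1) ^ k := one_le_pow₀ (by
      have : (0 : ℝ) ≤ k := by positivity
      linarith)
    change 4 * S ≤ _
    nlinarith
  rcases le_total 1 ((|(l : ℝ)| / r) ^ 2) with h | h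
  · rw [min_eq_left h, mul_one]
    exact hbig
  · rw [min_eq_right h]
    have hlr : l.natAbs ≤ r := by
      have h1 := (sq_le_one_iff₀ (by positivity)).mp h
      rw [div_le_one hr0, ← Int.cast_abs, Int.abs_eq_natAbs] at h1
      exact_mod_cast h1
    have hlr' : l.natAbs ≤ 2 * k * r :=
      hlr.trans (Nat.le_mul_of_pos_left r (Nat.mul_pos two_pos e.1.1.pos))
    have hy := (translatesBeyond_lineTrans_zpow e.2.ne l hlr').eq_shift
    have hy' := (translatesBeyond_lineTrans_zpow e.2.ne (-l) (R := 2 * k * r)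
      (by rwa [Int.natAbs_neg])).eq_shift
    rw [zpow_neg] at hy'
    refine (energy_scaledTent_le e.1.1 hr hy hy' le_rfl).trans ?_
    have hN : (shiftNorm (houghtonGen e ^ l) : ℝ) ≤ |(l : ℝ)| := by
      rw [← Int.cast_abs, Int.abs_eq_natAbs]
      exact_mod_cast shiftNorm_lineTrans_zpow_le e.2.ne l
    gcongr
    exact hN

theorem exists_energy_scaledTent_le (z : Fin k) (y : houghtonGroup k) :
    ∃ C : ℝ, 0 ≤ C ∧ ∀ r : ℕ, 1 ≤ r → energy (scaledTent k r) y
      ≤ C * ((r : ℝ) ^ 2)⁻¹ * ∑ x ∈ scaledSet k r, scaledTent k r x ^ 2 := by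
  obtain ⟨R₁, h₁⟩ := exists_translatesBeyond_shift y
  obtain ⟨R₂, h₂⟩ := exists_translatesBeyond_shift y⁻¹
  set R := R₁ + R₂ with hR
  refine ⟨8 * (4 * k + 1) ^ k * (shiftNorm y : ℝ) ^ 2 + 4 * (R : ℝ) ^ 2, by positivity,
    fun r hr => ?_⟩
  have hr0 : (0 : ℝ) < r := by exact_mod_cast hr
  have hS := sum_sq_scaledTent_pos z hr
  set S := ∑ x ∈ scaledSet k r, scaledTent k r x ^ 2
  by_cases hle : R ≤ 2 * k * r
  · refine (energy_scaledTent_le z hr (h₁.mono (by omega)) (h₂.mono (by omega)) hle).trans ?_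
    rw [div_pow, div_eq_mul_inv, ← mul_assoc]
    gcongr
    exact le_add_of_nonneg_right (by positivity)
  · have hrR : (r : ℝ) ≤ R := by
      have : r ≤ 2 * k * r := Nat.le_mul_of_pos_left r (Nat.mul_pos two_pos z.pos)
      exact_mod_cast this.trans (not_le.mp hle).le
    refine (energy_le_four (support_scaledTent_subset r) _).trans ?_
    have h1 : 1 ≤ (R : ℝ) ^ 2 * ((r : ℝ) ^ 2)⁻¹ := by
      rw [← div_eq_mul_inv, one_le_div (by positivity)]
      gcongr
    have h2 : 0 ≤ 8 * (4 * (k : ℝ) + 1) ^ k * (shiftNorm y : ℝ) ^ 2 * ((r : ℝ) ^ 2)⁻¹ := by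
      positivity
    change 4 * S ≤ _
    nlinarith

/-- Upper bounds for the spectral profile from the Dirichlet forms of the test functions at all
scales, for a rate `W` which is decreasing and doubling. -/
theorem exists_spectralProfile_le {φ : houghtonGroup k → ℝ} (z : Fin k) {W : ℝ → ℝ}
    (hpos : ∀ t, 1 ≤ t → 0 < W t) (hanti : ∀ s t, 1 ≤ s → s ≤ t → W t ≤ W s)
    (hdoub : ∀ K : ℝ, 1 ≤ K → ∃ C : ℝ, 0 < C ∧ ∀ s t : ℝ, 1 ≤ s → s ≤ t → t ≤ K * s →
      W s ≤ C * W t) {C : ℝ} (hC : 0 < C)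
    (H : ∀ r : ℕ, 1 ≤ r → dirichletForm φ (scaledTent k r)
      ≤ ENNReal.ofReal (C * W r * ∑ x ∈ scaledSet k r, scaledTent k r x ^ 2))
    (H0 : ∀ (f : houghtonGroup k → ℝ) (Ω : Finset (houghtonGroup k)), Function.support f ⊆ Ω →
      dirichletForm φ f ≤ ENNReal.ofReal (C * ∑ x ∈ Ω, f x ^ 2)) :
    ∃ c : ℝ, 0 < c ∧ ∀ v : ℝ, 1 ≤ v → spectralProfile φ v ≤ ENNReal.ofReal (c * W (logRatio v)) := by
  set A := 2 * k ^ 2 * (k + 3) + 4 * k + 1 with hA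
  have hA1 : 1 ≤ A := by omega
  have hA1' : (1 : ℝ) ≤ A := by exact_mod_cast hA1
  obtain ⟨D, hD, hdoub⟩ := hdoub (16 * A) (by linarith)
  have hW0 := hpos (8 * A) (by linarith)
  refine ⟨C * D + C * (W (8 * A))⁻¹, by positivity, fun v hv => ?_⟩
  have ht1 := one_le_logRatio (by linarith : 0 < v)
  have hWt := hpos _ ht1
  by_cases ht : 8 * (A : ℝ) ≤ logRatio v
  · set r := ⌊logRatio v / (8 * A)⌋₊ with hr
    have hq1 : 1 ≤ logRatio v / (8 * A) := (one_le_div (by positivity)).mpr ht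
    have hr1 : 1 ≤ r := Nat.le_floor (by exact_mod_cast hq1)
    have hr1' : (1 : ℝ) ≤ r := by exact_mod_cast hr1
    have hrle : (r : ℝ) ≤ logRatio v / (8 * A) := Nat.floor_le (by linarith)
    have hrlt : logRatio v / (8 * A) < r + 1 := Nat.lt_floor_add_one _
    rw [le_div_iff₀ (by positivity)] at hrle
    rw [div_lt_iff₀ (by positivity)] at hrlt
    have hcard : ((scaledSet k r).card : ℝ) ≤ v := by
      have h1 : ((scaledSet k r).card : ℝ) ≤ ((A * r : ℕ) : ℝ) ^ (A * r) := by
        exact_mod_cast card_scaledSet_le (k := k) hr1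
      refine h1.trans (pow_self_le_of_le_logRatio hv (Nat.mul_pos hA1 hr1) ?_)
      push_cast
      linarith
    refine (spectralProfile_le_of_dirichletForm_le (support_scaledTent_subset r) hcard
      (sum_sq_scaledTent_pos z hr1) (H r hr1)).trans (ENNReal.ofReal_le_ofReal ?_)
    have hWr := hdoub r (logRatio v) hr1' (by nlinarith) (by nlinarith)
    calc C * W r ≤ C * (D * W (logRatio v)) := by gcongr
      _ ≤ _ := by
        rw [add_mul, mul_assoc C D]
        exact le_add_of_nonneg_right (by positivity)
  · -- at small volumes the indicator function of one element suffices
    push Not at ht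
    classical
    have hcard : ((({1} : Finset (houghtonGroup k)).card : ℕ) : ℝ) ≤ v := by simpa using hv
    have hone : ∑ x ∈ ({1} : Finset (houghtonGroup k)),
        (Pi.single (1 : houghtonGroup k) (1 : ℝ) : houghtonGroup k → ℝ) x ^ 2 = 1 := by simp
    have hsupp : Function.support (Pi.single (1 : houghtonGroup k) (1 : ℝ) : houghtonGroup k → ℝ)
        ⊆ (({1} : Finset (houghtonGroup k)) : Set (houghtonGroup k)) := by
      rw [Finset.coe_singleton]
      exact Pi.support_single_subset
    refine (spectralProfile_le_of_dirichletForm_le hsupp hcard (by rw [hone]; exact one_pos)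
      (H0 _ _ hsupp)).trans (ENNReal.ofReal_le_ofReal ?_)
    have h1 := hanti _ _ ht1 ht.le
    calc C = C * (W (8 * A))⁻¹ * W (8 * A) := by field_simp
      _ ≤ C * (W (8 * A))⁻¹ * W (logRatio v) := by gcongr
      _ ≤ _ := by
        rw [add_mul]
        exact le_add_of_nonneg_left (by positivity)

end UpperBounds

/-! ### Conclusion -/

section Conclusion

variable {k : ℕ}

theorem dirichletForm_houghtonMeasure_le (hk : 2 ≤ k) {p : RayPair k → ℤ → ℝ}
    (hp : ∀ e n, 0 ≤ p e n) (hs : ∀ e, Summable (p e)) {f : houghtonGroup k → ℝ}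
    (hf : (Function.support f).Finite) {b : RayPair k → ℤ → ℝ} {B : ℝ} (hB : 0 ≤ B)
    (hb : ∀ e n, 0 ≤ b e n) (hle : ∀ e n, energy f (houghtonGen e ^ n) ≤ B * b e n)
    (hsb : ∀ e, Summable fun n => p e n * b e n) :
    dirichletForm (houghtonMeasure p) f
      ≤ ENNReal.ofReal (B * ∑ e, ∑' n, p e n * b e n) := by
  have hnn : ∀ e n, 0 ≤ p e n * b e n := fun e n => mul_nonneg (hp e n) (hb e n)
  have hch : (1 : ℝ) ≤ (k.choose 2 : ℕ) := by exact_mod_cast Nat.choose_pos hk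
  rw [dirichletForm_houghtonMeasure hp hs hf]
  calc _ ≤ (1 : ℝ≥0∞) * (1 *
        ∑ e : RayPair k, ∑' n : ℤ, ENNReal.ofReal (B * (p e n * b e n))) := by
        refine mul_le_mul' ?_ (mul_le_mul' ?_ (Finset.sum_le_sum fun e _ =>
          ENNReal.tsum_le_tsum fun n => ENNReal.ofReal_le_ofReal ?_))
        · rw [ENNReal.div_le_iff two_ne_zero ENNReal.ofNat_ne_top]
          norm_num
        · exact ENNReal.ofReal_le_one.mpr (inv_le_one_of_one_le₀ hch)
        · calc _ ≤ p e n * (B * b e n) := mul_le_mul_of_nonneg_left (hle e n) (hp e n)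
            _ = _ := by ring
    _ = _ := by
        rw [one_mul, one_mul, Finset.mul_sum, ENNReal.ofReal_sum_of_nonneg fun e _ =>
          mul_nonneg hB (tsum_nonneg (hnn e))]
        refine Finset.sum_congr rfl fun e _ => ?_
        rw [← tsum_mul_left, ENNReal.ofReal_tsum_of_nonneg (fun n => mul_nonneg hB (hnn e n))
          ((hsb e).mul_left B)]

theorem exists_spectralProfile_le_decrInverse (hk : 2 ≤ k) (α : RayPair k → StepIndex)
    {e₀ : RayPair k} (he₀ : α e₀ ≠ StepIndex.trivial) :
    ∃ c : ℝ, 0 < c ∧ ∀ v : ℝ, 1 ≤ v →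
      spectralProfile (houghtonMeasure fun e => stepMeasure (α e)) v
        ≤ ENNReal.ofReal (c * decrInverse (maxRho α) (logRatio v)) := by
  have hp : ∀ e n, 0 ≤ (fun e => stepMeasure (α e)) e n := fun e n => stepMeasure_nonneg _ _
  have hs : ∀ e, Summable ((fun e => stepMeasure (α e)) e) := fun e => summable_stepMeasure _
  choose C hC hmom using fun e => exists_tsum_stepMeasure_mul_min_le (α e)
  set W : ℝ → ℝ := fun t => ∑ e, stepRate (α e) t with hW
  have hsumC : 0 ≤ ∑ e, C e := Finset.sum_nonneg fun e _ => (hC e).le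
  have hsump : 0 ≤ ∑ e, ∑' n, stepMeasure (α e) n :=
    Finset.sum_nonneg fun e _ => tsum_nonneg (hp e)
  have key : ∃ c : ℝ, 0 < c ∧ ∀ v : ℝ, 1 ≤ v →
      spectralProfile (houghtonMeasure fun e => stepMeasure (α e)) v
        ≤ ENNReal.ofReal (c * W (logRatio v)) := by
    refine exists_spectralProfile_le
      (φ := houghtonMeasure fun e => stepMeasure (α e)) e₀.1.1 (W := W)
      (C := 8 * (4 * k + 1) ^ k * ∑ e, C e + 4 * ∑ e, ∑' n, stepMeasure (α e) n + 1)
      (fun t ht => Finset.sum_pos' (fun e _ => stepRate_nonneg _ ht)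
        ⟨e₀, Finset.mem_univ _, stepRate_pos he₀ ht⟩)
      (fun s t hs hst => Finset.sum_le_sum fun e _ => stepRate_anti _ hs hst)
      (fun K hK => by
        choose D hD hdoub using fun e => exists_stepRate_le_mul (α e) hK
        have hle : ∀ e, D e ≤ ∑ e, D e := fun e =>
          Finset.single_le_sum (fun e _ => (hD e).le) (Finset.mem_univ e)
        refine ⟨∑ e, D e, (hD e₀).trans_le (hle e₀), fun s t hs hst ht => ?_⟩
        rw [hW]
        simp only
        rw [Finset.mul_sum]
        refine Finset.sum_le_sum fun e _ => (hdoub e s t hs hst ht).trans ?_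
        exact mul_le_mul_of_nonneg_right (hle e) (stepRate_nonneg _ (hs.trans hst)))
      (by positivity) (fun r hr => ?_) fun f Ω hf => ?_
    · have hr' : (1 : ℝ) ≤ r := by exact_mod_cast hr
      have hS := sum_sq_scaledTent_pos e₀.1.1 hr
      set S := ∑ x ∈ scaledSet k r, scaledTent k r x ^ 2
      refine (dirichletForm_houghtonMeasure_le hk hp hs
        ((scaledSet k r).finite_toSet.subset (support_scaledTent_subset r))
        (b := fun _ l => min 1 ((|(l : ℝ)| / r) ^ 2)) (B := 8 * (4 * k + 1) ^ k * S)
        (by positivity) (fun e l => le_min zero_le_one (sq_nonneg _))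
        (fun e l => (energy_scaledTent_houghtonGen_zpow_le e hr l).trans (le_of_eq (by ring)))
        fun e => summable_stepMeasure_mul_min (α e) r).trans (ENNReal.ofReal_le_ofReal ?_)
      have hrate : ∀ e, 0 ≤ stepRate (α e) r := fun e => stepRate_nonneg _ hr'
      have hWr : 0 ≤ W r := Finset.sum_nonneg fun e _ => hrate e
      have h1 : ∑ e, ∑' l : ℤ, stepMeasure (α e) l * min 1 ((|(l : ℝ)| / r) ^ 2)
          ≤ (∑ e, C e) * W r := by
        rw [Finset.sum_mul]
        refine Finset.sum_le_sum fun e _ => (hmom e r hr).trans ?_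
        refine mul_le_mul_of_nonneg_left ?_ (hC e).le
        exact Finset.single_le_sum (f := fun e => stepRate (α e) r) (fun e _ => hrate e)
          (Finset.mem_univ e)
      calc _ ≤ 8 * (4 * k + 1) ^ k * S * ((∑ e, C e) * W r) :=
            mul_le_mul_of_nonneg_left h1 (by positivity)
        _ = 8 * (4 * k + 1) ^ k * (∑ e, C e) * W r * S := by ring
        _ ≤ _ := by
            gcongr
            linarith
    · have hS : 0 ≤ ∑ x ∈ Ω, f x ^ 2 := Finset.sum_nonneg fun _ _ => sq_nonneg _
      refine (dirichletForm_houghtonMeasure_le hk hp hs (Ω.finite_toSet.subset hf)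
        (b := fun _ _ => 1) (B := 4 * ∑ x ∈ Ω, f x ^ 2) (by positivity)
        (fun _ _ => zero_le_one) (fun e l => by rw [mul_one]; exact energy_le_four hf _)
        fun e => by simpa using hs e).trans (ENNReal.ofReal_le_ofReal ?_)
      simp only [mul_one]
      have : 0 ≤ 8 * (4 * (k : ℝ) + 1) ^ k * ∑ e, C e := by positivity
      nlinarith
  obtain ⟨c, hc, h⟩ := key
  have hN : (0 : ℝ) < Fintype.card (RayPair k) := by
    exact_mod_cast Fintype.card_pos_iff.mpr ⟨e₀⟩
  refine ⟨c * Fintype.card (RayPair k), by positivity, fun v hv =>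
    (h v hv).trans (ENNReal.ofReal_le_ofReal ?_)⟩
  have ht := one_le_logRatio (by linarith : 0 < v)
  rw [mul_assoc]
  refine mul_le_mul_of_nonneg_left ?_ hc.le
  refine (Finset.sum_le_card_nsmul _ _ _ fun e _ =>
    stepRate_le_decrInverse α (e₀ := e₀) ht e).trans ?_
  rw [nsmul_eq_mul, Finset.card_univ]

theorem dirichletForm_le_of_finite_support {G : Type*} [Group G] {φ : G → ℝ} (hφ : ∀ g, 0 ≤ φ g)
    (hfin : (Function.support φ).Finite) {f : G → ℝ} (hf : (Function.support f).Finite) :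
    dirichletForm φ f ≤ ENNReal.ofReal (∑ y ∈ hfin.toFinset, φ y * energy f y) := by
  rw [dirichletForm_eq hφ hf, tsum_eq_sum (s := hfin.toFinset) fun y hy => by
    have : φ y = 0 := by simpa using hy
    simp [this], ENNReal.ofReal_sum_of_nonneg fun y _ => mul_nonneg (hφ y) (energy_nonneg _ _)]
  calc _ ≤ (1 : ℝ≥0∞) * ∑ y ∈ hfin.toFinset, ENNReal.ofReal (φ y * energy f y) := by
        gcongr with y _
        · rw [ENNReal.div_le_iff two_ne_zero ENNReal.ofNat_ne_top]
          norm_num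
        · rw [ENNReal.ofReal_mul (hφ y)]
    _ = _ := one_mul _

theorem exists_spectralProfile_le_inv_sq (z : Fin k) {φ : houghtonGroup k → ℝ}
    (hφ : ∀ g, 0 ≤ φ g) (hfin : (Function.support φ).Finite) :
    ∃ c : ℝ, 0 < c ∧ ∀ v : ℝ, 1 ≤ v →
      spectralProfile φ v ≤ ENNReal.ofReal (c * (logRatio v ^ 2)⁻¹) := by
  choose C hC hE using fun y : houghtonGroup k => exists_energy_scaledTent_le z y
  have hs1 : 0 ≤ ∑ y ∈ hfin.toFinset, φ y * C y :=
    Finset.sum_nonneg fun y _ => mul_nonneg (hφ y) (hC y)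
  have hs2 : 0 ≤ ∑ y ∈ hfin.toFinset, φ y := Finset.sum_nonneg fun y _ => hφ y
  refine exists_spectralProfile_le z (W := stepRate .simple)
    (C := ∑ y ∈ hfin.toFinset, φ y * C y + 4 * ∑ y ∈ hfin.toFinset, φ y + 1)
    (fun t ht => stepRate_pos (by simp) ht) (fun s t => stepRate_anti _)
    (fun K hK => exists_stepRate_le_mul _ hK) (by positivity) (fun r hr => ?_) fun f Ω hf => ?_
  · have hr0 : (0 : ℝ) < r := by exact_mod_cast hr
    have hS := sum_sq_scaledTent_pos z hr
    refine (dirichletForm_le_of_finite_support hφ hfin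
      ((scaledSet k r).finite_toSet.subset (support_scaledTent_subset r))).trans
      (ENNReal.ofReal_le_ofReal ?_)
    set S := ∑ x ∈ scaledSet k r, scaledTent k r x ^ 2
    calc _ ≤ ∑ y ∈ hfin.toFinset, φ y * (C y * ((r : ℝ) ^ 2)⁻¹ * S) :=
          Finset.sum_le_sum fun y _ => mul_le_mul_of_nonneg_left (hE y r hr) (hφ y)
      _ = (∑ y ∈ hfin.toFinset, φ y * C y) * ((r : ℝ) ^ 2)⁻¹ * S := by
          rw [Finset.sum_mul, Finset.sum_mul]
          exact Finset.sum_congr rfl fun y _ => by ring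
      _ ≤ _ := by
          rw [stepRate]
          gcongr
          linarith
  · have hS : 0 ≤ ∑ x ∈ Ω, f x ^ 2 := Finset.sum_nonneg fun _ _ => sq_nonneg _
    refine (dirichletForm_le_of_finite_support hφ hfin (Ω.finite_toSet.subset hf)).trans
      (ENNReal.ofReal_le_ofReal ?_)
    calc _ ≤ ∑ y ∈ hfin.toFinset, φ y * (4 * ∑ x ∈ Ω, f x ^ 2) :=
          Finset.sum_le_sum fun y _ => mul_le_mul_of_nonneg_left (energy_le_four hf y) (hφ y)
      _ = 4 * (∑ y ∈ hfin.toFinset, φ y) * ∑ x ∈ Ω, f x ^ 2 := by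
          rw [← Finset.sum_mul]
          ring
      _ ≤ _ := by
          gcongr
          linarith

theorem ProfileEquiv.of_one_le {G : Type*} [Group G] {φ : G → ℝ} {F : ℝ → ℝ} {c c' : ℝ}
    (hc : 0 < c) (hc' : 0 < c')
    (hl : ∀ v, 1 ≤ v → ENNReal.ofReal (c * F v) ≤ spectralProfile φ v)
    (hu : ∀ v, 1 ≤ v → spectralProfile φ v ≤ ENNReal.ofReal (c' * F v)) :
    ProfileEquiv (spectralProfile φ) F := by
  refine ⟨c, 1, c', 1, hc, one_pos, hc', one_pos, fun v _ => ?_, fun v hv => ?_⟩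
  · rw [one_mul]
    rcases lt_or_ge v 1 with h | h
    · rw [spectralProfile_of_lt_one φ h]
      exact le_top
    · exact hl v h
  · rw [one_mul]
    exact hu v hv

end Conclusion

end

theorem theorem4p4 (k : ℕ) (hk : 3 ≤ k) :
    (∀ α : RayPair k → StepIndex,
      (∃ e e' : RayPair k, e ≠ e' ∧ α e ≠ StepIndex.trivial ∧ α e' ≠ StepIndex.trivial) →
      ProfileEquiv (spectralProfile (houghtonMeasure fun e => stepMeasure (α e)))
        (fun v => decrInverse (maxRho α) (logRatio v))) ∧
    (∀ φ : houghtonGroup k → ℝ, IsSymmProb φ → (Function.support φ).Finite →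
      Subgroup.closure (Function.support φ) = ⊤ →
      ProfileEquiv (spectralProfile φ) (fun v => (logRatio v ^ 2)⁻¹)) := by
  refine ⟨fun α hα => ?_, fun φ hφ hfin hgen => ?_⟩
  · obtain ⟨c, hc, hl⟩ := exists_decrInverse_le_spectralProfile (by omega) α hα
    obtain ⟨e₀, -, -, he₀, -⟩ := hα
    obtain ⟨c', hc', hu⟩ := exists_spectralProfile_le_decrInverse (by omega) α he₀
    exact ProfileEquiv.of_one_le hc hc' hl hu
  · let e : RayPair k := ⟨(⟨0, by omega⟩, ⟨1, by omega⟩), by simp⟩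
    let e' : RayPair k := ⟨(⟨0, by omega⟩, ⟨2, by omega⟩), by simp⟩
    have hne : e ≠ e' := by simp [e, e']
    obtain ⟨c, hc, hl⟩ := exists_inv_sq_le_spectralProfile hne hφ.nonneg hgen
    obtain ⟨c', hc', hu⟩ := exists_spectralProfile_le_inv_sq e.1.1 hφ.nonneg hfin
    exact ProfileEquiv.of_one_le hc hc' hl hu
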